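/- Let $n\ge 1$. **Descending plane partitions.** A descending plane partition is a shifted array $\pi=(\pi_{i,j})_{1\le i\le k,\ i\le j\le\lambda_i}$ of positive integers such that $\lambda_1\ge\lambda_2\ge\dots\ge\lambda_k\ge k$, rows are weakly decreasing, columns are strictly decreasing, and the first entry of each row is greater than the number of entries in its own row and does not exceed the number of entries in the preceding row. Let $D_n$ be the set of descending plane partitions with entries $\le n$ (including the empty one), ordered by: $\pi\le\sigma$ if, for all $i,j$, whenever $\pi_{i,j}$ exists then $\sigma_{i,j}$ exists and $\pi_{i,j}\le\sigma_{i,j}$. For $\pi\in D_n$ let $r(\pi)$ be the number of entries equal to $n$, $s(\pi)$ the number of entries with $\pi_{i,j}\le j-i$, and $i(\pi)$ the total number of entries. **Tilings.** Let $H_n$ be the hexagon in the triangular lattice with angles $120^\circ$ and side lengths $n-1,n+1,n-1,n+1,n-1,n+1$ from whose centre an equilateral triangle of side length $2$ (with sides parallel to the long sides of the hexagon, pointing left, with a vertical right side) has been removed. Let $\mathcal T_n$ be the set of tilings of $H_n$ by unit rhombi with angles $60^\circ$ and $120^\circ$, each the union of two adjacent unit lattice triangles, that are invariant under rotation by $120^\circ$.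 Let the fundamental region be the part of $H_n$ on or to the right of the vertical line through the vertical side of the hole, and on or above the line through the lower left side of the hole. **Reading off.** In the fundamental region, follow the paths of rhombi that start at the (horizontally oriented) rhombi cut in two by the left border, cross only edges pointing from south-west to north-east (hence run through horizontally oriented rhombi and rhombi oriented south-west/north-east), and end at the rhombi cut in two by the bottom border. Each path, viewed as a lattice path on the square grid with height $0$ along the bottom border, contributes one row: the height of its starting point followed by the positive heights of its horizontal steps, paths being read from top to bottom. **Moves.** An ordinary move replaces, in a unit hexagon tiled by three rhombi, the tiling in which the horizontally oriented rhombus is at the bottom by the one in which it is at the top, simultaneously with the two rotated copies of this replacement. The special move replaces the three rhombi without south-west/north-east edges that are stacked along the vertical side of the hole, together with their rotated copies, by two south-west/north-east oriented rhombi along that side and one horizontally oriented rhombus above them which is cut in two by the left border, together with their rotated copies. **Claim.** 1. $D_n$ is a lattice. Reading off defines a bijection $\Phi:\mathcal T_n\to D_n$, and for $T,U\in\mathcal T_n$: $\Phi(T)\le\Phi(U)$ if and only if $U$ results from $T$ by a finite (possibly empty) sequence of moves, and $\Phi(U)$ covers $\Phi(T)$ if and only if $U$ results from $T$ by one move. 2.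 There is exactly one antiautomorphism (order-reversing bijection whose inverse is order-reversing) $\tau$ of $D_n$, and under $\Phi$ it corresponds to the reflection of tilings in the horizontal symmetry axis of $H_n$, and likewise to the reflection in each of the other symmetry axes of $H_n$: $\tau(\Phi(T))=\Phi(\rho(T))$ for each such reflection $\rho$ and every $T\in\mathcal T_n$. 3. For every $\pi\in D_n$, $$r(\pi)+r(\tau(\pi))=n-1,\qquad s(\tau(\pi))=s(\pi),\qquad i(\pi)+i(\tau(\pi))=\binom n2+s(\pi).$$ -/

import Mathlib

/-! ### Descending plane partitions -/

/-- The entry in row `i` and column `j` (both counted from `0`) of a shifted array given by its list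
of rows: row `i` starts in column `i`.  The value is `none` if there is no such entry. -/
def shiftedEntry (rows : List (List ℕ)) (i j : ℕ) : Option ℕ :=
  if i ≤ j then (rows[i]?).bind (fun row => row[j - i]?) else none

/-- The number of entries in row `i`. -/
def rowLength (rows : List (List ℕ)) (i : ℕ) : ℕ :=
  (rows.getD i []).length

/-- The number of the last column that is reached by row `i`, columns being counted from `1`
(this is `λ_{i+1}` if the rows are counted from `1`). -/
def rowEnd (rows : List (List ℕ)) (i : ℕ) : ℕ :=
  i + rowLength rows i

/-- A descending plane partition: a shifted array of positive integers with
`λ₁ ≥ λ₂ ≥ ⋯ ≥ λ_k ≥ k`, weakly decreasing rows, strictly decreasing columns, in which the first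
entry of each row is greater than the number of entries in its own row and does not exceed the
number of entries in the preceding row. -/
@[ext]
structure DescendingPlanePartition where
  rows : List (List ℕ)
  pos : ∀ row ∈ rows, ∀ a ∈ row, 0 < a
  rowEnd_antitone : ∀ i, i + 1 < rows.length → rowEnd rows (i + 1) ≤ rowEnd rows i
  length_le_rowEnd : ∀ i, i < rows.length → rows.length ≤ rowEnd rows i
  row_weak : ∀ i j a b, shiftedEntry rows i j = some a → shiftedEntry rows i (j + 1) = some b →
    b ≤ a
  col_strict : ∀ i j a b, shiftedEntry rows i j = some a → shiftedEntry rows (i + 1) j = some b →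
    b < a
  first_gt : ∀ i a, shiftedEntry rows i i = some a → rowLength rows i < a
  first_le : ∀ i a, shiftedEntry rows (i + 1) (i + 1) = some a → a ≤ rowLength rows i

namespace DescendingPlanePartition

/-- `π.entry i j` is the entry of `π` in row `i` and column `j`, if it exists. -/
def entry (π : DescendingPlanePartition) (i j : ℕ) : Option ℕ :=
  shiftedEntry π.rows i j

theorem rowLength_pos (π : DescendingPlanePartition) (i : ℕ) (hi : i < π.rows.length) :
    0 < rowLength π.rows i := by
  have h := π.length_le_rowEnd i hi
  unfold rowEnd at h
  omega

theorem ext_entry {π σ : DescendingPlanePartition} (h : ∀ i j, π.entry i j = σ.entry i j) :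
    π = σ := by
  have key : ∀ (α β : DescendingPlanePartition), (∀ i j, α.entry i j = β.entry i j) →
      α.rows.length ≤ β.rows.length := by
    intro α β hab
    by_contra hlt
    push Not at hlt
    have h1 := α.rowLength_pos _ hlt
    have h2 := hab β.rows.length β.rows.length
    simp only [rowLength, List.getD_eq_getElem?_getD, List.getElem?_eq_getElem hlt,
      Option.getD_some] at h1
    simp [entry, shiftedEntry, List.getElem?_eq_getElem hlt] at h2
    rw [h2] at h1
    simp at h1
  have hlen : π.rows.length = σ.rows.length := le_antisymm (key _ _ h) (key _ _ fun i j => (h i j).symm)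
  apply DescendingPlanePartition.ext
  apply List.ext_getElem hlen
  intro i h1 h2
  apply List.ext_getElem?
  intro m
  have := h i (i + m)
  simpa [entry, shiftedEntry, List.getElem?_eq_getElem h1, List.getElem?_eq_getElem h2] using this

/-- The Mills–Robbins–Rumsey order: `π ≤ σ` if, whenever `π_{i,j}` exists, then `σ_{i,j}` also
exists and `π_{i,j} ≤ σ_{i,j}`. -/
instance : PartialOrder DescendingPlanePartition where
  le π σ := ∀ i j a, π.entry i j = some a → ∃ b, σ.entry i j = some b ∧ a ≤ b
  le_refl π := fun i j a h => ⟨a, h, le_rfl⟩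
  le_trans π σ ρ h1 h2 := by
    intro i j a h
    obtain ⟨b, hb, hab⟩ := h1 i j a h
    obtain ⟨c, hc, hbc⟩ := h2 i j b hb
    exact ⟨c, hc, hab.trans hbc⟩
  le_antisymm π σ h1 h2 := by
    apply ext_entry
    intro i j
    cases hp : π.entry i j with
    | none =>
      cases hs : σ.entry i j with
      | none => rfl
      | some b =>
        obtain ⟨c, hc, -⟩ := h2 i j b hs
        simp [hp] at hc
    | some a =>
      obtain ⟨b, hb, hab⟩ := h1 i j a hp
      obtain ⟨c, hc, hbc⟩ := h2 i j b hb
      rw [hp] at hc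
      cases hc
      rw [hb, le_antisymm hab hbc]

/-- `r(π)`: the number of entries of `π` that are equal to `n`. -/
def r (n : ℕ) (π : DescendingPlanePartition) : ℕ :=
  π.rows.flatten.count n

/-- `s(π)`: the number of special entries of `π`, that is, of entries with `π_{i,j} ≤ j - i`.
(`List.zipIdx` pairs the entry `π_{i,j}` with its offset `j - i` in its row.) -/
def s (π : DescendingPlanePartition) : ℕ :=
  (π.rows.map fun row => row.zipIdx.countP fun q => q.1 ≤ q.2).sum

/-- `i(π)`: the total number of entries of `π`. -/
def i (π : DescendingPlanePartition) : ℕ :=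
  π.rows.flatten.length

end DescendingPlanePartition

/-- Descending plane partitions with entries `≤ n`, ordered as above. -/
abbrev BoundedDPP (n : ℕ) : Type :=
  {π : DescendingPlanePartition // ∀ row ∈ π.rows, ∀ a ∈ row, a ≤ n}

/-! ### The triangular lattice, the hexagon with a triangular hole, and its rhombus tilings

The plane is `{X : Fin 3 → ℝ | X 0 + X 1 + X 2 = 1}`, drawn so that `X 0` increases to the right,
`X 1` to the upper left and `X 2` to the lower left, and scaled so that the lines `X i = k`, `k ∈ ℤ`,
cut it into equilateral triangles of side length `1`.  Rotation by `120°` about the centre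
`(1/3, 1/3, 1/3)` is the cyclic permutation of the coordinates, and the reflections in the three
lines `X i = X j` (`i ≠ j`) through the centre are the transpositions. -/

/-- A unit triangle is given by the vector `c` of the integer parts of the coordinates of its interior
points: it is `{X | ∀ i, c i ≤ X i ≤ c i + 1}`.  The vectors that occur are those with coordinate
sum `0` (the triangles `{X | ∀ i, c i ≤ X i}`, which have their vertical side on the left) and those
with coordinate sum `-1` (the triangles `{X | ∀ i, X i ≤ c i + 1}`, with the vertical side on the
right). -/
def IsUnitTriangle (c : Fin 3 → ℤ) : Prop :=
  ∑ i, c i = 0 ∨ ∑ i, c i = -1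

/-- The unit triangles in the hexagon `{X | ∀ i, -n ≤ X i ≤ n}`.  Its sides on the lines
`X i = n` have length `n + 1`, those on the lines `X i = -n` have length `n - 1`, and the two kinds
alternate. -/
def hexagon (n : ℕ) : Set (Fin 3 → ℤ) :=
  {c | IsUnitTriangle c ∧ ∀ i, -(n : ℤ) ≤ c i ∧ c i < n}

/-- The unit triangles in the equilateral triangle `{X | ∀ i, X i ≤ 1}` of side length `2`, whose
centre is the centre of the hexagon. -/
def hole : Set (Fin 3 → ℤ) :=
  {c | IsUnitTriangle c ∧ ∀ i, c i < 1}

/-- The hexagon with side lengths `n-1, n+1, n-1, n+1, n-1, n+1` from which the central equilateral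
triangle with side length `2` has been removed. -/
def holedHexagon (n : ℕ) : Set (Fin 3 → ℤ) :=
  hexagon n \ hole

/-- A rhombus with side length `1`: the union of the unit triangle `base` (of coordinate sum `0`) and
of the unit triangle on the other side of its side on the line `X dir = base dir`. -/
@[ext]
structure Rhombus where
  base : Fin 3 → ℤ
  dir : Fin 3
  sum_base : ∑ i, base i = 0

namespace Rhombus

/-- The other unit triangle of the rhombus. -/
def opp (ρ : Rhombus) : Fin 3 → ℤ :=
  ρ.base - Pi.single ρ.dir 1

/-- The two unit triangles of which a rhombus consists. -/
def cells (ρ : Rhombus) : Set (Fin 3 → ℤ) :=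
  {ρ.base, ρ.opp}

/-- The image of a rhombus under the isometry `X ↦ X ∘ g` of the plane. -/
def perm (g : Equiv.Perm (Fin 3)) (ρ : Rhombus) : Rhombus where
  base := ρ.base ∘ g
  dir := g.symm ρ.dir
  sum_base := by
    rw [← ρ.sum_base]
    exact Equiv.sum_comp g ρ.base

/-- Rotation by `120°` about the centre. -/
def rotate (ρ : Rhombus) : Rhombus :=
  ρ.perm (finRotate 3)

/-- Reflection in the symmetry axis on which the two coordinates other than `X k` are equal; for
`k = 0` this is the horizontal axis. -/
def reflect (k : Fin 3) (ρ : Rhombus) : Rhombus :=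
  ρ.perm (Equiv.swap (k + 1) (k + 2))

theorem perm_opp (g : Equiv.Perm (Fin 3)) (ρ : Rhombus) : (ρ.perm g).opp = ρ.opp ∘ g := by
  funext j
  by_cases h : g j = ρ.dir
  · have h' : j = g.symm ρ.dir := by rw [← h]; simp
    subst h'
    simp [opp, perm]
  · have h' : j ≠ g.symm ρ.dir := fun hj => h (by rw [hj]; simp)
    simp [opp, perm, h, h']

theorem mem_cells_perm (g : Equiv.Perm (Fin 3)) (ρ : Rhombus) (c : Fin 3 → ℤ) :
    c ∈ (ρ.perm g).cells ↔ c ∘ g.symm ∈ ρ.cells := by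
  have aux : ∀ d : Fin 3 → ℤ, c = d ∘ g ↔ c ∘ g.symm = d := by
    intro d
    constructor
    · rintro rfl
      funext j
      simp
    · rintro rfl
      funext j
      simp
  have h1 : c ∈ (ρ.perm g).cells ↔ c = ρ.base ∘ g ∨ c = (ρ.perm g).opp := Iff.rfl
  have h2 : c ∘ g.symm ∈ ρ.cells ↔ c ∘ g.symm = ρ.base ∨ c ∘ g.symm = ρ.opp := Iff.rfl
  rw [h1, h2, perm_opp, aux, aux]

theorem perm_perm (g h : Equiv.Perm (Fin 3)) (ρ : Rhombus) :
    (ρ.perm g).perm h = ρ.perm (g * h) := by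
  ext j
  · rfl
  · simp [perm, Equiv.Perm.mul_def]

theorem reflect_reflect (k : Fin 3) (ρ : Rhombus) : (ρ.reflect k).reflect k = ρ := by
  unfold reflect
  rw [perm_perm, Equiv.swap_mul_self]
  rfl

theorem reflect_rotate (k : Fin 3) (ρ : Rhombus) :
    (ρ.reflect k).rotate = ((ρ.rotate).rotate).reflect k := by
  unfold reflect rotate
  rw [perm_perm, perm_perm, perm_perm]
  congr 1
  revert k
  decide

end Rhombus

theorem holedHexagon_perm (n : ℕ) (g : Equiv.Perm (Fin 3)) (c : Fin 3 → ℤ) :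
    c ∘ g ∈ holedHexagon n ↔ c ∈ holedHexagon n := by
  have hs : ∑ i, (c ∘ g) i = ∑ i, c i := Equiv.sum_comp g c
  have h1 : (∀ i, -(n : ℤ) ≤ (c ∘ g) i ∧ (c ∘ g) i < n) ↔ ∀ i, -(n : ℤ) ≤ c i ∧ c i < n :=
    g.forall_congr_left.trans (by simp)
  have h2 : (∀ i, (c ∘ g) i < 1) ↔ ∀ i, c i < 1 :=
    g.forall_congr_left.trans (by simp)
  simp only [holedHexagon, hexagon, hole, IsUnitTriangle, Set.mem_sdiff, Set.mem_ofPred_eq, hs, h1, h2]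

/-- A cyclically symmetric rhombus tiling of the holed hexagon: a set of rhombi that lie in the
region, such that each unit triangle of the region is covered exactly once, and that is invariant
under rotation by `120°`. -/
@[ext]
structure CyclicTiling (n : ℕ) where
  tiles : Set Rhombus
  cells_subset : ∀ ρ ∈ tiles, ρ.cells ⊆ holedHexagon n
  existsUnique_tile : ∀ c ∈ holedHexagon n, ∃! ρ, ρ ∈ tiles ∧ c ∈ ρ.cells
  rotate_mem : ∀ ρ ∈ tiles, ρ.rotate ∈ tiles

namespace CyclicTiling

variable {n : ℕ}

/-- Reflection of a tiling in the `k`-th symmetry axis. -/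
def reflect (k : Fin 3) (T : CyclicTiling n) : CyclicTiling n where
  tiles := Rhombus.reflect k '' T.tiles
  cells_subset := by
    rintro _ ⟨ρ, hρ, rfl⟩ c hc
    have h := (Rhombus.mem_cells_perm _ _ _).1 hc
    exact (holedHexagon_perm n _ c).1 (T.cells_subset ρ hρ h)
  existsUnique_tile := by
    intro c hc
    have hc' := (holedHexagon_perm n (Equiv.swap (k + 1) (k + 2)).symm c).2 hc
    obtain ⟨ρ, ⟨hρ, hcρ⟩, huniq⟩ := T.existsUnique_tile _ hc'
    refine ⟨ρ.reflect k, ⟨⟨ρ, hρ, rfl⟩, (Rhombus.mem_cells_perm _ _ _).2 hcρ⟩, ?_⟩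
    rintro _ ⟨⟨ρ', hρ', rfl⟩, hc''⟩
    rw [huniq ρ' ⟨hρ', (Rhombus.mem_cells_perm _ _ _).1 hc''⟩]
  rotate_mem := by
    rintro _ ⟨ρ, hρ, rfl⟩
    exact ⟨ρ.rotate.rotate, T.rotate_mem _ (T.rotate_mem _ hρ), (Rhombus.reflect_rotate k ρ).symm⟩

end CyclicTiling

/-! ### The descending plane partition of a tiling

The fundamental region is the part `{X | X 0 ≥ 1, X 2 ≤ 1}` of the holed hexagon: its left border
lies on the line `X 0 = 1` and contains a side of the hole, its bottom border lies on the line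
`X 2 = 1`.  The horizontally oriented rhombi are those with `dir = 0`. The rhombi with `dir = 2` are
oriented south-west/north-east.  Paths follow the rhombi of these two kinds, from left to right and
downwards, crossing the edges that point from south-west to north-east, which are the edges on the
lines `X 1 = const`. -/

namespace Rhombus

/-- The rhombus is cut in two by the left border of the fundamental region. -/
def CutByLeftBorder (ρ : Rhombus) : Prop :=
  ρ.dir = 0 ∧ ρ.base 0 = 1 ∧ ρ.base 2 < 1

/-- The rhombus is cut in two by the bottom border of the fundamental region. -/
def CutByBottomBorder (ρ : Rhombus) : Prop :=
  ρ.dir = 2 ∧ ρ.base 2 = 1 ∧ 1 ≤ ρ.base 0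

/-- Two rhombi that are not of direction `1`, such that the lower right one of the two edges of `ρ`
on lines `X 1 = const` (which separates the unit triangles `ρ.base` and `ρ.base - e₁`) is the upper
left one of the two such edges of `ρ'` (which bounds `ρ'.opp` from above). -/
def PathStep (ρ ρ' : Rhombus) : Prop :=
  ρ.dir ≠ 1 ∧ ρ'.dir ≠ 1 ∧ ρ'.opp = ρ.base - Pi.single 1 1

/-- The height of a horizontally oriented rhombus of the fundamental region, that is, the height of
the corresponding horizontal step of a path after the paths have been deformed to lattice paths on the
square grid, the height being `0` along the bottom border.  For a rhombus that is cut by the left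
border it is the height of the starting point of the path. -/
def height (ρ : Rhombus) : ℕ :=
  (-ρ.base 2).toNat

end Rhombus

namespace CyclicTiling

variable {n : ℕ}

/-- `P` is one of the paths of rhombi of the tiling `T` that connect the rhombi cut by the left
border with those cut by the bottom border of the fundamental region. -/
def IsPath (T : CyclicTiling n) (P : List Rhombus) : Prop :=
  (∀ ρ ∈ P, ρ ∈ T.tiles) ∧ P.IsChain Rhombus.PathStep ∧
    (∃ ρ, P.head? = some ρ ∧ ρ.CutByLeftBorder) ∧
    (∃ ρ, P.getLast? = some ρ ∧ ρ.CutByBottomBorder)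

/-- The row that is read off from a path: the height of its starting point, followed by the heights
of its horizontal steps, where steps at height `0` do not contribute. -/
def pathRow (P : List Rhombus) : List ℕ :=
  ((P.filter fun ρ => ρ.dir = 0).map Rhombus.height).filter fun a => 0 < a

/-- `π` is the descending plane partition that is read off from the tiling `T`: its rows are the rows
read off from the paths of `T`.  (Different paths have different starting points, hence give different
rows, and the first entries of the rows of `π` are strictly decreasing, so that the order of the rows
is determined: they are read from the topmost path to the lowest one.) -/
def ReadsOff (T : CyclicTiling n) (π : BoundedDPP n) : Prop :=
  ∀ row : List ℕ, row ∈ π.1.rows ↔ ∃ P, T.IsPath P ∧ pathRow P = row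

end CyclicTiling

/-! ### Local moves on tilings -/

/-- The union of a set of rhombi and its rotations by `120°` and `240°` about the centre. -/
def rotations (A : Set Rhombus) : Set Rhombus :=
  {ρ | ρ ∈ A ∨ ρ.rotate ∈ A ∨ ρ.rotate.rotate ∈ A}

/-- The tiling by three rhombi of the unit hexagon with centre at the lattice point `p`
(`p 0 + p 1 + p 2 = 1`), before an ordinary move: the horizontally oriented rhombus is at the
bottom. -/
def flipBefore (p : Fin 3 → ℤ) : Set Rhombus :=
  {ρ | ∃ i : Fin 3, ρ.base = p - Pi.single i 1 ∧ ρ.dir = i + 2}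

/-- The tiling by three rhombi of the unit hexagon with centre `p`, after an ordinary move: the
horizontally oriented rhombus is at the top. -/
def flipAfter (p : Fin 3 → ℤ) : Set Rhombus :=
  {ρ | ∃ i : Fin 3, ρ.base = p - Pi.single i 1 ∧ ρ.dir = i + 1}

/-- Before the special move: three rhombi of direction `1` stacked along the vertical side of the
hole. -/
def specialBefore : Set Rhombus :=
  {ρ | (ρ.base = ![1, 1, -2] ∧ ρ.dir = 1) ∨ (ρ.base = ![1, 0, -1] ∧ ρ.dir = 1) ∨
    (ρ.base = ![1, -1, 0] ∧ ρ.dir = 1)}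

/-- After the special move: a horizontally oriented rhombus above the upper end of the vertical side
of the hole, cut by the left border of the fundamental region, and two rhombi of direction `2` along
that side. -/
def specialAfter : Set Rhombus :=
  {ρ | (ρ.base = ![1, 1, -2] ∧ ρ.dir = 0) ∨ (ρ.base = ![1, 0, -1] ∧ ρ.dir = 2) ∨
    (ρ.base = ![1, -1, 0] ∧ ρ.dir = 2)}

namespace CyclicTiling

variable {n : ℕ}

/-- `U` results from `T` by replacing the rhombi in `A` and in its rotations, all of which belong to
`T`, by those in `B` and in its rotations. -/
def Replace (A B : Set Rhombus) (T U : CyclicTiling n) : Prop :=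
  rotations A ⊆ T.tiles ∧ U.tiles = (T.tiles \ rotations A) ∪ rotations B

/-- `U` results from `T` by one local move: an ordinary move in a unit hexagon (and, because of the
cyclic symmetry, in its rotations), or the special move around the hole. -/
def Move (T U : CyclicTiling n) : Prop :=
  (∃ p : Fin 3 → ℤ, ∑ i, p i = 1 ∧ Replace (flipBefore p) (flipAfter p) T U) ∨
    Replace specialBefore specialAfter T U

/-- The order on tilings generated by the local moves: `U` results from `T` by a finite (possibly
empty) sequence of moves. -/
def MoveLE (T U : CyclicTiling n) : Prop :=
  Relation.ReflTransGen Move T U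

end CyclicTiling

/-! A cyclically symmetric tiling is encoded by a height function on the lattice points of a
fundamental region: `N m h` is the number of horizontally oriented rhombi in column `m` at height at
least `h`. That every unit triangle is covered once means that `N` decreases weakly in `m` and in
`h` and that `N m h ≤ N (m + 1) (h + 1) + 1`. Rotational symmetry identifies the border points `(m,
0)` and `(0, m + 2)`, and the hole forces a common height at the three lattice points of its side.

For a descending plane partition, let `N m h` with `1 ≤ h` count the rows whose entry with offset
`m` is at least `h`. Weak rows, strict columns and the two conditions on first entries turn into the
same inequalities, the last two through the gluing at `h = 0`. The path of rhombi with index `i`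
follows the places where `N` passes from `i + 1` to `i`, so reading off realises this identification
(`CyclicTiling.readsOff_iff`).

The entrywise order is the pointwise order of height arrays, which are closed under `max` and `min`.
A cover raises `N` by one at a single lattice point together with the points identified with it
(`HeightArray.covBy_iff`); in the tiling this is an ordinary move, or the special move if the point
lies on the side of the hole (`CyclicTiling.move_iff`). Reflection complements heights with respect
to their upper bounds, hence reverses the order; the three statistics are sums of values of `N`, and
the identities hold column by column.

Uniqueness of the antiautomorphism is the absence of nontrivial automorphisms
(`HeightArray.apply_eq`). An automorphism permutes the sup-prime arrays, which are the least arrays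
with a prescribed positive value at a site. Such an array is determined by the sup-prime arrays
strictly below it, except that `basic n 0 4 1` and `basic n 1 1 1` share theirs;
`HeightArray.not_swap` shows, by looking at arrays above these two, that they cannot be exchanged.
-/

/-! ### Height arrays -/

/-- The height functions of cyclically symmetric tilings, restricted to a fundamental region. -/
@[ext]
structure HeightArray (n : ℕ) where
  toFun : ℕ → ℕ → ℕ
  succ_right_le : ∀ m h, toFun m (h + 1) ≤ toFun m h
  succ_left_le : ∀ m h, toFun (m + 1) h ≤ toFun m h
  le_succ_succ : ∀ m h, toFun m h ≤ toFun (m + 1) (h + 1) + 1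
  -- These two lattice points, on the bottom and on the left border, are rotations of each other.
  glue : ∀ m, toFun m 0 = toFun 0 (m + 2)
  -- Together with `glue 0` this makes the height constant along the side of the hole.
  hole : toFun 0 1 = toFun 0 2
  bound : toFun 0 (n + 1) = 0

namespace HeightArray

variable {n : ℕ}

instance : CoeFun (HeightArray n) fun _ => ℕ → ℕ → ℕ := ⟨toFun⟩

theorem toFun_injective : Function.Injective (toFun : HeightArray n → ℕ → ℕ → ℕ) := by
  intro N N' h
  exact HeightArray.ext h

theorem ext_apply {N N' : HeightArray n} (h : ∀ m k, N m k = N' m k) : N = N' :=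
  HeightArray.ext (funext fun m => funext fun k => h m k)

instance : PartialOrder (HeightArray n) := PartialOrder.lift toFun toFun_injective

theorem le_def {N N' : HeightArray n} : N ≤ N' ↔ ∀ m h, N m h ≤ N' m h := Iff.rfl

theorem antitone_right (N : HeightArray n) (m : ℕ) : Antitone (N m) :=
  antitone_nat_of_succ_le (N.succ_right_le m)

theorem antitone_left (N : HeightArray n) (h : ℕ) : Antitone fun m => N m h :=
  antitone_nat_of_succ_le fun m => N.succ_left_le m h

theorem antitone (N : HeightArray n) {m m' h h' : ℕ} (hm : m ≤ m') (hh : h ≤ h') :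
    N m' h' ≤ N m h :=
  (N.antitone_right m' hh).trans (N.antitone_left h hm)

theorem le_add_add (N : HeightArray n) (m h d : ℕ) : N m h ≤ N (m + d) (h + d) + d := by
  induction d with
  | zero => simp
  | succ d ih =>
    have := N.le_succ_succ (m + d) (h + d)
    simp only [← add_assoc] at *
    omega

/-- Moving along the diagonal costs at most one per step, and moving back left or down is free by
monotonicity. The minimal arrays `basic` are built from this distance. -/
theorem le_add_max (N : HeightArray n) (m h m' h' : ℕ) :
    N m h ≤ N m' h' + max (m' - m) (h' - h) := by
  refine (N.le_add_add m h (max (m' - m) (h' - h))).trans ?_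
  gcongr
  apply N.antitone <;> omega

theorem eq_zero_of_lt (N : HeightArray n) {m h : ℕ} (hh : n < h) : N m h = 0 := by
  have h1 := N.bound
  have h2 := N.antitone (Nat.zero_le m) (show n + 1 ≤ h from hh)
  omega

/-- Column `m` is bounded by its value at height `0`, which is glued to `(0, m + 2)`, beyond the
height `n`. -/
theorem eq_zero_of_le (N : HeightArray n) {m h : ℕ} (hm : n ≤ m + 1) : N m h = 0 := by
  have h1 := N.bound
  have h2 := N.antitone (le_refl m) (Nat.zero_le h)
  have h3 := N.glue m
  have h4 := N.antitone (le_refl 0) (show n + 1 ≤ m + 2 by omega)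
  omega

/-- After `n - 1 - m` diagonal steps the column `n - 1` is reached, where all heights vanish. -/
theorem le_left (N : HeightArray n) (m h : ℕ) : N m h ≤ n - 1 - m := by
  have h1 := N.le_add_add m h (n - 1 - m)
  have h2 : N (m + (n - 1 - m)) (h + (n - 1 - m)) = 0 := N.eq_zero_of_le (by omega)
  omega

theorem le_right (N : HeightArray n) (m h : ℕ) : N m h ≤ n + 1 - h := by
  have h1 := N.le_add_add m h (n + 1 - h)
  have h2 : N (m + (n + 1 - h)) (h + (n + 1 - h)) = 0 := N.eq_zero_of_lt (by omega)
  omega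

instance : Finite (HeightArray n) := by
  let F : HeightArray n → Fin n → Fin (n + 1) → Fin (n + 1) := fun N m h =>
    ⟨N m h, by have := N.le_left m h; omega⟩
  apply Finite.of_injective F
  intro N N' h
  apply ext_apply
  intro m k
  by_cases hm : m < n
  · by_cases hk : k < n + 1
    · have := congrFun (congrFun h ⟨m, hm⟩) ⟨k, hk⟩
      simpa [F] using this
    · rw [N.eq_zero_of_lt (by omega), N'.eq_zero_of_lt (by omega)]
  · rw [N.eq_zero_of_le (by omega), N'.eq_zero_of_le (by omega)]

/-- Height arrays are closed under pointwise maxima. -/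
def sup (N N' : HeightArray n) : HeightArray n where
  toFun m h := max (N m h) (N' m h)
  succ_right_le m h := max_le_max (N.succ_right_le m h) (N'.succ_right_le m h)
  succ_left_le m h := max_le_max (N.succ_left_le m h) (N'.succ_left_le m h)
  le_succ_succ m h := by
    have := N.le_succ_succ m h
    have := N'.le_succ_succ m h
    omega
  glue m := by rw [N.glue, N'.glue]
  hole := by rw [N.hole, N'.hole]
  bound := by rw [N.bound, N'.bound]; rfl

/-- Height arrays are closed under pointwise minima. -/
def inf (N N' : HeightArray n) : HeightArray n where
  toFun m h := min (N m h) (N' m h)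
  succ_right_le m h := min_le_min (N.succ_right_le m h) (N'.succ_right_le m h)
  succ_left_le m h := min_le_min (N.succ_left_le m h) (N'.succ_left_le m h)
  le_succ_succ m h := by
    have := N.le_succ_succ m h
    have := N'.le_succ_succ m h
    omega
  glue m := by rw [N.glue, N'.glue]
  hole := by rw [N.hole, N'.hole]
  bound := by rw [N.bound, N'.bound]; rfl

instance : Lattice (HeightArray n) where
  sup := sup
  inf := inf
  le_sup_left _ _ _ _ := le_max_left _ _
  le_sup_right _ _ _ _ := le_max_right _ _
  sup_le _ _ _ h1 h2 m h := max_le (h1 m h) (h2 m h)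
  inf_le_left _ _ _ _ := min_le_left _ _
  inf_le_right _ _ _ _ := min_le_right _ _
  le_inf _ _ _ h1 h2 m h := le_min (h1 m h) (h2 m h)

/-! ### Reflection -/

/-- The effect of the reflections on height arrays. -/
def reflect (N : HeightArray n) : HeightArray n where
  toFun m h := if h ≤ m + 2 then n - 1 - m - N m (m + 2 - h) else n + 1 - h - N (h - m - 2) h
  succ_right_le m h := by
    split_ifs with h1 h2
    · have := N.succ_right_le m (m + 2 - (h + 1))
      rw [show m + 2 - (h + 1) + 1 = m + 2 - h by omega] at this
      omega
    · omega
    -- The two formulas meet here; they are compared through `N m 0 = N 0 (m + 2)`.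
    · obtain rfl : h = m + 2 := by omega
      have h3 := N.le_succ_succ 0 (m + 2)
      have h4 := N.glue m
      have h5 := N.le_right 1 (m + 3)
      rw [show m + 2 + 1 - m - 2 = 1 by omega, show m + 2 - (m + 2) = 0 by omega,
        show m + 2 + 1 = m + 3 by omega] at *
      simp only [zero_add] at h3
      omega
    · have h3 := N.le_succ_succ (h - m - 2) h
      have h5 := N.le_right (h - m - 2 + 1) (h + 1)
      rw [show h + 1 - m - 2 = h - m - 2 + 1 by omega]
      omega
  succ_left_le m h := by
    split_ifs with h1 h2 h2
    · have h3 := N.le_succ_succ m (m + 2 - h)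
      rw [show m + 2 - h + 1 = m + 1 + 2 - h by omega] at h3
      omega
    · obtain rfl : h = m + 3 := by omega
      have h4 := N.glue (m + 1)
      have h3 := N.succ_left_le 0 (m + 3)
      rw [show m + 1 + 2 - (m + 3) = 0 by omega, show m + 3 - m - 2 = 1 by omega]
      simp only [zero_add] at h3
      rw [show m + 1 + 2 = m + 3 by omega] at h4
      omega
    · omega
    · have h3 := N.succ_left_le (h - (m + 1) - 2) h
      rw [show h - (m + 1) - 2 + 1 = h - m - 2 by omega] at h3
      omega
  le_succ_succ m h := by
    split_ifs with h1 h2 h2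
    · have h3 := N.succ_left_le m (m + 2 - h)
      rw [show m + 1 + 2 - (h + 1) = m + 2 - h by omega]
      omega
    · omega
    · omega
    · have h3 := N.succ_right_le (h - m - 2) h
      rw [show h + 1 - (m + 1) - 2 = h - m - 2 by omega]
      omega
  glue m := by
    have h3 := N.glue m
    rcases Nat.eq_zero_or_pos m with rfl | hm
    · have := N.hole
      simp_all
    · rw [if_pos (by omega), if_neg (by omega), show m + 2 - 0 - 2 = m by omega, Nat.sub_zero]
      omega
  hole := by
    have h3 := N.glue 0
    have h4 := N.hole
    simp_all
  bound := by
    split_ifs with h1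
    · omega
    · omega

theorem reflect_apply_of_le (N : HeightArray n) {m h : ℕ} (hh : h ≤ m + 2) :
    N.reflect m h = n - 1 - m - N m (m + 2 - h) := if_pos hh

/-- On the line `h = m + 2` both formulas are valid, by gluing. -/
theorem reflect_apply_of_ge (N : HeightArray n) {m h : ℕ} (hh : m + 2 ≤ h) :
    N.reflect m h = n + 1 - h - N (h - m - 2) h := by
  rcases hh.eq_or_lt with rfl | hh
  · rw [reflect_apply_of_le _ le_rfl]
    have := N.glue m
    rw [show m + 2 - (m + 2) = 0 by omega, show m + 2 - m - 2 = 0 by omega]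
    omega
  · exact if_neg (by omega)

/-- Both formulas complement a value with respect to a bound that it never exceeds, so the truncated
subtractions cancel. -/
theorem reflect_reflect (N : HeightArray n) : N.reflect.reflect = N := by
  apply ext_apply
  intro m h
  by_cases hh : h ≤ m + 2
  · rw [reflect_apply_of_le _ hh, reflect_apply_of_le _ (by omega),
      show m + 2 - (m + 2 - h) = h by omega]
    have := N.le_left m h
    omega
  · rw [reflect_apply_of_ge _ (by omega), reflect_apply_of_ge _ (by omega),
      show h - (h - m - 2) - 2 = m by omega]
    have := N.le_right m h
    omega

theorem reflect_le_reflect {N N' : HeightArray n} (h : N ≤ N') : N'.reflect ≤ N.reflect := by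
  refine le_def.2 fun m k => ?_
  by_cases hh : k ≤ m + 2
  · rw [reflect_apply_of_le _ hh, reflect_apply_of_le _ hh]
    have := le_def.1 h m (m + 2 - k)
    omega
  · rw [reflect_apply_of_ge _ (by omega), reflect_apply_of_ge _ (by omega)]
    have := le_def.1 h (k - m - 2) k
    omega

/-- Reflection as an antiautomorphism. -/
def reflectIso : HeightArray n ≃o (HeightArray n)ᵒᵈ where
  toFun N := OrderDual.toDual N.reflect
  invFun N := (OrderDual.ofDual N).reflect
  left_inv N := N.reflect_reflect
  right_inv N := (OrderDual.ofDual N).reflect_reflect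
  map_rel_iff' := by
    intro N N'
    change N'.reflect ≤ N.reflect ↔ N ≤ N'
    refine ⟨fun h => ?_, reflect_le_reflect⟩
    have := reflect_le_reflect h
    rwa [reflect_reflect, reflect_reflect] at this

end HeightArray

namespace HeightArray

variable {n : ℕ}

/-! ### Covers -/

/-- The sites `(m, h)` that represent the lattice points of the fundamental region modulo gluing. -/
def IsSite (m h : ℕ) : Prop := 1 ≤ h ∧ (m = 0 → 2 ≤ h)

/-- `(a, b)` is identified with the site `(m, h)`. -/
def Glued (m h a b : ℕ) : Prop :=
  (a = m ∧ b = h) ∨ (m = 0 ∧ b = 0 ∧ a + 2 = h) ∨ (m = 0 ∧ h = 2 ∧ a = 0 ∧ b = 1)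

instance (m h a b : ℕ) : Decidable (Glued m h a b) := by unfold Glued; infer_instance

theorem exists_site_glued (a b : ℕ) : ∃ m h, IsSite m h ∧ Glued m h a b := by
  rcases Nat.eq_zero_or_pos b with rfl | hb
  · exact ⟨0, a + 2, ⟨by omega, by omega⟩, Or.inr (Or.inl ⟨rfl, rfl, rfl⟩)⟩
  · by_cases h : a = 0 ∧ b = 1
    · exact ⟨0, 2, ⟨by omega, by omega⟩, Or.inr (Or.inr ⟨rfl, rfl, h.1, h.2⟩)⟩
    · exact ⟨a, b, ⟨hb, by omega⟩, Or.inl ⟨rfl, rfl⟩⟩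

theorem Glued.apply_eq (N : HeightArray n) {m h a b : ℕ} (hg : Glued m h a b) : N a b = N m h := by
  rcases hg with ⟨rfl, rfl⟩ | ⟨rfl, rfl, rfl⟩ | ⟨rfl, rfl, rfl, rfl⟩
  · rfl
  · exact N.glue a
  · exact N.hole

/-- `N'` arises from `N` by increasing the value at one site by one. -/
def AddAt (N N' : HeightArray n) (m h : ℕ) : Prop :=
  IsSite m h ∧ ∀ a b, N' a b = if Glued m h a b then N a b + 1 else N a b

/-- The value of `N` at the site `(m, h)` can be increased. -/
structure Addable (N : HeightArray n) (m h : ℕ) : Prop where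
  site : IsSite m h
  below : ¬ (m = 0 ∧ h = 2) → N m h < N m (h - 1)
  left : 1 ≤ m → N m h < N (m - 1) h
  diag : N m h ≤ N (m + 1) (h + 1)
  -- The site `(0, h)` is also the point `(h - 2, 0)`, which has a diagonal neighbour of its own.
  diag_glued : m = 0 → N 0 h ≤ N (h - 1) 1
  le_bound : m = 0 → h ≤ n

theorem Addable.exists_addAt {N : HeightArray n} {m h : ℕ} (H : N.Addable m h) :
    ∃ N', AddAt N N' m h := by
  obtain ⟨⟨hs, hs'⟩, h1, h2, h3, h4, h5⟩ := H
  refine ⟨⟨fun a b => if Glued m h a b then N a b + 1 else N a b, ?_, ?_, ?_, ?_, ?_, ?_⟩,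
    ⟨hs, hs'⟩, fun a b => rfl⟩
  · intro a b
    have e := N.succ_right_le a b
    split_ifs with g1 g2 g2 <;> try omega
    rcases g1 with ⟨rfl, rfl⟩ | ⟨rfl, hb, rfl⟩ | ⟨rfl, rfl, rfl, hb⟩
    · rw [Nat.add_sub_cancel] at h1
      refine h1 fun hc => g2 ?_
      unfold Glued
      omega
    · omega
    · exact absurd (show Glued 0 2 0 b by unfold Glued; omega) g2
  · intro a b
    have e := N.succ_left_le a b
    split_ifs with g1 g2 g2 <;> try omega
    rcases g1 with ⟨rfl, rfl⟩ | ⟨rfl, rfl, rfl⟩ | ⟨rfl, rfl, h6, rfl⟩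
    · rw [Nat.add_sub_cancel] at h2
      exact h2 (by omega)
    -- On the bottom border the comparison with the left neighbour becomes, after gluing, the
    -- condition `below` at the site `(0, a + 3)`.
    · have e1 := N.glue a
      have e2 := N.glue (a + 1)
      have := h1 (by omega)
      rw [show a + 1 + 2 - 1 = a + 2 by omega] at this
      omega
    · omega
  · intro a b
    have e := N.le_succ_succ a b
    split_ifs with g1 g2 g2 <;> try omega
    rcases g1 with ⟨rfl, rfl⟩ | ⟨rfl, rfl, rfl⟩ | ⟨rfl, rfl, rfl, rfl⟩
    · omega
    · have e1 := N.glue a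
      have := h4 rfl
      rw [show a + 2 - 1 = a + 1 by omega] at this
      simp only [zero_add]
      omega
    · have e1 := N.hole
      have e2 := N.succ_right_le 1 2
      change N 0 1 + 1 ≤ N 1 2 + 1
      change N 0 2 ≤ N 1 3 at h3
      change N 1 3 ≤ N 1 2 at e2
      omega
  · intro a
    have := N.glue a
    by_cases g1 : Glued m h a 0
    · have g2 : Glued m h 0 (a + 2) := by
        unfold Glued at *
        omega
      rw [if_pos g1, if_pos g2, this]
    · have g2 : ¬ Glued m h 0 (a + 2) := by
        unfold Glued at *
        omega
      rw [if_neg g1, if_neg g2, this]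
  · have := N.hole
    by_cases g1 : Glued m h 0 1
    · have g2 : Glued m h 0 2 := by
        unfold Glued at *
        omega
      rw [if_pos g1, if_pos g2, this]
    · have g2 : ¬ Glued m h 0 2 := by
        unfold Glued at *
        omega
      rw [if_neg g1, if_neg g2, this]
  · rw [if_neg, N.bound]
    unfold Glued
    omega

theorem AddAt.le {N N' : HeightArray n} {m h : ℕ} (H : AddAt N N' m h) : N ≤ N' := by
  refine le_def.2 fun a b => ?_
  rw [H.2]
  split_ifs <;> omega

theorem AddAt.apply_eq {N N' : HeightArray n} {m h : ℕ} (H : AddAt N N' m h) :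
    N' m h = N m h + 1 := by
  have g : Glued m h m h := Or.inl ⟨rfl, rfl⟩
  rw [H.2, if_pos g]

theorem AddAt.le_of_lt {N N' M : HeightArray n} {m h : ℕ} (H : AddAt N N' m h) (hM : N ≤ M)
    (hlt : N m h < M m h) : N' ≤ M := by
  refine le_def.2 fun a b => ?_
  have := le_def.1 hM a b
  rw [H.2]
  split_ifs with g
  · rw [g.apply_eq N, g.apply_eq M]
    omega
  · exact this

theorem AddAt.covBy {N N' : HeightArray n} {m h : ℕ} (H : AddAt N N' m h) : N ⋖ N' := by
  have h1 := H.apply_eq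
  refine ⟨lt_of_le_of_ne H.le fun h => ?_, fun M hM hM' => ?_⟩
  · rw [← h] at h1
    omega
  · have h2 := le_def.1 hM.le
    have h3 := le_def.1 hM'.le
    by_cases hlt : N m h < M m h
    · exact absurd (H.le_of_lt hM.le hlt) hM'.not_ge
    · refine hM.not_ge (le_def.2 fun a b => ?_)
      have h4 := h2 a b
      have h5 := h3 a b
      have h6 := h2 m h
      rw [H.2] at h5
      split_ifs at h5 with g
      · rw [g.apply_eq N, g.apply_eq M]
        omega
      · omega

/-- If the value at a site with `N < N'` cannot be raised, some neighbour blocks it, and the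
inequalities for `N'` give `N < N'` at that neighbour too. Passing to the blocking neighbour lowers
a weight, so this ends at an addable site. -/
theorem exists_addable {N N' : HeightArray n} (hle : N ≤ N') {m h : ℕ} (hs : IsSite m h)
    (hlt : N m h < N' m h) : ∃ m h, N.Addable m h ∧ N m h < N' m h := by
  -- A neighbour below or to the left has equal height and a smaller position term; the summand `2`
  -- ensures this also when `(m, 1)` is followed by `(0, m + 2)`. A diagonal neighbour has height
  -- one less, while its position term grows by at most `4`, whence the factor `5`.
  obtain ⟨c, hc⟩ : ∃ c, c = 5 * N m h + (if m = 0 then h else m + h + 2) := ⟨_, rfl⟩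
  induction c using Nat.strong_induction_on generalizing m h with
  | _ c ih =>
    have key : ∀ a b, N a b < N' a b → ∀ m' h', Glued m' h' a b → IsSite m' h' →
        5 * N a b + (if m' = 0 then h' else m' + h' + 2) < c →
        ∃ m h, N.Addable m h ∧ N m h < N' m h := by
      intro a b hab m' h' g hs' hc'
      rw [g.apply_eq N] at hab hc'
      rw [g.apply_eq N'] at hab
      exact ih _ hc' hs' hab rfl
    by_contra hcon
    have hadd : ¬ N.Addable m h := fun H => hcon ⟨m, h, H, hlt⟩
    have hle' := le_def.1 hle
    obtain ⟨hs1, hs2⟩ := hs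
    refine hadd ⟨⟨hs1, hs2⟩, fun h0 => ?_, fun h0 => ?_, ?_, ?_, ?_⟩
    · by_contra hge
      have e1 := N'.antitone (le_refl m) (show h - 1 ≤ h by omega)
      have e2 := N.antitone (le_refl m) (show h - 1 ≤ h by omega)
      have e3 : N m (h - 1) < N' m (h - 1) := by omega
      by_cases h1 : h = 1
      · subst h1
        refine hcon (key m 0 e3 0 (m + 2) (by unfold Glued; omega) ⟨by omega, by omega⟩ ?_)
        have e4 : N m 0 = N m 1 := by
          simp only [Nat.sub_self] at *
          omega
        rw [if_neg (by omega)] at hc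
        rw [if_pos rfl]
        omega
      · refine hcon (key _ _ e3 m (h - 1) (by unfold Glued; omega) ⟨by omega, by omega⟩ ?_)
        split_ifs at hc ⊢ <;> omega
    · by_contra hge
      have e1 := N'.antitone (show m - 1 ≤ m by omega) (le_refl h)
      have e2 := N.antitone (show m - 1 ≤ m by omega) (le_refl h)
      have e3 : N (m - 1) h < N' (m - 1) h := by omega
      rw [if_neg (by omega)] at hc
      by_cases h1 : m = 1 ∧ h = 1
      · refine hcon (key _ _ e3 0 2 (by unfold Glued; omega) ⟨by omega, by omega⟩ ?_)
        rw [if_pos rfl]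
        omega
      · refine hcon (key _ _ e3 (m - 1) h (by unfold Glued; omega) ⟨by omega, by omega⟩ ?_)
        split_ifs <;> omega
    · by_contra hge
      have e1 := N'.le_succ_succ m h
      refine hcon (key (m + 1) (h + 1) (by omega) (m + 1) (h + 1) (by unfold Glued; omega)
        ⟨by omega, by omega⟩ ?_)
      rw [if_neg (by omega)]
      split_ifs at hc <;> omega
    · rintro rfl
      by_contra hge
      have := hs2 rfl
      have e1 := N'.le_succ_succ (h - 2) 0
      have e2 := N'.glue (h - 2)
      rw [show h - 2 + 1 = h - 1 by omega] at e1
      rw [show h - 2 + 2 = h by omega] at e2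
      rw [if_pos rfl] at hc
      simp only [zero_add] at e1
      refine hcon (key (h - 1) 1 (by omega) (h - 1) 1 (by unfold Glued; omega)
        ⟨by omega, by omega⟩ ?_)
      rw [if_neg (by omega)]
      omega
    · rintro rfl
      by_contra hn
      have := N'.eq_zero_of_lt (m := 0) (h := h) (by omega)
      omega

/-- Raising an addable site where `N < N'` gives an array above `N` and still below `N'`; a cover
leaves no room for it other than `N'`. -/
theorem covBy_iff {N N' : HeightArray n} : N ⋖ N' ↔ ∃ m h, AddAt N N' m h := by
  refine ⟨fun H => ?_, fun ⟨m, h, H⟩ => H.covBy⟩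
  have h1 : ¬ N' ≤ N := H.lt.not_ge
  rw [le_def] at h1
  push Not at h1
  obtain ⟨a, b, hab⟩ := h1
  obtain ⟨m, h, hs, g⟩ := exists_site_glued a b
  rw [g.apply_eq N, g.apply_eq N'] at hab
  obtain ⟨m, h, hadd, hlt⟩ := exists_addable H.le hs hab
  obtain ⟨M, hM⟩ := hadd.exists_addAt
  have h2 := hM.le_of_lt H.le hlt
  rcases h2.lt_or_eq with h3 | rfl
  · exact absurd h3 (H.2 hM.covBy.lt)
  · exact ⟨m, h, hM⟩

/-! ### Join irreducible height arrays -/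

/-- The smallest height array with value at least `k` at `(m, h)`, if there is one. -/
def basic (n m h k : ℕ) : HeightArray n where
  -- The subtracted minimum is the distance of `(y, g)` from `(m, h)`, from the copy `(h - 2, 0)` of
  -- `(0, h)` and from the copy `(0, m + 2)` of `(m, 0)`. The caps on `k` are the distances of `(0,
  -- n + 1)` from two of these points; they make the value vanish there.
  toFun y g := min k (min (n - 1 - m) (n + 1 - h)) -
    min (max (y - m) (g - h)) (min (max (y + 2 - h) g) (max y (g - m - 2)))
  succ_right_le y g := by
    refine Nat.sub_le_sub_left (min_le_min (max_le_max le_rfl ?_) (min_le_min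
      (max_le_max le_rfl ?_) (max_le_max le_rfl ?_))) _ <;> omega
  succ_left_le y g := by
    refine Nat.sub_le_sub_left (min_le_min (max_le_max ?_ le_rfl) (min_le_min
      (max_le_max ?_ le_rfl) (max_le_max ?_ le_rfl))) _ <;> omega
  le_succ_succ y g := by
    have h1 : max (y + 1 - m) (g + 1 - h) ≤ max (y - m) (g - h) + 1 := by omega
    have h2 : max (y + 1 + 2 - h) (g + 1) ≤ max (y + 2 - h) g + 1 := by omega
    have h3 : max (y + 1) (g + 1 - m - 2) ≤ max y (g - m - 2) + 1 := by omega
    omega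
  glue y := by
    congr 1
    omega
  hole := by
    congr 1
    omega
  bound := by
    apply Nat.sub_eq_zero_of_le
    omega

end HeightArray

/-! ### Minimal height arrays as the sup-prime elements, and what their strict lower sets determine.
-/

namespace HeightArray

variable {n : ℕ}

/-- The value of a minimal height array, before clipping at the top. -/
def basicFun (m h k y g : ℕ) : ℕ :=
  k - min (max (y - m) (g - h)) (min (max (y + 2 - h) g) (max y (g - m - 2)))

/-- `(a, b)` has distance at most `d` from `(m, h)`. -/
def Near (m h d a b : ℕ) : Prop :=
  (a ≤ m + d ∧ b ≤ h + d) ∨ (a + 2 ≤ h + d ∧ b ≤ d) ∨ (a ≤ d ∧ b ≤ m + 2 + d)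

/-- The superlevel sets are unions of three rectangles. All later comparisons of minimal arrays
become linear conditions on coordinates in this way. -/
theorem le_basicFun_iff {m h k l a b : ℕ} (hl : 1 ≤ l) :
    l ≤ basicFun m h k a b ↔ l ≤ k ∧ Near m h (k - l) a b := by
  have h1 : ∀ D : ℕ, l ≤ k - D ↔ l ≤ k ∧ D ≤ k - l := fun D => by omega
  unfold basicFun Near
  rw [h1, min_le_iff, min_le_iff, max_le_iff, max_le_iff, max_le_iff, Nat.sub_sub b m 2]
  simp only [tsub_le_iff_left]

theorem basic_apply {m h k : ℕ} (h1 : k ≤ n - 1 - m) (h2 : k ≤ n + 1 - h) (y g : ℕ) :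
    basic n m h k y g = basicFun m h k y g := by
  unfold basic basicFun
  simp only [min_eq_left (le_min h1 h2)]

theorem basic_apply_self {m h k : ℕ} (h1 : k ≤ n - 1 - m) (h2 : k ≤ n + 1 - h) :
    basic n m h k m h = k := by
  rw [basic_apply h1 h2]
  unfold basicFun
  omega

/-- The value `k` is also attained at `(m, 0)` and `(0, h)`, hence at the points glued to them, and
from each of these points the height falls by at most the distance. -/
theorem basic_le {N : HeightArray n} {m h k : ℕ} (hk : k ≤ N m h) (hh : 1 ≤ h) :
    basic n m h k ≤ N := by
  refine le_def.2 fun y g => ?_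
  rw [basic_apply (hk.trans (N.le_left m h)) (hk.trans (N.le_right m h))]
  have e1 := N.le_add_max m h y g
  have e2 := N.antitone (le_refl m) (Nat.zero_le h)
  have e3 := N.antitone (Nat.zero_le m) (le_refl h)
  have e4 := N.le_add_max 0 (m + 2) y g
  rw [N.glue m] at e2
  unfold basicFun
  by_cases hh2 : 2 ≤ h
  · have e5 := N.le_add_max (h - 2) 0 y g
    have e6 := N.glue (h - 2)
    rw [show h - 2 + 2 = h by omega] at e6
    have e7 : max (y - (h - 2)) (g - 0) = max (y + 2 - h) g := by omega
    have e8 : max (y - 0) (g - (m + 2)) = max y (g - m - 2) := by omega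
    rw [e7] at e5
    rw [e8] at e4
    omega
  -- For `h = 1` there is no point `(h - 2, 0)`, but then the second distance is at least the third
  -- and does not affect the minimum.
  · have e8 : max (y - 0) (g - (m + 2)) = max y (g - m - 2) := by omega
    rw [e8] at e4
    omega

theorem basic_le_iff {N : HeightArray n} {m h k : ℕ} (hh : 1 ≤ h) (h1 : k ≤ n - 1 - m)
    (h2 : k ≤ n + 1 - h) : basic n m h k ≤ N ↔ k ≤ N m h := by
  refine ⟨fun H => ?_, fun H => basic_le H hh⟩
  have := le_def.1 H m h
  rwa [basic_apply_self h1 h2] at this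

/-- The join irreducible height arrays. -/
def IsBasic (N : HeightArray n) : Prop :=
  ∃ m h k, IsSite m h ∧ 1 ≤ k ∧ k ≤ n - 1 - m ∧ k ≤ n + 1 - h ∧ N = basic n m h k

instance : OrderBot (HeightArray n) where
  bot := ⟨fun _ _ => 0, by simp, by simp, by simp, by simp, by simp, by simp⟩
  bot_le N := le_def.2 fun _ _ => Nat.zero_le _

theorem bot_apply (m h : ℕ) : (⊥ : HeightArray n) m h = 0 := rfl

theorem sup_apply (N N' : HeightArray n) (m h : ℕ) : (N ⊔ N') m h = max (N m h) (N' m h) := rfl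

/-- Lying above `basic n m h k` is a condition on the value at one point, and suprema are pointwise
maxima, so `basic n m h k` is prime. Conversely `N` is the join of the minimal arrays through its
own values, and a prime element lies below one of them. -/
theorem isBasic_iff {N : HeightArray n} : IsBasic N ↔ SupPrime N := by
  constructor
  · rintro ⟨m, h, k, hs, hk, h1, h2, rfl⟩
    refine ⟨fun hmin => ?_, fun A B hAB => ?_⟩
    · have := le_def.1 (isMin_iff_eq_bot.1 hmin).le m h
      rw [basic_apply_self h1 h2, bot_apply] at this
      omega
    · rw [basic_le_iff hs.1 h1 h2] at hAB ⊢
      rw [basic_le_iff hs.1 h1 h2]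
      rw [sup_apply] at hAB
      exact le_max_iff.1 hAB
  · intro hN
    classical
    let S : Finset (ℕ × ℕ) := (Finset.range n ×ˢ Finset.range (n + 1)).filter
      fun p => IsSite p.1 p.2
    have hle : N ≤ S.sup fun p => basic n p.1 p.2 (N p.1 p.2) := by
      refine le_def.2 fun a b => ?_
      obtain ⟨m, h, hs, g⟩ := exists_site_glued a b
      rw [g.apply_eq N, g.apply_eq]
      rcases Nat.eq_zero_or_pos (N m h) with h0 | hpos
      · rw [h0]
        exact Nat.zero_le _
      · have h1 := N.le_left m h
        have h2 := N.le_right m h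
        have hmem : (m, h) ∈ S := by
          simp only [S, Finset.mem_filter, Finset.mem_product, Finset.mem_range]
          exact ⟨by omega, hs⟩
        have h3 := le_def.1 (Finset.le_sup (f := fun p : ℕ × ℕ => basic n p.1 p.2 (N p.1 p.2))
          hmem) m h
        simp only at h3
        rwa [basic_apply_self h1 h2] at h3
    obtain ⟨⟨m, h⟩, hmem, hb⟩ := hN.le_finset_sup.1 hle
    have hs : IsSite m h := (Finset.mem_filter.1 hmem).2
    refine ⟨m, h, N m h, hs, ?_, N.le_left m h, N.le_right m h,
      le_antisymm hb (basic_le le_rfl hs.1)⟩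
    by_contra h0
    have h0' : N m h = 0 := by omega
    refine hN.not_isMin (isMin_iff_eq_bot.2 (le_bot_iff.1 (hb.trans ?_)))
    simp only [h0']
    exact basic_le (Nat.zero_le _) hs.1

theorem IsBasic.map {N : HeightArray n} (hN : IsBasic N) (f : HeightArray n ≃o HeightArray n) :
    IsBasic (f N) := by
  rw [isBasic_iff] at *
  refine ⟨fun h => hN.not_isMin ((OrderIso.isMin_apply f).1 h), fun A B h => ?_⟩
  have h1 : N ≤ f.symm A ⊔ f.symm B := by
    rw [← OrderIso.map_sup]
    exact f.le_symm_apply.2 h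
  have h2 := hN.2 h1
  rwa [f.le_symm_apply, f.le_symm_apply] at h2

/-- Two minimal height arrays coincide at a point only if their sites do. -/
theorem eq_of_basicFun_eq {m h k m' h' k' : ℕ} (hs : IsSite m h) (hs' : IsSite m' h')
    (hk : 1 ≤ k) (hk' : 1 ≤ k') (h1 : basicFun m h k m' h' = k')
    (h2 : basicFun m' h' k' m h = k) : m = m' ∧ h = h' := by
  have e1 := (le_basicFun_iff hk').1 h1.ge
  have e2 := (le_basicFun_iff hk).1 h2.ge
  obtain rfl : k = k' := le_antisymm e2.1 e1.1
  have e3 := e1.2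
  have e4 := e2.2
  unfold Near at e3 e4
  obtain ⟨a, b⟩ := hs
  obtain ⟨a', b'⟩ := hs'
  omega

/-- The strict lower set of a minimal height array in the join irreducible elements determines its
values. -/
theorem basic_apply_le_of_lt {m h k : ℕ} (hs : IsSite m h) (hk : 1 ≤ k)
    (h1 : k ≤ n - 1 - m) (h2 : k ≤ n + 1 - h) {N : HeightArray n}
    (H : ∀ X : HeightArray n, IsBasic X → X < basic n m h k → X < N) (a b : ℕ)
    (hg : ¬ Glued m h a b) : basic n m h k a b ≤ N a b := by
  obtain ⟨m', h', hs', g⟩ := exists_site_glued a b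
  rw [g.apply_eq N, g.apply_eq]
  obtain ⟨l, hl⟩ : ∃ l, l = basic n m h k m' h' := ⟨_, rfl⟩
  rw [← hl]
  rcases Nat.eq_zero_or_pos l with h0 | hpos
  · omega
  have h3 := (basic n m h k).le_left m' h'
  have h4 := (basic n m h k).le_right m' h'
  rw [← hl] at h3 h4
  rw [← basic_le_iff hs'.1 h3 h4]
  -- The minimal array through the value at `(m', h')` is strictly smaller: equality would make the
  -- two sites coincide.
  refine (H _ ⟨m', h', l, hs', hpos, h3, h4, rfl⟩ (lt_of_le_of_ne (basic_le hl.le hs'.1) ?_)).le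
  intro heq
  have e1 : basic n m' h' l m h = basic n m h k m h := by rw [heq]
  rw [basic_apply_self h1 h2, basic_apply h3 h4] at e1
  rw [basic_apply h1 h2] at hl
  obtain ⟨rfl, rfl⟩ := eq_of_basicFun_eq hs hs' hk hpos hl.symm e1
  exact hg g

/-- At the site itself the strict lower set only sees the array with peak `k - 1` at the same site,
so one unit is lost. -/
theorem basic_apply_self_of_lt {m h k : ℕ} (hs : IsSite m h)
    (h1 : k ≤ n - 1 - m) (h2 : k ≤ n + 1 - h) {N : HeightArray n}
    (H : ∀ X : HeightArray n, IsBasic X → X < basic n m h k → X < N) : k - 1 ≤ N m h := by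
  rcases Nat.lt_or_ge k 2 with h0 | h0
  · omega
  have h3 : k - 1 ≤ n - 1 - m := by omega
  have h4 : k - 1 ≤ n + 1 - h := by omega
  rw [← basic_le_iff hs.1 h3 h4]
  refine (H _ ⟨m, h, k - 1, hs, by omega, h3, h4, rfl⟩ (lt_of_le_of_ne (basic_le ?_ hs.1) ?_)).le
  · rw [basic_apply_self h1 h2]
    omega
  · intro heq
    have e1 : basic n m h (k - 1) m h = basic n m h k m h := by rw [heq]
    rw [basic_apply_self h1 h2, basic_apply_self h3 h4] at e1
    omega

theorem site_cases_of_pos {m h m' h' : ℕ} (hs : IsSite m h) (hs' : IsSite m' h')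
    (hm : m = 0) (hself : ¬ Near m' h' 0 m h)
    (hself' : ¬ Near m h 0 m' h')
    (k1 : ¬ Glued m h m (h - 1) → ¬ Glued m' h' m (h - 1) → Near m' h' 0 m (h - 1))
    (k1' : ¬ Glued m h m' (h' - 1) → ¬ Glued m' h' m' (h' - 1) → Near m h 0 m' (h' - 1))
    (k2' : ¬ Glued m h (m' - 1) h' → ¬ Glued m' h' (m' - 1) h' → Near m h 0 (m' - 1) h') :
    h = 4 ∧ m' = 1 ∧ h' = 1 := by
  subst hm
  obtain ⟨a, b⟩ := hs
  obtain ⟨a', b'⟩ := hs'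
  have e0 : 1 ≤ m' := by
    unfold Near at hself hself'
    omega
  have e1 : h' < h ∧ m' + 2 < h := by
    unfold Near at hself
    omega
  have e2 : h - 1 ≤ h' ∨ h - 1 ≤ m' + 2 := by
    have := k1 (by unfold Glued; omega) (by unfold Glued; omega)
    unfold Near at this
    omega
  have e3 : h' = 1 := by
    have := k1' (by unfold Glued; omega) (by unfold Glued; omega)
    unfold Near at this
    omega
  subst e3
  have e4 : m' = 1 := by
    have := k2' (by unfold Glued; omega) (by unfold Glued; omega)
    unfold Near at this
    omega
  omega

/-- Two incomparable sites are considered, where the points below and to the left of each one,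
unless glued to one of the sites, are dominated by the other. Off the left border the four neighbour
conditions contradict incomparability; with one site on the border they leave a single pair. -/
theorem site_cases {m h m' h' : ℕ} (hs : IsSite m h) (hs' : IsSite m' h')
    (hself : ¬ Near m' h' 0 m h) (hself' : ¬ Near m h 0 m' h')
    (k1 : ¬ Glued m h m (h - 1) → ¬ Glued m' h' m (h - 1) → Near m' h' 0 m (h - 1))
    (k2 : ¬ Glued m h (m - 1) h → ¬ Glued m' h' (m - 1) h → Near m' h' 0 (m - 1) h)
    (k1' : ¬ Glued m h m' (h' - 1) → ¬ Glued m' h' m' (h' - 1) → Near m h 0 m' (h' - 1))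
    (k2' : ¬ Glued m h (m' - 1) h' → ¬ Glued m' h' (m' - 1) h' → Near m h 0 (m' - 1) h') :
    (m = 0 ∧ h = 4 ∧ m' = 1 ∧ h' = 1) ∨ (m = 1 ∧ h = 1 ∧ m' = 0 ∧ h' = 4) := by
  rcases Nat.eq_zero_or_pos m with hm | hm
  · have := site_cases_of_pos hs hs' hm hself hself' k1 k1' k2'
    omega
  rcases Nat.eq_zero_or_pos m' with hm' | hm'
  · have := site_cases_of_pos hs' hs hm' hself' hself (fun g g' => k1' g' g)
      (fun g g' => k1 g' g) (fun g g' => k2 g' g)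
    omega
  exfalso
  obtain ⟨a, b⟩ := hs
  obtain ⟨a', b'⟩ := hs'
  have e1 : ¬ (m ≤ m' ∧ h ≤ h') := fun e => hself (Or.inl e)
  have e2 : ¬ (m' ≤ m ∧ h' ≤ h) := fun e => hself' (Or.inl e)
  have f1 : (m ≤ m' ∧ h ≤ h' + 1) ∨ (m + 2 ≤ h' ∧ h = 1) := by
    have := k1 (by unfold Glued; omega) (by unfold Glued; omega)
    unfold Near at this
    omega
  have f2 : (m ≤ m' + 1 ∧ h ≤ h') ∨ (m = 1 ∧ h ≤ m' + 2) := by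
    by_cases g : Glued m' h' (m - 1) h
    · unfold Glued at g
      omega
    have := k2 (by unfold Glued; omega) g
    unfold Near at this
    omega
  have f3 : (m' ≤ m ∧ h' ≤ h + 1) ∨ (m' + 2 ≤ h ∧ h' = 1) := by
    have := k1' (by unfold Glued; omega) (by unfold Glued; omega)
    unfold Near at this
    omega
  have f4 : (m' ≤ m + 1 ∧ h' ≤ h) ∨ (m' = 1 ∧ h' ≤ m + 2) := by
    by_cases g : Glued m h (m' - 1) h'
    · unfold Glued at g
      omega
    have := k2' g (by unfold Glued; omega)
    unfold Near at this
    omega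
  omega

theorem basicFun_eq_cases_of_le {m h k m' h' k' : ℕ} (hs : IsSite m h) (hs' : IsSite m' h')
    (hk : 1 ≤ k) (hkk : k ≤ k') (hv : basicFun m' h' k' m h = k - 1)
    (hv' : basicFun m h k m' h' = k' - 1)
    (H : ∀ a b, ¬ Glued m h a b → ¬ Glued m' h' a b → basicFun m h k a b = basicFun m' h' k' a b) :
    k = 1 ∧ k' = 1 ∧ ((m = 0 ∧ h = 4 ∧ m' = 1 ∧ h' = 1) ∨ (m = 1 ∧ h = 1 ∧ m' = 0 ∧ h' = 4)) := by
  have hk' : k' ≤ k + 1 := by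
    unfold basicFun at hv'
    omega
  have key : ∀ a b l, 1 ≤ l → Near m h (k - l) a b → l ≤ k → ¬ Glued m h a b →
      ¬ Glued m' h' a b → l ≤ k' ∧ Near m' h' (k' - l) a b := by
    intro a b l hl hn hlk g g'
    exact ((le_basicFun_iff hl).1 (H a b g g' ▸ (le_basicFun_iff hl).2 ⟨hlk, hn⟩))
  have key' : ∀ a b l, 1 ≤ l → Near m' h' (k' - l) a b → l ≤ k' → ¬ Glued m h a b →
      ¬ Glued m' h' a b → l ≤ k ∧ Near m h (k - l) a b := by
    intro a b l hl hn hlk g g'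
    exact ((le_basicFun_iff hl).1 ((H a b g g').symm ▸ (le_basicFun_iff hl).2 ⟨hlk, hn⟩))
  have hself : ¬ Near m' h' (k' - k) m h := by
    intro hn
    have := (le_basicFun_iff hk).2 ⟨hkk, hn⟩
    omega
  obtain ⟨a, b⟩ := hs
  obtain ⟨a', b'⟩ := hs'
  -- Suppose first that the peaks are `k` and `k + 1`. The points below and to the left of `(m',
  -- h')` reach the level `k + 1`, which the other array never does, so they are glued to one of the
  -- sites. This leaves `(0, 2)` for the higher peak and `(0, 4)` for the lower one, and the values
  -- at `(1, 3)` differ.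
  rcases hk'.eq_or_lt with rfl | hlt
  · have h1 : Near m h 0 m' h' := by
      have := (le_basicFun_iff (m := m) (h := h) (k := k) (l := k) (a := m') (b := h') hk).1
        (by omega)
      simpa using this.2
    rw [show k + 1 - k = 1 by omega] at hself
    have k1 := key m (h - 1) k hk (by unfold Near; omega) le_rfl
    have k2 := key (m - 1) h k hk (by unfold Near; omega) le_rfl
    have k3 := key' m' (h' - 1) (k + 1) (by omega) (by unfold Near; omega) le_rfl
    have k4 := key' (m' - 1) h' (k + 1) (by omega) (by unfold Near; omega) le_rfl
    have k5 := key' (m' + 1) (h' + 1) k hk (by unfold Near; omega) (by omega)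
    rw [show k + 1 - k = 1 by omega] at k1 k2
    rw [Nat.sub_self] at k5
    clear key key' H hv hv'
    have hf : ¬ k + 1 ≤ k := by omega
    simp only [hf, false_and, imp_false, not_not, le_add_iff_nonneg_right, zero_le, true_and] at *
    have e1 : m' = 0 := by
      by_contra hm
      clear h1 k1 k2 k4 k5
      unfold Near Glued at *
      omega
    subst e1
    have e2 : h' = 2 := by
      by_contra hm
      clear h1 k1 k2 k4 k5
      unfold Near Glued at *
      omega
    subst e2
    clear k3 k4 h1
    have e3 : m = 0 ∧ h = 4 := by
      clear k5
      unfold Near Glued at *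
      omega
    obtain ⟨rfl, rfl⟩ := e3
    unfold Near Glued at k5
    omega
  · obtain rfl : k = k' := by omega
    have hself' : ¬ Near m h 0 m' h' := by
      intro hn
      have := (le_basicFun_iff (m := m) (h := h) (k := k) (l := k) (a := m') (b := h') hk).2
        ⟨le_rfl, by simpa using hn⟩
      omega
    have k1 := key m (h - 1) k hk (by unfold Near; omega) le_rfl
    have k2 := key (m - 1) h k hk (by unfold Near; omega) le_rfl
    have k1' := key' m' (h' - 1) k hk (by unfold Near; omega) le_rfl
    have k2' := key' (m' - 1) h' k hk (by unfold Near; omega) le_rfl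
    simp only [le_refl, true_and, Nat.sub_self] at k1 k2 k1' k2' hself
    have hcases : (m = 0 ∧ h = 4 ∧ m' = 1 ∧ h' = 1) ∨ (m = 1 ∧ h = 1 ∧ m' = 0 ∧ h' = 4) := by
      exact site_cases ⟨a, b⟩ ⟨a', b'⟩ hself hself' k1 k2 k1' k2'
    have hk1 : k = 1 := by
      by_contra hk1
      have hsub : k - (k - 1) = 1 := by omega
      rcases hcases with ⟨rfl, rfl, rfl, rfl⟩ | ⟨rfl, rfl, rfl, rfl⟩
      -- For `k ≥ 2` the diagonal neighbour `(1, 5)` of `(0, 4)` separates the arrays: it is not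
      -- within distance `1` of `(1, 1)`.
      · have := key 1 5 (k - 1) (by omega) (by unfold Near; omega) (by omega)
        rw [hsub] at this
        unfold Glued Near at this
        omega
      · have := key' 1 5 (k - 1) (by omega) (by unfold Near; omega) (by omega)
        rw [hsub] at this
        unfold Glued Near at this
        omega
    exact ⟨hk1, hk1, hcases⟩

theorem basicFun_eq_cases {m h k m' h' k' : ℕ} (hs : IsSite m h) (hs' : IsSite m' h')
    (hk : 1 ≤ k) (hk' : 1 ≤ k') (hv : basicFun m' h' k' m h = k - 1)
    (hv' : basicFun m h k m' h' = k' - 1)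
    (H : ∀ a b, ¬ Glued m h a b → ¬ Glued m' h' a b → basicFun m h k a b = basicFun m' h' k' a b) :
    k = 1 ∧ k' = 1 ∧ ((m = 0 ∧ h = 4 ∧ m' = 1 ∧ h' = 1) ∨ (m = 1 ∧ h = 1 ∧ m' = 0 ∧ h' = 4)) := by
  rcases le_total k k' with hkk | hkk
  · exact basicFun_eq_cases_of_le hs hs' hk hkk hv hv' H
  · have := basicFun_eq_cases_of_le hs' hs hk' hkk hv' hv fun a b g g' => (H a b g' g).symm
    omega

end HeightArray

namespace HeightArray

variable {n : ℕ}

/-- If everything sup-prime below `N` is fixed, `N` and `f N` have the same sup-prime elements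
strictly below them. If they are distinct, they agree away from both sites, and at the site of each
the other is smaller by exactly one; `basicFun_eq_cases` lists the possibilities. -/
theorem apply_eq_or_of_forall_lt_fixed (f : HeightArray n ≃o HeightArray n) {N : HeightArray n}
    (hN : IsBasic N) (ih : ∀ X, IsBasic X → X < N → f X = X) :
    f N = N ∨ (4 ≤ n ∧ ((N = basic n 0 4 1 ∧ f N = basic n 1 1 1) ∨
      (N = basic n 1 1 1 ∧ f N = basic n 0 4 1))) := by
  by_cases hne : f N = N
  · exact Or.inl hne
  right
  have hlt : ∀ X, IsBasic X → (X < N ↔ X < f N) := by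
    intro X hX
    constructor
    · intro h
      have := f.lt_iff_lt.2 h
      rwa [ih X hX h] at this
    · intro h
      have h1 : f.symm X < N := f.lt_iff_lt.1 (by rwa [f.apply_symm_apply])
      have h2 := ih _ (hX.map f.symm) h1
      rw [f.apply_symm_apply] at h2
      rwa [← h2] at h1
  have hnle : ¬ N ≤ f N := by
    intro h
    rcases h.lt_or_eq with h | h
    · exact lt_irrefl _ ((hlt N hN).2 h)
    · exact hne h.symm
  have hnle' : ¬ f N ≤ N := by
    intro h
    rcases h.lt_or_eq with h | h
    · exact lt_irrefl _ ((hlt _ (hN.map f)).1 h)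
    · exact hne h
  have hfN := hN.map f
  obtain ⟨N', hN'⟩ : ∃ N', N' = f N := ⟨_, rfl⟩
  rw [← hN'] at hne hlt hnle hnle' hfN ⊢
  clear hN' ih
  obtain ⟨m, h, k, hs, hk, h1, h2, rfl⟩ := hN
  obtain ⟨m', h', k', hs', hk', h1', h2', rfl⟩ := hfN
  have e1 := basic_apply_self_of_lt hs h1 h2 fun X hX hlt' => (hlt X hX).1 hlt'
  have e2 := basic_apply_self_of_lt hs' h1' h2' fun X hX hlt' => (hlt X hX).2 hlt'
  rw [basic_le_iff hs.1 h1 h2] at hnle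
  rw [basic_le_iff hs'.1 h1' h2'] at hnle'
  have e3 : basicFun m' h' k' m h = k - 1 := by
    rw [← basic_apply h1' h2']
    omega
  have e4 : basicFun m h k m' h' = k' - 1 := by
    rw [← basic_apply h1 h2]
    omega
  have e5 := basicFun_eq_cases hs hs' hk hk' e3 e4 fun a b g g' => by
    rw [← basic_apply h1 h2, ← basic_apply h1' h2']
    exact le_antisymm
      (basic_apply_le_of_lt hs hk h1 h2 (fun X hX hlt' => (hlt X hX).1 hlt') a b g)
      (basic_apply_le_of_lt hs' hk' h1' h2' (fun X hX hlt' => (hlt X hX).2 hlt') a b g')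
  obtain ⟨rfl, rfl, ⟨rfl, rfl, rfl, rfl⟩ | ⟨rfl, rfl, rfl, rfl⟩⟩ := e5
  · exact ⟨by omega, Or.inl ⟨rfl, rfl⟩⟩
  · exact ⟨by omega, Or.inr ⟨rfl, rfl⟩⟩

theorem one_le_basic_apply_iff {m h a b : ℕ} (h1 : 1 ≤ n - 1 - m) (h2 : 1 ≤ n + 1 - h) :
    1 ≤ basic n m h 1 a b ↔ Near m h 0 a b := by
  rw [basic_apply h1 h2, le_basicFun_iff le_rfl]
  simp

/-- The image of the minimal height array at `(1, 2)` under an automorphism that exchanges those at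
`(0, 4)` and at `(1, 1)`. -/
theorem one_le_apply_of_swap (hn : 4 ≤ n) (f : HeightArray n ≃o HeightArray n)
    (h1 : f (basic n 0 4 1) = basic n 1 1 1) (h2 : f (basic n 1 1 1) = basic n 0 4 1) :
    1 ≤ f (basic n 1 2 1) 0 5 := by
  have hB : basic n 1 1 1 ≤ basic n 1 2 1 := by
    rw [basic_le_iff (by omega) (by omega) (by omega),
      one_le_basic_apply_iff (by omega) (by omega)]
    unfold Near
    omega
  have hA : ¬ basic n 0 4 1 ≤ basic n 1 2 1 := by
    rw [basic_le_iff (by omega) (by omega) (by omega),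
      one_le_basic_apply_iff (by omega) (by omega)]
    unfold Near
    omega
  have hq : IsBasic (f (basic n 1 2 1)) :=
    IsBasic.map ⟨1, 2, 1, ⟨by omega, by omega⟩, by omega, by omega, by omega, rfl⟩ f
  rw [← f.le_iff_le, h2] at hB
  rw [← f.le_iff_le, h1] at hA
  have hne : f (basic n 1 2 1) ≠ basic n 0 4 1 := by
    intro he
    rw [← h2, f.apply_eq_iff_eq] at he
    have e1 : 1 ≤ basic n 1 1 1 1 2 := by
      rw [← he, one_le_basic_apply_iff (by omega) (by omega)]
      unfold Near
      omega
    rw [one_le_basic_apply_iff (by omega) (by omega)] at e1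
    unfold Near at e1
    omega
  obtain ⟨m, h, k, ⟨hs, hs'⟩, hk, e1, e2, he⟩ := hq
  rw [he] at hA hB hne ⊢
  rw [basic_le_iff (by omega) (by omega) (by omega), basic_apply e1 e2] at hA
  rw [basic_le_iff (by omega) (by omega) (by omega), basic_apply e1 e2] at hB
  rw [basic_apply e1 e2]
  rw [le_basicFun_iff le_rfl] at hA hB ⊢
  unfold Near at hA hB ⊢
  -- The image is positive at `(0, 4)` but zero at `(1, 1)`. This forces a site `(0, h)` with peak
  -- `1` and `4 ≤ h`, and `h = 4` is excluded.
  obtain rfl : m = 0 := by omega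
  obtain rfl : k = 1 := by omega
  have : h ≠ 4 := by
    rintro rfl
    exact hne rfl
  omega

/-- An exchange would map `basic n 1 4 1` to `basic n 2 1 1`, as both inequalities follow from the
positions of these arrays relative to the exchanged pair. But the image is positive at `(0, 5)`,
where `basic n 2 1 1` vanishes. -/
theorem not_swap (hn : 4 ≤ n) (f : HeightArray n ≃o HeightArray n)
    (h1 : f (basic n 0 4 1) = basic n 1 1 1) (h2 : f (basic n 1 1 1) = basic n 0 4 1) : False := by
  have h1' : f.symm (basic n 0 4 1) = basic n 1 1 1 := by rw [← h2, f.symm_apply_apply]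
  have h2' : f.symm (basic n 1 1 1) = basic n 0 4 1 := by rw [← h1, f.symm_apply_apply]
  have hC := one_le_apply_of_swap hn f h1 h2
  have hC' := one_le_apply_of_swap hn f.symm h1' h2'
  have isB : ∀ m h, IsSite m h → 1 ≤ n - 1 - m → 1 ≤ n + 1 - h → IsBasic (basic n m h 1) :=
    fun m h hs e1 e2 => ⟨m, h, 1, hs, le_rfl, e1, e2, rfl⟩
  have cmp : ∀ m h m' h', IsSite m h → 1 ≤ n - 1 - m → 1 ≤ n + 1 - h → 1 ≤ n - 1 - m' →
      1 ≤ n + 1 - h' → (basic n m h 1 ≤ basic n m' h' 1 ↔ Near m' h' 0 m h) := by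
    intro m h m' h' hs e1 e2 e3 e4
    rw [basic_le_iff hs.1 e1 e2, one_le_basic_apply_iff e3 e4]
  have hg := (isB 1 4 ⟨by omega, by omega⟩ (by omega) (by omega)).map f
  have g1 : basic n 0 4 1 ≤ basic n 1 4 1 :=
    (cmp _ _ _ _ ⟨by omega, by omega⟩ (by omega) (by omega) (by omega) (by omega)).2
      (by unfold Near; omega)
  have g3 : basic n 1 2 1 ≤ basic n 1 4 1 :=
    (cmp _ _ _ _ ⟨by omega, by omega⟩ (by omega) (by omega) (by omega) (by omega)).2
      (by unfold Near; omega)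
  rw [← f.le_iff_le] at g1 g3
  rw [h1, basic_le_iff (by omega) (by omega) (by omega)] at g1
  have g4 := hC.trans (le_def.1 g3 0 5)
  have g5 : ¬ 1 ≤ f (basic n 1 4 1) 1 2 := by
    intro hc
    have := basic_le hc (by omega)
    rw [← f.symm_apply_le] at this
    have h5 := hC'.trans (le_def.1 this 0 5)
    rw [one_le_basic_apply_iff (by omega) (by omega)] at h5
    unfold Near at h5
    omega
  -- Being zero at `(1, 2)` and positive at `(1, 1)` forces peak `1` and a site `(m, 1)`; positivity
  -- at `(0, 5)` then gives `3 ≤ m`.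
  have g6 : 1 ≤ f (basic n 1 4 1) 2 1 := by
    obtain ⟨m, h, k, ⟨hs, hs'⟩, hk, e1, e2, he⟩ := hg
    rw [he] at g1 g4 g5 ⊢
    rw [basic_apply e1 e2, le_basicFun_iff le_rfl] at g1 g4 g5 ⊢
    unfold Near at g1 g4 g5 ⊢
    omega
  have g7 : basic n 2 1 1 ≤ f (basic n 1 4 1) := basic_le g6 (by omega)
  have g8 : basic n 0 4 1 ≤ basic n 2 1 1 :=
    (cmp _ _ _ _ ⟨by omega, by omega⟩ (by omega) (by omega) (by omega) (by omega)).2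
      (by unfold Near; omega)
  have g9 : basic n 1 1 1 ≤ basic n 2 1 1 :=
    (cmp _ _ _ _ ⟨by omega, by omega⟩ (by omega) (by omega) (by omega) (by omega)).2
      (by unfold Near; omega)
  have hq := (isB 2 1 ⟨by omega, by omega⟩ (by omega) (by omega)).map f.symm
  rw [← f.symm_apply_le] at g7
  rw [← f.symm.le_iff_le, h1', basic_le_iff (by omega) (by omega) (by omega)] at g8
  rw [← f.symm.le_iff_le, h2', basic_le_iff (by omega) (by omega) (by omega)] at g9
  have i1 : ¬ 1 ≤ f.symm (basic n 2 1 1) 2 1 := by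
    intro hc
    have := hc.trans (le_def.1 g7 2 1)
    rw [one_le_basic_apply_iff (by omega) (by omega)] at this
    unfold Near at this
    omega
  have i2 : ¬ 1 ≤ f.symm (basic n 2 1 1) 0 5 := by
    intro hc
    have := hc.trans (le_def.1 g7 0 5)
    rw [one_le_basic_apply_iff (by omega) (by omega)] at this
    unfold Near at this
    omega
  -- A minimal array that is positive at `(1, 1)` and `(0, 4)` but zero at `(2, 1)` and `(0, 5)` has
  -- its outermost corner exactly at `(1, 4)`.
  have i3 : 1 ≤ f.symm (basic n 2 1 1) 1 4 := by
    obtain ⟨m, h, k, ⟨hs, hs'⟩, hk, e1, e2, he⟩ := hq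
    rw [he] at g8 g9 i1 i2 ⊢
    rw [basic_apply e1 e2, le_basicFun_iff le_rfl] at g8 g9 i1 i2 ⊢
    unfold Near at g8 g9 i1 i2 ⊢
    omega
  have i4 := basic_le i3 (by omega)
  rw [f.le_symm_apply] at i4
  have i5 := g4.trans (le_def.1 i4 0 5)
  rw [one_le_basic_apply_iff (by omega) (by omega)] at i5
  unfold Near at i5
  omega

/-- Induction along the order. If `N` is moved, `N` and `f N` are the exceptional pair. Everything
sup-prime below `f N` is fixed as well, so the dichotomy applies to `f N` too, and injectivity
leaves only an exchange. -/
theorem apply_eq_of_isBasic (f : HeightArray n ≃o HeightArray n) (N : HeightArray n)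
    (hN : IsBasic N) : f N = N := by
  induction N using WellFoundedLT.induction with
  | ind N ih =>
    have hlow : ∀ X, IsBasic X → X < f N → f X = X := by
      intro X hX hlt
      have h1 : f.symm X < N := f.lt_iff_lt.1 (by rwa [f.apply_symm_apply])
      have h2 := ih _ h1 (hX.map f.symm)
      rw [f.apply_symm_apply] at h2
      exact ih X (by rwa [← h2] at h1) hX
    rcases apply_eq_or_of_forall_lt_fixed f hN fun X hX h => ih X h hX with h | ⟨hn, h⟩
    · exact h
    · have hAB : basic n 0 4 1 ≠ basic n 1 1 1 := by
        intro h
        have e1 := le_def.1 h.ge 1 1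
        rw [basic_apply_self (by omega) (by omega), one_le_basic_apply_iff (by omega) (by omega)]
          at e1
        unfold Near at e1
        omega
      have hB := apply_eq_or_of_forall_lt_fixed f (hN.map f) hlow
      rcases h with ⟨h1, h2⟩ | ⟨h1, h2⟩
      · rw [h2] at hB
        rw [h1] at h2
        rcases hB with h | ⟨-, h | h⟩
        · exact absurd (f.injective (h2.trans h.symm)) hAB
        · exact absurd h.1.symm hAB
        · exact (not_swap hn f h2 h.2).elim
      · rw [h2] at hB
        rw [h1] at h2
        rcases hB with h | ⟨-, h | h⟩
        · exact absurd (f.injective (h.trans h2.symm)) hAB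
        · exact (not_swap hn f h.2 h2).elim
        · exact absurd h.1 hAB

/-- Height arrays have no nontrivial automorphisms. -/
theorem apply_eq (f : HeightArray n ≃o HeightArray n) (N : HeightArray n) : f N = N := by
  -- Each minimal array below `N` is fixed, hence lies below `f N`. The same for the inverse gives
  -- equality.
  have key : ∀ (f : HeightArray n ≃o HeightArray n) (N : HeightArray n), N ≤ f N := by
    intro f N
    refine le_def.2 fun a b => ?_
    obtain ⟨m, h, hs, g⟩ := exists_site_glued a b
    rw [g.apply_eq N, g.apply_eq (f N)]
    rcases Nat.eq_zero_or_pos (N m h) with h0 | hpos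
    · omega
    · have h1 := N.le_left m h
      have h2 := N.le_right m h
      have h3 := basic_le (le_refl (N m h)) hs.1
      rw [← f.le_iff_le, apply_eq_of_isBasic f _ ⟨m, h, _, hs, hpos, h1, h2, rfl⟩] at h3
      exact (basic_le_iff hs.1 h1 h2).1 h3
  refine le_antisymm ?_ (key f N)
  have := key f.symm (f N)
  rwa [f.symm_apply_apply] at this

end HeightArray

/-! ### Descending plane partitions and height arrays -/

theorem shiftedEntry_add (rows : List (List ℕ)) (i m : ℕ) :
    shiftedEntry rows i (i + m) = (rows.getD i [])[m]? := by
  unfold shiftedEntry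
  rw [if_pos (Nat.le_add_right i m), Nat.add_sub_cancel_left, List.getD_eq_getElem?_getD]
  cases rows[i]? <;> simp

theorem shiftedEntry_eq_none_of_lt (rows : List (List ℕ)) {i j : ℕ} (h : j < i) :
    shiftedEntry rows i j = none := if_neg (by omega)

namespace DescendingPlanePartition

/-- The entry with offset `m` in row `i`, or `0` if there is no such entry. -/
def part (π : DescendingPlanePartition) (i m : ℕ) : ℕ :=
  (π.rows.getD i []).getD m 0

theorem entry_add_eq_some_iff (π : DescendingPlanePartition) {i m a : ℕ} :
    π.entry i (i + m) = some a ↔ 0 < a ∧ π.part i m = a := by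
  unfold entry part
  rw [shiftedEntry_add, List.getD_eq_getElem?_getD (l := π.rows.getD i []) (i := m)]
  constructor
  · intro h
    refine ⟨?_, by rw [h]; rfl⟩
    have h1 : a ∈ π.rows.getD i [] := List.mem_of_getElem? h
    by_cases hi : i < π.rows.length
    · rw [List.getD_eq_getElem _ _ hi] at h1
      exact π.pos _ (List.getElem_mem hi) _ h1
    · rw [List.getD_eq_default _ _ (by omega)] at h1
      simp at h1
  · rintro ⟨h1, h2⟩
    cases h : (π.rows.getD i [])[m]? with
    | none =>
      rw [h] at h2
      simp at h2
      omega
    | some b =>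
      rw [h] at h2
      simpa using h2

theorem entry_part (π : DescendingPlanePartition) {i m : ℕ} (h : 0 < π.part i m) :
    π.entry i (i + m) = some (π.part i m) :=
  π.entry_add_eq_some_iff.2 ⟨h, rfl⟩

theorem part_pos_iff (π : DescendingPlanePartition) {i m : ℕ} :
    0 < π.part i m ↔ m < rowLength π.rows i := by
  constructor
  · intro h
    have h1 := π.entry_part h
    unfold entry at h1
    rw [shiftedEntry_add] at h1
    exact (List.getElem?_eq_some_iff.1 h1).1
  · intro h
    have h1 : π.entry i (i + m) = some ((π.rows.getD i [])[m]'h) := by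
      unfold entry
      rw [shiftedEntry_add]
      exact List.getElem?_eq_getElem h
    have h2 := π.entry_add_eq_some_iff.1 h1
    omega

theorem part_succ_right_le (π : DescendingPlanePartition) (i m : ℕ) :
    π.part i (m + 1) ≤ π.part i m := by
  rcases Nat.eq_zero_or_pos (π.part i (m + 1)) with h | h
  · omega
  · have h1 : 0 < π.part i m := by
      have h2 := π.part_pos_iff.1 h
      rw [part_pos_iff]
      omega
    exact π.row_weak i (i + m) _ _ (π.entry_part h1) (π.entry_part h)

/-- In offset coordinates columns run diagonally; the entry above exists because the row ends are
weakly decreasing. -/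
theorem part_succ_lt (π : DescendingPlanePartition) {i m : ℕ} (h : 0 < π.part (i + 1) m) :
    π.part (i + 1) m < π.part i (m + 1) := by
  have h1 : 0 < π.part i (m + 1) := by
    rw [part_pos_iff] at *
    have h2 : i + 1 < π.rows.length := by
      by_contra hi
      unfold rowLength at h
      rw [List.getD_eq_default _ _ (by omega)] at h
      simp at h
    have := π.rowEnd_antitone i h2
    unfold rowEnd at this
    omega
  have h2 := π.entry_part h
  rw [show i + 1 + m = i + (m + 1) by omega] at h2
  exact π.col_strict i _ _ _ (π.entry_part h1) h2

/-- An entry with offset `m` means a row of length at least `m + 1`, which the first entry exceeds.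
On height arrays this is monotonicity between heights `0` and `1`, and it is the origin of the shift
by `2` in the gluing. -/
theorem add_two_le_part_zero (π : DescendingPlanePartition) {i m : ℕ} (h : 0 < π.part i m) :
    m + 2 ≤ π.part i 0 := by
  rw [part_pos_iff] at h
  have h1 : 0 < π.part i 0 := by
    rw [part_pos_iff]
    omega
  have := π.first_gt i _ (π.entry_part h1)
  omega

/-- The bound of a first entry by the preceding row length; it becomes the diagonal inequality at
height `0`. -/
theorem part_pos_of_le (π : DescendingPlanePartition) {i m : ℕ} (h : m + 1 ≤ π.part (i + 1) 0) :
    0 < π.part i m := by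
  have := π.first_le i _ (π.entry_part (by omega : 0 < π.part (i + 1) 0))
  rw [part_pos_iff]
  omega

theorem part_eq_zero (π : DescendingPlanePartition) {i m : ℕ} (h : π.rows.length ≤ i) :
    π.part i m = 0 := by
  unfold part
  rw [List.getD_eq_default _ _ h]
  rfl

theorem part_le {n : ℕ} (π : BoundedDPP n) (i m : ℕ) : π.1.part i m ≤ n := by
  rcases Nat.eq_zero_or_pos (π.1.part i m) with h | h
  · omega
  · have h1 := π.1.entry_part h
    unfold entry at h1
    rw [shiftedEntry_add] at h1
    have h2 := List.mem_of_getElem? h1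
    by_cases hi : i < π.1.rows.length
    · rw [List.getD_eq_getElem _ _ hi] at h2
      exact π.2 _ (List.getElem_mem hi) _ h2
    · rw [List.getD_eq_default _ _ (by omega)] at h2
      simp at h2

theorem part_antitone (π : DescendingPlanePartition) (m : ℕ) : Antitone fun i => π.part i m := by
  refine antitone_nat_of_succ_le fun i => ?_
  rcases Nat.eq_zero_or_pos (π.part (i + 1) m) with h | h
  · omega
  · exact (π.part_succ_lt h).le.trans (π.part_succ_right_le i m)

theorem le_iff_part_le {π σ : DescendingPlanePartition} :
    π ≤ σ ↔ ∀ i m, π.part i m ≤ σ.part i m := by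
  constructor
  · intro h i m
    rcases Nat.eq_zero_or_pos (π.part i m) with h0 | hpos
    · omega
    · obtain ⟨b, hb, hab⟩ := h i (i + m) _ (π.entry_part hpos)
      rwa [(σ.entry_add_eq_some_iff.1 hb).2]
  · intro h i j a ha
    by_cases hij : i ≤ j
    · obtain ⟨m, rfl⟩ := Nat.exists_eq_add_of_le hij
      obtain ⟨h1, h2⟩ := π.entry_add_eq_some_iff.1 ha
      have := h i m
      exact ⟨_, σ.entry_part (by omega), by omega⟩
    · unfold entry at ha
      rw [shiftedEntry_eq_none_of_lt _ (by omega)] at ha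
      simp at ha

theorem exists_part_lt (π : DescendingPlanePartition) (m : ℕ) {h : ℕ} (hh : 1 ≤ h) :
    ∃ i, π.part i m < h :=
  ⟨π.rows.length, by rw [π.part_eq_zero le_rfl]; exact hh⟩

/-- The number of entries with offset `m` that are at least `h + 1`. -/
def colCount (π : DescendingPlanePartition) (m h : ℕ) : ℕ :=
  Nat.find (π.exists_part_lt m (Nat.le_add_left 1 h))

/-- At fixed offset the entries decrease with the row, so the first failure counts the successes, as
in conjugating a partition. -/
theorem lt_colCount_iff (π : DescendingPlanePartition) {i m h : ℕ} :
    i < π.colCount m h ↔ h + 1 ≤ π.part i m := by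
  unfold colCount
  rw [Nat.lt_find_iff]
  refine ⟨fun H => not_lt.1 (H i le_rfl), fun H j hj => not_lt.2 (H.trans ?_)⟩
  exact π.part_antitone m hj

/-- The height array of a descending plane partition. -/
def toHeightArray {n : ℕ} (π : BoundedDPP n) : HeightArray n where
  toFun m h := match h with
    -- The value that gluing prescribes: `colCount m h` counts entries at least `h + 1`, so this is
    -- the value at `(0, m + 2)`.
    | 0 => π.1.colCount 0 (m + 1)
    | h + 1 => π.1.colCount m h
  succ_right_le m h := by
    refine le_of_forall_lt fun i hi => ?_
    cases h with
    | zero =>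
      simp only [zero_add, lt_colCount_iff] at hi ⊢
      exact π.1.add_two_le_part_zero hi
    | succ h =>
      simp only [lt_colCount_iff] at hi ⊢
      omega
  succ_left_le m h := by
    refine le_of_forall_lt fun i hi => ?_
    cases h with
    | zero =>
      simp only [lt_colCount_iff] at hi ⊢
      omega
    | succ h =>
      simp only [lt_colCount_iff] at hi ⊢
      exact hi.trans (π.1.part_succ_right_le i m)
  le_succ_succ m h := by
    refine le_of_forall_lt fun i hi => ?_
    cases i with
    | zero => omega
    | succ i =>
      rw [Nat.succ_lt_succ_iff]
      cases h with
      | zero =>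
        simp only [lt_colCount_iff] at hi ⊢
        exact π.1.part_pos_of_le hi
      | succ h =>
        simp only [lt_colCount_iff] at hi ⊢
        have := π.1.part_succ_lt (i := i) (m := m) (by omega)
        omega
  glue m := rfl
  -- No row starts with `1`, since its first entry exceeds its positive length.
  hole := by
    refine le_antisymm (le_of_forall_lt fun i hi => ?_) (le_of_forall_lt fun i hi => ?_)
    · simp only [lt_colCount_iff] at hi ⊢
      exact π.1.add_two_le_part_zero hi
    · simp only [lt_colCount_iff] at hi ⊢
      omega
  bound := by
    refine Nat.eq_zero_of_not_pos fun hi => ?_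
    simp only [lt_colCount_iff] at hi
    have := part_le π 0 0
    omega

theorem lt_toHeightArray_iff {n : ℕ} (π : BoundedDPP n) {i m h : ℕ} (hh : 1 ≤ h) :
    i < toHeightArray π m h ↔ h ≤ π.1.part i m := by
  obtain ⟨h, rfl⟩ := Nat.exists_eq_add_of_le' hh
  exact π.1.lt_colCount_iff

theorem toHeightArray_le_iff {n : ℕ} {π σ : BoundedDPP n} :
    toHeightArray π ≤ toHeightArray σ ↔ π ≤ σ := by
  rw [← Subtype.coe_le_coe, le_iff_part_le]
  constructor
  · intro H i m
    rcases Nat.eq_zero_or_pos (π.1.part i m) with h0 | hpos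
    · omega
    · rw [← lt_toHeightArray_iff σ hpos]
      exact ((lt_toHeightArray_iff π hpos).2 le_rfl).trans_le (HeightArray.le_def.1 H m _)
  · intro H
    refine HeightArray.le_def.2 fun a b => ?_
    obtain ⟨m, h, hs, g⟩ := HeightArray.exists_site_glued a b
    rw [g.apply_eq, g.apply_eq]
    refine le_of_forall_lt fun i hi => ?_
    rw [lt_toHeightArray_iff _ hs.1] at hi ⊢
    exact hi.trans (H i m)

end DescendingPlanePartition

/-! ### The descending plane partition of a height array. -/

namespace HeightArray

variable {n : ℕ}

theorem exists_apply_succ_le (N : HeightArray n) (i m : ℕ) : ∃ h, N m (h + 1) ≤ i :=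
  ⟨n, by rw [N.eq_zero_of_lt (by omega)]; exact Nat.zero_le _⟩

/-- The entry with offset `m` in row `i` of the descending plane partition of a height array. -/
def part (N : HeightArray n) (i m : ℕ) : ℕ := Nat.find (N.exists_apply_succ_le i m)

theorem le_part_iff (N : HeightArray n) {i m h : ℕ} (hh : 1 ≤ h) :
    h ≤ N.part i m ↔ i < N m h := by
  obtain ⟨h, rfl⟩ := Nat.exists_eq_add_of_le' hh
  unfold part
  rw [Nat.succ_le_iff, Nat.lt_find_iff]
  refine ⟨fun H => not_le.1 (H h le_rfl), fun H j hj => not_le.2 (H.trans_le ?_)⟩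
  exact N.antitone_right m (by omega)

theorem exists_apply_one_le (N : HeightArray n) (i : ℕ) : ∃ m, N m 1 ≤ i :=
  ⟨n, by rw [N.eq_zero_of_le (by omega)]; exact Nat.zero_le _⟩

/-- The length of row `i` of the descending plane partition of a height array. -/
def rowLen (N : HeightArray n) (i : ℕ) : ℕ := Nat.find (N.exists_apply_one_le i)

theorem lt_rowLen_iff (N : HeightArray n) {i m : ℕ} : m < N.rowLen i ↔ i < N m 1 := by
  unfold rowLen
  rw [Nat.lt_find_iff]
  refine ⟨fun H => not_le.1 (H m le_rfl), fun H j hj => not_le.2 (H.trans_le ?_)⟩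
  exact N.antitone_left 1 hj

theorem part_pos_iff (N : HeightArray n) {i m : ℕ} : 0 < N.part i m ↔ m < N.rowLen i := by
  rw [lt_rowLen_iff]
  exact N.le_part_iff le_rfl

/-- Row `i` of the descending plane partition of a height array. -/
def row (N : HeightArray n) (i : ℕ) : List ℕ := (List.range (N.rowLen i)).map (N.part i)

/-- The rows of the descending plane partition of a height array. -/
def rows (N : HeightArray n) : List (List ℕ) := (List.range (N 0 1)).map N.row

theorem getD_rows (N : HeightArray n) (i : ℕ) : N.rows.getD i [] = N.row i := by
  by_cases hi : i < N 0 1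
  · rw [List.getD_eq_getElem _ _ (by simpa [rows] using hi)]
    simp [rows]
  · rw [List.getD_eq_default _ _ (by simpa [rows] using hi)]
    have : N.rowLen i = 0 := by
      by_contra h
      have := N.lt_rowLen_iff.1 (Nat.pos_of_ne_zero h)
      omega
    unfold row
    rw [this]
    rfl

theorem rowLength_rows (N : HeightArray n) (i : ℕ) : rowLength N.rows i = N.rowLen i := by
  unfold rowLength
  rw [getD_rows]
  simp [row]

theorem shiftedEntry_rows (N : HeightArray n) {i j a : ℕ} :
    shiftedEntry N.rows i j = some a ↔ ∃ m, j = i + m ∧ m < N.rowLen i ∧ N.part i m = a := by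
  by_cases hij : i ≤ j
  · obtain ⟨m, rfl⟩ := Nat.exists_eq_add_of_le hij
    rw [shiftedEntry_add, getD_rows]
    simp only [row, List.getElem?_map, Option.map_eq_some_iff, List.getElem?_eq_some_iff,
      List.length_range, List.getElem_range]
    constructor
    · rintro ⟨b, ⟨h1, rfl⟩, h2⟩
      exact ⟨_, rfl, h1, h2⟩
    · rintro ⟨b, h0, h1, h2⟩
      obtain rfl : m = b := by omega
      exact ⟨m, ⟨h1, rfl⟩, h2⟩
  · rw [shiftedEntry_eq_none_of_lt _ (by omega)]
    simp only [reduceCtorEq, false_iff]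
    rintro ⟨m, h, -⟩
    omega

/-- The last offset `m` of row `i + 1` has `i + 2 ≤ N m 1`, so one diagonal step gives `i + 1 ≤ N (m
+ 1) 2 ≤ N (m + 1) 1`. -/
theorem rowLen_succ_lt (N : HeightArray n) {i : ℕ} (hi : i + 1 < N 0 1) :
    N.rowLen (i + 1) < N.rowLen i := by
  rw [lt_rowLen_iff]
  by_contra h
  rcases Nat.eq_zero_or_pos (N.rowLen (i + 1)) with h0 | hpos
  · rw [h0] at h
    omega
  · obtain ⟨m, hm⟩ := Nat.exists_eq_add_of_le' hpos
    have h1 := N.lt_rowLen_iff.1 (show m < N.rowLen (i + 1) by omega)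
    have h2 := N.le_succ_succ m 1
    have h3 := N.succ_right_le (m + 1) 1
    rw [show N.rowLen (i + 1) = m + 1 from hm] at h
    omega

/-- For the last offset `m` of the row, `N m 1 ≤ N m 0 = N 0 (m + 2)`, so the first entry is at
least `m + 2`. -/
theorem rowLen_lt_part (N : HeightArray n) {i : ℕ} (hi : 0 < N.rowLen i) :
    N.rowLen i < N.part i 0 := by
  obtain ⟨m, hm⟩ := Nat.exists_eq_add_of_le' (show 1 ≤ N.rowLen i from hi)
  have h1 := N.lt_rowLen_iff (i := i) (m := m)
  rw [hm] at h1 ⊢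
  simp only [Nat.lt_add_one, true_iff] at h1
  rw [Nat.lt_iff_add_one_le, le_part_iff _ (by omega), ← N.glue]
  exact h1.trans_le (N.succ_right_le m 0)

/-- The descending plane partition of a height array. -/
def toDPP (N : HeightArray n) : BoundedDPP n where
  val :=
  { rows := N.rows
    pos := by
      intro row hrow a ha
      obtain ⟨i, -, rfl⟩ := List.mem_map.1 hrow
      obtain ⟨m, hm, rfl⟩ := List.mem_map.1 ha
      exact N.part_pos_iff.2 (List.mem_range.1 hm)
    rowEnd_antitone := by
      intro i hi
      unfold rowEnd
      rw [rowLength_rows, rowLength_rows]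
      have := N.rowLen_succ_lt (i := i) (by simpa [rows] using hi)
      omega
    length_le_rowEnd := by
      intro i hi
      unfold rowEnd
      rw [rowLength_rows]
      have hlen : N.rows.length = N 0 1 := by simp [rows]
      rw [hlen] at hi ⊢
      clear hlen
      -- Induction on the number `d` of rows below row `i`: the last row is nonempty, and lengths
      -- strictly increase upwards.
      obtain ⟨d, hd⟩ := Nat.exists_eq_add_of_lt hi
      induction d generalizing i with
      | zero =>
        have := N.lt_rowLen_iff (i := i) (m := 0)
        omega
      | succ d ih =>
        have h1 := ih (i + 1) (by omega) (by omega)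
        have h2 := N.rowLen_succ_lt (i := i) (by omega)
        omega
    row_weak := by
      intro i j a b ha hb
      obtain ⟨m, rfl, h1, rfl⟩ := N.shiftedEntry_rows.1 ha
      obtain ⟨m', h0, h2, rfl⟩ := N.shiftedEntry_rows.1 hb
      obtain rfl : m' = m + 1 := by omega
      have h3 := N.part_pos_iff.2 h2
      rw [N.le_part_iff h3]
      exact ((N.le_part_iff h3).1 le_rfl).trans_le (N.succ_left_le m _)
    col_strict := by
      intro i j a b ha hb
      obtain ⟨m, rfl, h1, rfl⟩ := N.shiftedEntry_rows.1 ha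
      obtain ⟨m', h0, h2, rfl⟩ := N.shiftedEntry_rows.1 hb
      obtain rfl : m = m' + 1 := by omega
      have h3 := N.part_pos_iff.2 h2
      rw [Nat.lt_iff_add_one_le, N.le_part_iff (by omega)]
      have h4 := (N.le_part_iff h3).1 le_rfl
      have h5 := N.le_succ_succ m' (N.part (i + 1) m')
      omega
    first_gt := by
      intro i a ha
      obtain ⟨m, h0, h1, rfl⟩ := N.shiftedEntry_rows.1 ha
      obtain rfl : m = 0 := by omega
      rw [rowLength_rows]
      exact N.rowLen_lt_part h1
    first_le := by
      intro i a ha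
      obtain ⟨m, h0, h1, rfl⟩ := N.shiftedEntry_rows.1 ha
      obtain rfl : m = 0 := by omega
      rw [rowLength_rows]
      have h3 := N.rowLen_lt_part h1
      -- A first entry is at least `2`; written as `m + 2` it is moved by gluing to the point `(m,
      -- 0)`.
      obtain ⟨m, hm⟩ := Nat.exists_eq_add_of_le' (show 2 ≤ N.part (i + 1) 0 by omega)
      rw [hm, Nat.succ_le_iff, N.lt_rowLen_iff]
      have h4 := (N.le_part_iff (i := i + 1) (m := 0) (h := m + 2) (by omega)).1 hm.ge
      have h5 := N.le_succ_succ m 0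
      have h6 := N.glue m
      simp only [zero_add] at h5
      omega }
  property := by
    intro row hrow a ha
    obtain ⟨i, -, rfl⟩ := List.mem_map.1 hrow
    obtain ⟨m, hm, rfl⟩ := List.mem_map.1 ha
    by_contra hlt
    have h1 := (N.le_part_iff (i := i) (m := m) (h := n + 1) (by omega)).1 (by omega)
    rw [N.eq_zero_of_lt (by omega)] at h1
    omega

theorem part_toDPP (N : HeightArray n) (i m : ℕ) : N.toDPP.1.part i m = N.part i m := by
  unfold DescendingPlanePartition.part toDPP
  simp only
  rw [getD_rows, List.getD_eq_getElem?_getD]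
  by_cases hm : m < N.rowLen i
  · simp [row, hm]
  · have : N.part i m = 0 := by
      have := N.part_pos_iff (i := i) (m := m)
      omega
    simp [row, hm, this]

theorem toHeightArray_toDPP (N : HeightArray n) :
    DescendingPlanePartition.toHeightArray N.toDPP = N := by
  apply ext_apply
  intro a b
  obtain ⟨m, h, hs, g⟩ := exists_site_glued a b
  rw [g.apply_eq, g.apply_eq]
  refine eq_of_forall_lt_iff fun i => ?_
  rw [DescendingPlanePartition.lt_toHeightArray_iff _ hs.1, part_toDPP, le_part_iff _ hs.1]

/-- Height arrays and descending plane partitions are isomorphic. -/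
def dppIso (n : ℕ) : HeightArray n ≃o BoundedDPP n :=
  OrderIso.symm
    { toFun := DescendingPlanePartition.toHeightArray
      invFun := toDPP
      left_inv := fun π => by
        have h := toHeightArray_toDPP (DescendingPlanePartition.toHeightArray π)
        exact le_antisymm (DescendingPlanePartition.toHeightArray_le_iff.1 h.le)
          (DescendingPlanePartition.toHeightArray_le_iff.1 h.ge)
      right_inv := toHeightArray_toDPP
      map_rel_iff' := DescendingPlanePartition.toHeightArray_le_iff }

end HeightArray

/-! ### Statistics -/

namespace HeightArray

variable {n : ℕ}

/-- Double counting: the statistics are sums over rows, whereas height arrays count by offset. -/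
theorem sum_card_filter_range (K : ℕ) (P : ℕ → ℕ → Prop) [∀ i m, Decidable (P i m)] :
    ∑ i ∈ Finset.range K, ((Finset.range n).filter (P i)).card =
      ∑ m ∈ Finset.range n, ((Finset.range K).filter fun i => P i m).card := by
  simp only [Finset.card_filter]
  exact Finset.sum_comm

theorem rowLen_le (N : HeightArray n) (i : ℕ) : N.rowLen i ≤ n := by
  by_contra h
  have := N.lt_rowLen_iff.1 (not_le.1 h)
  rw [N.eq_zero_of_le (by omega)] at this
  omega

theorem countP_row (N : HeightArray n) (i : ℕ) (p : ℕ → Bool) :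
    (N.row i).countP p =
      ((Finset.range n).filter fun m => m < N.rowLen i ∧ p (N.part i m) = true).card := by
  have h : ((Finset.range n).filter fun m => m < N.rowLen i ∧ p (N.part i m) = true) =
      (Finset.range (N.rowLen i)).filter fun m => p (N.part i m) = true := by
    ext m
    have := N.rowLen_le i
    simp only [Finset.mem_filter, Finset.mem_range]
    constructor
    · rintro ⟨-, h⟩
      exact h
    · rintro ⟨h1, h2⟩
      exact ⟨by omega, h1, h2⟩
  have h2 : p ∘ N.part i = fun m => decide (p (N.part i m) = true) := by
    funext m
    simp
  rw [h, row, List.countP_map, List.countP_eq_length_filter, h2]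
  rfl

theorem s_row (N : HeightArray n) (i : ℕ) :
    ((N.row i).zipIdx.countP fun q => q.1 ≤ q.2) =
      ((Finset.range n).filter fun m => m < N.rowLen i ∧ N.part i m ≤ m).card := by
  have h : ((Finset.range n).filter fun m => m < N.rowLen i ∧ N.part i m ≤ m) =
      (Finset.range (N.rowLen i)).filter fun m => N.part i m ≤ m := by
    ext m
    have := N.rowLen_le i
    simp only [Finset.mem_filter, Finset.mem_range]
    constructor
    · rintro ⟨-, h⟩
      exact h
    · rintro ⟨h1, h2⟩
      exact ⟨by omega, h1, h2⟩
  have h2 : (N.row i).zipIdx = (List.range (N.rowLen i)).map fun m => (N.part i m, m) := by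
    apply List.ext_getElem <;> simp [row]
  rw [h, h2, List.countP_map, List.countP_eq_length_filter]
  rfl

theorem sum_map_rows (N : HeightArray n) (f : List ℕ → ℕ) :
    (N.rows.map f).sum = ∑ i ∈ Finset.range (N 0 1), f (N.row i) := by
  rw [rows, List.map_map]
  rfl

theorem card_filter_lt_and_not_lt {K a b : ℕ} (ha : a ≤ K) :
    ((Finset.range K).filter fun i => i < a ∧ ¬ i < b).card = a - b := by
  have : ((Finset.range K).filter fun i => i < a ∧ ¬ i < b) = Finset.Ico b a := by
    ext i
    simp only [Finset.mem_filter, Finset.mem_range, Finset.mem_Ico]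
    omega
  rw [this, Nat.card_Ico]

theorem i_toDPP (N : HeightArray n) : N.toDPP.1.i = ∑ m ∈ Finset.range n, N m 1 := by
  have h1 : N.toDPP.1.i = (N.rows.map List.length).sum := List.length_flatten
  rw [h1, sum_map_rows]
  have h2 : ∀ i, (N.row i).length = ((Finset.range n).filter fun m => i < N m 1 ∧ ¬ i < 0).card := by
    intro i
    rw [← List.countP_true, countP_row]
    simp [lt_rowLen_iff]
  simp only [h2]
  rw [sum_card_filter_range]
  refine Finset.sum_congr rfl fun m _ => ?_
  rw [card_filter_lt_and_not_lt (N.antitone (Nat.zero_le m) le_rfl), Nat.sub_zero]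

/-- The entry with offset `m` in row `i` exists for `i < N m 1` and is at least `m + 1`, hence not
special, for `i < N m (m + 1)`. -/
theorem s_toDPP (N : HeightArray n) :
    N.toDPP.1.s = ∑ m ∈ Finset.range n, (N m 1 - N m (m + 1)) := by
  have h1 : N.toDPP.1.s = (N.rows.map fun row => row.zipIdx.countP fun q => q.1 ≤ q.2).sum := rfl
  rw [h1, sum_map_rows]
  have h2 : ∀ i, ((N.row i).zipIdx.countP fun q => q.1 ≤ q.2) =
      ((Finset.range n).filter fun m => i < N m 1 ∧ ¬ i < N m (m + 1)).card := by
    intro i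
    rw [s_row]
    congr 1
    refine Finset.filter_congr fun m _ => ?_
    rw [lt_rowLen_iff, ← N.le_part_iff (h := m + 1) (by omega)]
    omega
  simp only [h2]
  rw [sum_card_filter_range]
  refine Finset.sum_congr rfl fun m _ => ?_
  rw [card_filter_lt_and_not_lt (N.antitone (Nat.zero_le m) le_rfl)]

/-- As heights vanish beyond `n`, an entry equals `n` once it is at least `n`. -/
theorem r_toDPP (hn : 1 ≤ n) (N : HeightArray n) :
    N.toDPP.1.r n = ∑ m ∈ Finset.range n, N m n := by
  have h1 : N.toDPP.1.r n = (N.rows.map (List.countP fun a => a == n)).sum :=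
    List.countP_flatten
  rw [h1, sum_map_rows]
  have h2 : ∀ i, (N.row i).countP (fun a => a == n) =
      ((Finset.range n).filter fun m => i < N m n ∧ ¬ i < 0).card := by
    intro i
    rw [countP_row]
    congr 1
    refine Finset.filter_congr fun m _ => ?_
    rw [← N.le_part_iff hn, ← part_pos_iff, beq_iff_eq]
    have h3 := N.le_part_iff (i := i) (m := m) (h := n + 1) (by omega)
    rw [N.eq_zero_of_lt (by omega)] at h3
    omega
  simp only [h2]
  rw [sum_card_filter_range]
  refine Finset.sum_congr rfl fun m _ => ?_
  rw [card_filter_lt_and_not_lt (N.antitone (Nat.zero_le m) hn), Nat.sub_zero]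

/-- In column `m`, reflection exchanges the values at heights `1` and `m + 1` and complements both
in `n - 1 - m`, which preserves their difference. -/
theorem s_reflect (N : HeightArray n) : N.reflect.toDPP.1.s = N.toDPP.1.s := by
  rw [s_toDPP, s_toDPP]
  refine Finset.sum_congr rfl fun m hm => ?_
  rw [reflect_apply_of_le _ (by omega), reflect_apply_of_le _ (by omega),
    show m + 2 - 1 = m + 1 by omega, show m + 2 - (m + 1) = 1 by omega]
  have h1 := N.le_left m 1
  have h2 := N.antitone (le_refl m) (show 1 ≤ m + 1 by omega)
  omega

theorem i_reflect (N : HeightArray n) :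
    N.toDPP.1.i + N.reflect.toDPP.1.i = n.choose 2 + N.toDPP.1.s := by
  have hc : n.choose 2 = ∑ m ∈ Finset.range n, (n - 1 - m) := by
    rw [Finset.sum_range_reflect (fun m => m), Finset.sum_range_id, Nat.choose_two_right]
  rw [i_toDPP, i_toDPP, s_toDPP, hc, ← Finset.sum_add_distrib, ← Finset.sum_add_distrib]
  refine Finset.sum_congr rfl fun m hm => ?_
  rw [reflect_apply_of_le _ (by omega), show m + 2 - 1 = m + 1 by omega]
  have h1 := N.le_left m (m + 1)
  have h2 := N.antitone (le_refl m) (show 1 ≤ m + 1 by omega)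
  omega

/-- At height `n` all values are `0` or `1`, and reflection complements the value of column `n - 2 -
m` to that of column `m`. The last column is zero, leaving `n - 1` pairs. -/
theorem r_reflect (hn : 1 ≤ n) (N : HeightArray n) :
    N.toDPP.1.r n + N.reflect.toDPP.1.r n = n - 1 := by
  obtain ⟨k, rfl⟩ := Nat.exists_eq_add_of_le' hn
  rw [r_toDPP hn, r_toDPP hn, Finset.sum_range_succ, Finset.sum_range_succ,
    N.eq_zero_of_le (by omega), N.reflect.eq_zero_of_le (by omega), add_zero, add_zero,
    ← Finset.sum_range_reflect (fun m => N m (k + 1)), ← Finset.sum_add_distrib]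
  have : ∀ m ∈ Finset.range k, N (k - 1 - m) (k + 1) + N.reflect m (k + 1) = 1 := by
    intro m hm
    rw [Finset.mem_range] at hm
    rw [reflect_apply_of_ge _ (by omega), show k + 1 - m - 2 = k - 1 - m by omega]
    have := N.le_right (k - 1 - m) (k + 1)
    omega
  rw [Finset.sum_congr rfl this]
  simp

end HeightArray

/-! ### Tiles of the fundamental region -/

namespace Rhombus

theorem rotate_dir (ρ : Rhombus) : ρ.rotate.dir = ρ.dir + 2 := by
  have : ∀ d : Fin 3, (finRotate 3).symm d = d + 2 := by decide
  exact this _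

theorem ext_coord {ρ σ : Rhombus} (h0 : ρ.base 0 = σ.base 0) (h2 : ρ.base 2 = σ.base 2)
    (hd : ρ.dir = σ.dir) : ρ = σ := by
  have h3 := ρ.sum_base
  have h4 := σ.sum_base
  rw [Fin.sum_univ_three] at h3 h4
  refine Rhombus.ext (funext fun i => ?_) hd
  fin_cases i
  · exact h0
  · change ρ.base 1 = σ.base 1
    omega
  · exact h2

theorem base_one (ρ : Rhombus) : ρ.base 1 = -ρ.base 0 - ρ.base 2 := by
  have h3 := ρ.sum_base
  rw [Fin.sum_univ_three] at h3
  omega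

theorem rotate_base_zero (ρ : Rhombus) : ρ.rotate.base 0 = ρ.base 1 := rfl

theorem rotate_base_one (ρ : Rhombus) : ρ.rotate.base 1 = ρ.base 2 := rfl

theorem rotate_base_two (ρ : Rhombus) : ρ.rotate.base 2 = ρ.base 0 := rfl

theorem rotate_rotate_rotate (ρ : Rhombus) : ρ.rotate.rotate.rotate = ρ := by
  refine ext_coord rfl rfl ?_
  rw [rotate_dir, rotate_dir, rotate_dir]
  have : ∀ d : Fin 3, d + 2 + 2 + 2 = d := by decide
  exact this _

/-- The rhombus of direction `d` whose base has distance `m` from the left border and distance `h`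
from the bottom border of the fundamental region. -/
def tile (m h : ℕ) (d : Fin 3) : Rhombus where
  base := ![m + 1, h - m - 1, -h]
  dir := d
  sum_base := by
    simp [Fin.sum_univ_three]

@[simp] theorem tile_base_zero (m h : ℕ) (d : Fin 3) : (tile m h d).base 0 = m + 1 := rfl

@[simp] theorem tile_base_one (m h : ℕ) (d : Fin 3) : (tile m h d).base 1 = h - m - 1 := rfl

@[simp] theorem tile_base_two (m h : ℕ) (d : Fin 3) : (tile m h d).base 2 = -h := rfl

@[simp] theorem tile_dir (m h : ℕ) (d : Fin 3) : (tile m h d).dir = d := rfl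

theorem tile_inj {m h m' h' : ℕ} {d d' : Fin 3} :
    tile m h d = tile m' h' d' ↔ m = m' ∧ h = h' ∧ d = d' := by
  constructor
  · intro e
    have e0 : (tile m h d).base 0 = (tile m' h' d').base 0 := by rw [e]
    have e2 : (tile m h d).base 2 = (tile m' h' d').base 2 := by rw [e]
    have e3 : (tile m h d).dir = (tile m' h' d').dir := by rw [e]
    simp only [tile_base_zero, tile_base_two, tile_dir] at e0 e2 e3
    exact ⟨by omega, by omega, e3⟩
  · rintro ⟨rfl, rfl, rfl⟩
    rfl

theorem eq_tile_iff {ρ : Rhombus} {m h : ℕ} {d : Fin 3} :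
    ρ = tile m h d ↔ ρ.base 0 = m + 1 ∧ ρ.base 2 = -h ∧ ρ.dir = d := by
  refine ⟨?_, fun ⟨h0, h2, hd⟩ => ext_coord h0 h2 hd⟩
  rintro rfl
  simp

theorem exists_eq_tile {ρ : Rhombus} (h0 : 1 ≤ ρ.base 0) (h2 : ρ.base 2 ≤ 0) :
    ∃ m h, ρ = tile m h ρ.dir :=
  ⟨(ρ.base 0 - 1).toNat, (-ρ.base 2).toNat, eq_tile_iff.2 ⟨by omega, by omega, rfl⟩⟩

/-- The last base coordinate is positive after rotation and nonpositive for a `tile`. So the rhombi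
`tile m h d` represent each rotation orbit at most once. -/
theorem rotate_tile_ne (m h m' h' : ℕ) (d d' : Fin 3) : (tile m h d).rotate ≠ tile m' h' d' := by
  intro e
  have e2 : (tile m h d).rotate.base 2 = (tile m' h' d').base 2 := by rw [e]
  rw [rotate_base_two, tile_base_zero, tile_base_two] at e2
  omega

theorem rotate_rotate_tile_ne (m h m' h' : ℕ) (d d' : Fin 3) :
    (tile m h d).rotate.rotate ≠ tile m' h' d' := by
  intro e
  apply rotate_tile_ne m' h' m h d' d
  rw [← e, rotate_rotate_rotate]

/-- The rhombus of direction `2` that contains the unit triangle `![m + 1, h - m - 2, -h]`. -/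
def upperTile (m h : ℕ) : Rhombus where
  base := ![m + 1, h - m - 2, -h + 1]
  dir := 2
  sum_base := by
    simp [Fin.sum_univ_three]
    ring

theorem upperTile_succ (m h : ℕ) : upperTile m (h + 1) = tile m h 2 := by
  refine eq_tile_iff.2 ⟨rfl, ?_, rfl⟩
  change -((h + 1 : ℕ) : ℤ) + 1 = -h
  push_cast
  ring

/-- A rhombus cut by the bottom border is a rotated copy of one cut by the left border. This is the
source of the gluing. -/
theorem rotate_rotate_upperTile (m : ℕ) : (upperTile m 0).rotate.rotate = tile 0 (m + 2) 0 := by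
  refine eq_tile_iff.2 ⟨?_, ?_, rfl⟩
  · change -((0 : ℕ) : ℤ) + 1 = ((0 : ℕ) : ℤ) + 1
    simp
  · change ((0 : ℕ) : ℤ) - m - 2 = -((m + 2 : ℕ) : ℤ)
    push_cast
    ring

theorem sum_opp (ρ : Rhombus) : ∑ i, ρ.opp i = -1 := by
  unfold opp
  simp [Finset.sum_sub_distrib, ρ.sum_base]

theorem mem_cells_iff_of_sum_zero {ρ : Rhombus} {c : Fin 3 → ℤ} (hc : ∑ i, c i = 0) :
    c ∈ ρ.cells ↔ ρ.base = c := by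
  constructor
  · rintro (h | h)
    · exact h.symm
    · rw [show c = ρ.opp from h, sum_opp] at hc
      omega
  · rintro rfl
    exact Or.inl rfl

theorem mem_cells_iff_of_sum_neg_one {ρ : Rhombus} {c : Fin 3 → ℤ} (hc : ∑ i, c i = -1) :
    c ∈ ρ.cells ↔ ρ.opp = c := by
  constructor
  · rintro (h | h)
    · rw [show c = ρ.base from h, sum_base] at hc
      omega
    · exact h.symm
  · rintro rfl
    exact Or.inr rfl

theorem up_mem_cells_iff {ρ : Rhombus} {m h : ℕ} :
    ![(m : ℤ) + 1, h - m - 1, -h] ∈ ρ.cells ↔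
      ρ = tile m h 0 ∨ ρ = tile m h 1 ∨ ρ = tile m h 2 := by
  rw [mem_cells_iff_of_sum_zero (by simp [Fin.sum_univ_three])]
  constructor
  · intro e
    have h1 : ρ = tile m h ρ.dir := Rhombus.ext e rfl
    have h2 : ∀ d : Fin 3, d = 0 ∨ d = 1 ∨ d = 2 := by decide
    rcases h2 ρ.dir with h | h | h <;> rw [h] at h1 <;> simp [h1, tile_inj]
  · rintro (rfl | rfl | rfl) <;> rfl

theorem opp_apply (ρ : Rhombus) (i : Fin 3) :
    ρ.opp i = ρ.base i - if i = ρ.dir then 1 else 0 := by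
  simp [opp, Pi.single_apply]

theorem opp_eq_iff {ρ : Rhombus} {m h : ℕ} :
    ρ.opp = ![(m : ℤ) + 1, h - m - 2, -h] ↔
      ρ = tile (m + 1) h 0 ∨ ρ = tile m h 1 ∨ ρ = upperTile m h := by
  constructor
  · intro e
    have e0 := congrFun e 0
    have e2 := congrFun e 2
    rw [opp_apply] at e0 e2
    simp only [Matrix.cons_val_zero, Matrix.cons_val_two, Matrix.tail_cons, Matrix.head_cons] at e0 e2
    have h2 : ∀ d : Fin 3, d = 0 ∨ d = 1 ∨ d = 2 := by decide
    rcases h2 ρ.dir with hd | hd | hd <;> rw [hd] at e0 e2 <;> simp at e0 e2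
    · left
      rw [eq_tile_iff]
      push_cast
      exact ⟨by omega, by omega, hd⟩
    · right; left
      rw [eq_tile_iff]
      exact ⟨by omega, by omega, hd⟩
    · right; right
      refine ext_coord ?_ ?_ hd
      · change _ = (m : ℤ) + 1
        omega
      · change _ = -(h : ℤ) + 1
        omega
  · have e3 : ∀ c c' : Fin 3 → ℤ, c 0 = c' 0 → c 1 = c' 1 → c 2 = c' 2 → c = c' := by
      intro c c' h0 h1 h2
      funext i
      fin_cases i <;> assumption
    rintro (rfl | rfl | rfl) <;> refine e3 _ _ ?_ ?_ ?_ <;> rw [opp_apply] <;>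
      simp [upperTile] <;> omega

theorem down_mem_cells_iff {ρ : Rhombus} {m h : ℕ} :
    ![(m : ℤ) + 1, h - m - 2, -h] ∈ ρ.cells ↔
      ρ = tile (m + 1) h 0 ∨ ρ = tile m h 1 ∨ ρ = upperTile m h := by
  rw [mem_cells_iff_of_sum_neg_one (by simp [Fin.sum_univ_three]; ring), opp_eq_iff]

end Rhombus

theorem up_mem_holedHexagon_iff {n m h : ℕ} :
    ![(m : ℤ) + 1, h - m - 1, -h] ∈ holedHexagon n ↔ m + 1 < n ∧ h ≤ n := by
  simp [holedHexagon, hexagon, hole, IsUnitTriangle, Fin.sum_univ_three, Fin.forall_fin_succ]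
  omega

theorem down_mem_holedHexagon_iff {n m h : ℕ} :
    ![(m : ℤ) + 1, h - m - 2, -h] ∈ holedHexagon n ↔ m + 1 < n ∧ h ≤ n := by
  simp [holedHexagon, hexagon, hole, IsUnitTriangle, Fin.sum_univ_three, Fin.forall_fin_succ]
  omega

/-- Turns unique covering of a triangle into a linear equation between indicators. -/
theorem existsUnique_three_iff {α : Type*} (S : Set α) {a b c : α} (hab : a ≠ b) (hac : a ≠ c)
    (hbc : b ≠ c) [Decidable (a ∈ S)] [Decidable (b ∈ S)] [Decidable (c ∈ S)] :
    (∃! x, x ∈ S ∧ (x = a ∨ x = b ∨ x = c)) ↔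
      (if a ∈ S then 1 else 0) + (if b ∈ S then 1 else 0) + (if c ∈ S then 1 else 0) = 1 := by
  constructor
  · rintro ⟨x, ⟨hx, hx'⟩, hu⟩
    have ha : a ∈ S → a = x := fun h => hu a ⟨h, Or.inl rfl⟩
    have hb : b ∈ S → b = x := fun h => hu b ⟨h, Or.inr (Or.inl rfl)⟩
    have hc : c ∈ S → c = x := fun h => hu c ⟨h, Or.inr (Or.inr rfl)⟩
    rcases hx' with rfl | rfl | rfl
    · rw [if_pos hx, if_neg fun h => hab (hb h).symm, if_neg fun h => hac (hc h).symm]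
    · rw [if_pos hx, if_neg fun h => hab (ha h), if_neg fun h => hbc (hc h).symm]
    · rw [if_pos hx, if_neg fun h => hac (ha h), if_neg fun h => hbc (hb h)]
  · intro h
    by_cases h1 : a ∈ S
    · have h2 : b ∉ S := fun h2 => by rw [if_pos h1, if_pos h2] at h; omega
      have h3 : c ∉ S := fun h3 => by rw [if_pos h1, if_pos h3] at h; omega
      refine ⟨a, ⟨h1, Or.inl rfl⟩, ?_⟩
      rintro y ⟨hy, rfl | rfl | rfl⟩
      exacts [rfl, absurd hy h2, absurd hy h3]
    · by_cases h2 : b ∈ S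
      · have h3 : c ∉ S := fun h3 => by rw [if_pos h2, if_pos h3] at h; omega
        refine ⟨b, ⟨h2, Or.inr (Or.inl rfl)⟩, ?_⟩
        rintro y ⟨hy, rfl | rfl | rfl⟩
        exacts [absurd hy h1, rfl, absurd hy h3]
      · have h3 : c ∈ S := by
          by_contra h3
          rw [if_neg h1, if_neg h2, if_neg h3] at h
          omega
        refine ⟨c, ⟨h3, Or.inr (Or.inr rfl)⟩, ?_⟩
        rintro y ⟨hy, rfl | rfl | rfl⟩
        exacts [absurd hy h1, absurd hy h2, rfl]

section

open Rhombus

/-! ### The height array of a tiling -/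

namespace CyclicTiling

variable {n : ℕ}

theorem mem_tiles_of_rotate (T : CyclicTiling n) {ρ : Rhombus} (h : ρ.rotate ∈ T.tiles) :
    ρ ∈ T.tiles := by
  rw [← ρ.rotate_rotate_rotate]
  exact T.rotate_mem _ (T.rotate_mem _ h)

theorem rotate_mem_iff (T : CyclicTiling n) {ρ : Rhombus} : ρ.rotate ∈ T.tiles ↔ ρ ∈ T.tiles :=
  ⟨T.mem_tiles_of_rotate, T.rotate_mem ρ⟩

theorem base_mem (T : CyclicTiling n) {ρ : Rhombus} (h : ρ ∈ T.tiles) :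
    ρ.base ∈ holedHexagon n := T.cells_subset ρ h (Or.inl rfl)

theorem opp_mem (T : CyclicTiling n) {ρ : Rhombus} (h : ρ ∈ T.tiles) :
    ρ.opp ∈ holedHexagon n := T.cells_subset ρ h (Or.inr rfl)

theorem tile_bound (T : CyclicTiling n) {m h : ℕ} {d : Fin 3} (H : tile m h d ∈ T.tiles) :
    m + 1 < n ∧ h ≤ n :=
  up_mem_holedHexagon_iff.1 (T.base_mem H)

theorem tile_two_lt (T : CyclicTiling n) {m h : ℕ} (H : tile m h 2 ∈ T.tiles) : h < n := by
  have h1 := T.opp_mem H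
  have h2 := h1.1.2 2
  rw [opp_apply, tile_base_two, tile_dir, if_pos rfl] at h2
  omega

/-- For smaller `h` the left half of the rhombus would lie in the hole. -/
theorem two_le_of_tile_zero (T : CyclicTiling n) {h : ℕ} (H : tile 0 h 0 ∈ T.tiles) : 2 ≤ h := by
  have h1 := T.opp_mem H
  by_contra hlt
  refine h1.2 ⟨h1.1.1, fun i => ?_⟩
  rw [opp_apply]
  fin_cases i <;> simp <;> omega

open Classical in
/-- The indicator of a rhombus of the tiling. -/
noncomputable def ind (T : CyclicTiling n) (m h : ℕ) (d : Fin 3) : ℕ :=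
  if tile m h d ∈ T.tiles then 1 else 0

theorem ind_eq_one_iff (T : CyclicTiling n) {m h : ℕ} {d : Fin 3} :
    T.ind m h d = 1 ↔ tile m h d ∈ T.tiles := by
  unfold ind
  split_ifs with H <;> simp [H]

theorem ind_eq_zero_iff (T : CyclicTiling n) {m h : ℕ} {d : Fin 3} :
    T.ind m h d = 0 ↔ tile m h d ∉ T.tiles := by
  unfold ind
  split_ifs with H <;> simp [H]

theorem ind_le_one (T : CyclicTiling n) (m h : ℕ) (d : Fin 3) : T.ind m h d ≤ 1 := by
  unfold ind
  split_ifs <;> omega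

theorem ind_up (T : CyclicTiling n) {m h : ℕ} (hm : m + 1 < n) (hh : h ≤ n) :
    T.ind m h 0 + T.ind m h 1 + T.ind m h 2 = 1 := by
  classical
  have h1 := T.existsUnique_tile _ (up_mem_holedHexagon_iff.2 ⟨hm, hh⟩)
  simp only [up_mem_cells_iff] at h1
  rw [existsUnique_three_iff _ (by simp [tile_inj]) (by simp [tile_inj]) (by simp [tile_inj])] at h1
  unfold ind
  convert h1

theorem ind_down (T : CyclicTiling n) {m h : ℕ} (hm : m + 1 < n) (hh : h + 1 ≤ n) :
    T.ind (m + 1) (h + 1) 0 + T.ind m (h + 1) 1 + T.ind m h 2 = 1 := by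
  classical
  have h1 := T.existsUnique_tile _ (down_mem_holedHexagon_iff.2 ⟨hm, hh⟩)
  simp only [down_mem_cells_iff] at h1
  rw [existsUnique_three_iff _ (by simp [tile_inj]) (by simp [upperTile_succ, tile_inj])
    (by simp [upperTile_succ, tile_inj])] at h1
  rw [upperTile_succ] at h1
  unfold ind
  convert h1

theorem tile_ne_upperTile (m h m' h' : ℕ) (d : Fin 3) (hd : d ≠ 2) :
    tile m h d ≠ upperTile m' h' := by
  intro e
  have : (tile m h d).dir = (upperTile m' h').dir := by rw [e]
  exact hd this

theorem ind_down_zero (T : CyclicTiling n) {m : ℕ} (hm : m + 1 < n) :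
    T.ind (m + 1) 0 0 + T.ind m 0 1 + T.ind 0 (m + 2) 0 = 1 := by
  classical
  have h1 := T.existsUnique_tile _ (down_mem_holedHexagon_iff.2 ⟨hm, Nat.zero_le n⟩)
  simp only [down_mem_cells_iff] at h1
  rw [existsUnique_three_iff _ (by simp [tile_inj]) (tile_ne_upperTile _ _ _ _ _ (by decide))
    (tile_ne_upperTile _ _ _ _ _ (by decide))] at h1
  unfold ind
  rw [← rotate_rotate_upperTile]
  simp only [T.rotate_mem_iff]
  convert h1

/-- The number of horizontally oriented rhombi in column `m` with height at least `h`. -/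
noncomputable def height (T : CyclicTiling n) (m h : ℕ) : ℕ :=
  ∑ k ∈ Finset.Ico h (n + 1), T.ind m k 0

theorem ind_eq_zero_of_lt (T : CyclicTiling n) {m h : ℕ} (d : Fin 3) (hh : n < h) :
    T.ind m h d = 0 := by
  rw [ind_eq_zero_iff]
  intro H
  have := T.tile_bound H
  omega

theorem ind_eq_zero_of_le (T : CyclicTiling n) {m h : ℕ} (d : Fin 3) (hm : n ≤ m + 1) :
    T.ind m h d = 0 := by
  rw [ind_eq_zero_iff]
  intro H
  have := T.tile_bound H
  omega

theorem ind_two_eq_zero (T : CyclicTiling n) {m h : ℕ} (hh : n ≤ h) : T.ind m h 2 = 0 := by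
  rw [ind_eq_zero_iff]
  intro H
  have := T.tile_two_lt H
  omega

theorem height_eq_zero_of_lt (T : CyclicTiling n) {m h : ℕ} (hh : n < h) : T.height m h = 0 := by
  unfold height
  rw [Finset.Ico_eq_empty (by omega), Finset.sum_empty]

theorem height_eq_zero_of_le (T : CyclicTiling n) {m h : ℕ} (hm : n ≤ m + 1) :
    T.height m h = 0 :=
  Finset.sum_eq_zero fun _ _ => T.ind_eq_zero_of_le _ hm

theorem height_eq_add_ind_zero (T : CyclicTiling n) (m h : ℕ) :
    T.height m h = T.height m (h + 1) + T.ind m h 0 := by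
  by_cases hh : h < n + 1
  · unfold height
    rw [Finset.sum_eq_sum_Ico_succ_bot hh, add_comm]
  · rw [T.height_eq_zero_of_lt (by omega), T.height_eq_zero_of_lt (by omega),
      T.ind_eq_zero_of_lt _ (by omega)]

/-- Descending induction on `h`. Subtracting the covering equations of two adjacent triangles
eliminates the rhombus of direction `1` that they share. -/
theorem height_eq_add_ind_two (T : CyclicTiling n) (m h : ℕ) :
    T.height m (h + 1) = T.height (m + 1) (h + 1) + T.ind m h 2 := by
  by_cases hm : m + 1 < n
  · by_cases hh : h ≤ n
    · induction hh using Nat.decreasingInduction with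
      | self =>
        rw [T.height_eq_zero_of_lt (by omega), T.height_eq_zero_of_lt (by omega),
          T.ind_two_eq_zero le_rfl]
      | of_succ h hh ih =>
        have h1 := T.height_eq_add_ind_zero m (h + 1)
        have h2 := T.height_eq_add_ind_zero (m + 1) (h + 1)
        have h3 := T.ind_up hm (h := h + 1) (by omega)
        have h4 := T.ind_down hm (h := h) (by omega)
        omega
    · rw [T.height_eq_zero_of_lt (by omega), T.height_eq_zero_of_lt (by omega),
        T.ind_two_eq_zero (by omega)]
  · rw [T.height_eq_zero_of_le (by omega), T.height_eq_zero_of_le (by omega),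
        T.ind_eq_zero_of_le _ (by omega)]

/-- Descending induction on `m`: passing from `m + 1` to `m` adds `T.ind 0 (m + 2) 0` on both sides,
on the left because of the rhombus cut by the bottom border. -/
theorem height_glue (T : CyclicTiling n) (m : ℕ) : T.height m 0 = T.height 0 (m + 2) := by
  by_cases hm : m ≤ n
  · induction hm using Nat.decreasingInduction with
    | self => rw [T.height_eq_zero_of_le (by omega), T.height_eq_zero_of_lt (by omega)]
    | of_succ m hm ih =>
      by_cases hm' : m + 1 < n
      · have h1 := T.height_eq_add_ind_zero m 0
        have h2 := T.height_eq_add_ind_zero (m + 1) 0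
        have h3 := T.ind_up hm' (Nat.zero_le n)
        have h4 := T.ind_down_zero hm'
        have h5 := T.height_eq_add_ind_two m 0
        have h6 := T.height_eq_add_ind_zero 0 (m + 2)
        rw [show m + 1 + 2 = m + 2 + 1 by omega] at ih
        omega
      · rw [T.height_eq_zero_of_le (by omega), T.height_eq_zero_of_lt (by omega)]
  · rw [T.height_eq_zero_of_le (by omega), T.height_eq_zero_of_lt (by omega)]

theorem ind_zero_add_ind_two_le (T : CyclicTiling n) (m h : ℕ) :
    T.ind m h 0 + T.ind m h 2 ≤ 1 := by
  by_cases hb : m + 1 < n ∧ h ≤ n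
  · have := T.ind_up hb.1 hb.2
    omega
  · by_cases hm : m + 1 < n
    · rw [T.ind_eq_zero_of_lt _ (by omega), T.ind_eq_zero_of_lt _ (by omega)]
      omega
    · rw [T.ind_eq_zero_of_le _ (by omega), T.ind_eq_zero_of_le _ (by omega)]
      omega

/-- The height array of a tiling. -/
noncomputable def toHeightArray (T : CyclicTiling n) : HeightArray n where
  toFun := T.height
  succ_right_le m h := by
    have := T.height_eq_add_ind_zero m h
    omega
  succ_left_le m h := by
    cases h with
    | zero =>
      rw [T.height_glue, T.height_glue]
      have := T.height_eq_add_ind_zero 0 (m + 2)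
      rw [show m + 1 + 2 = m + 2 + 1 by omega]
      omega
    | succ h =>
      have := T.height_eq_add_ind_two m h
      omega
  le_succ_succ m h := by
    have h1 := T.height_eq_add_ind_zero m h
    have h2 := T.height_eq_add_ind_two m h
    have h3 := T.ind_zero_add_ind_two_le m h
    omega
  glue := T.height_glue
  hole := by
    have h1 := T.height_eq_add_ind_zero 0 1
    have h2 : T.ind 0 1 0 = 0 := by
      rw [ind_eq_zero_iff]
      intro H
      have := T.two_le_of_tile_zero H
      omega
    rw [h1, h2, add_zero]
  bound := T.height_eq_zero_of_lt (by omega)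

end CyclicTiling

theorem rotate_mem_rotations_iff (A : Set Rhombus) {ρ : Rhombus} :
    ρ.rotate ∈ rotations A ↔ ρ ∈ rotations A := by
  unfold rotations
  simp only [Set.mem_ofPred_eq, rotate_rotate_rotate]
  constructor
  · rintro (h | h | h)
    exacts [Or.inr (Or.inl h), Or.inr (Or.inr h), Or.inl h]
  · rintro (h | h | h)
    exacts [Or.inr (Or.inr h), Or.inl h, Or.inr (Or.inl h)]

/-! ### The tiling of a height array -/

namespace HeightArray

variable {n : ℕ}

/-- The rhombus `tile m h d` belongs to the tiling with height array `N`. -/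
def HasTile (N : HeightArray n) (m h : ℕ) (d : Fin 3) : Prop :=
  (m + 1 < n ∧ h ≤ n) ∧ (d = 0 → N m h = N m (h + 1) + 1) ∧
    (d = 1 → N m h = N (m + 1) (h + 1)) ∧ (d = 2 → N m (h + 1) = N (m + 1) (h + 1) + 1)

/-- Outside the region the array vanishes, so a drop in height already implies the bounds. -/
theorem hasTile_zero_iff (N : HeightArray n) {m h : ℕ} :
    N.HasTile m h 0 ↔ N m h = N m (h + 1) + 1 := by
  unfold HasTile
  simp only [Fin.isValue, forall_const, zero_ne_one, IsEmpty.forall_iff, Fin.reduceEq,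
    and_true, and_iff_right_iff_imp]
  intro h1
  refine ⟨?_, ?_⟩
  · by_contra hc
    have := N.eq_zero_of_le (m := m) (h := h) (by omega)
    omega
  · by_contra hc
    have := N.eq_zero_of_lt (m := m) (h := h) (by omega)
    omega

theorem hasTile_one_iff (N : HeightArray n) {m h : ℕ} :
    N.HasTile m h 1 ↔ (m + 1 < n ∧ h ≤ n) ∧ N m h = N (m + 1) (h + 1) := by
  simp [HasTile]

theorem hasTile_two_iff (N : HeightArray n) {m h : ℕ} :
    N.HasTile m h 2 ↔ N m (h + 1) = N (m + 1) (h + 1) + 1 := by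
  unfold HasTile
  simp only [Fin.isValue, forall_const, IsEmpty.forall_iff, true_and, Fin.reduceEq,
    and_iff_right_iff_imp]
  intro h1
  refine ⟨?_, ?_⟩
  · by_contra hc
    have := N.eq_zero_of_le (m := m) (h := h + 1) (by omega)
    omega
  · by_contra hc
    have := N.eq_zero_of_lt (m := m) (h := h + 1) (by omega)
    omega

/-- The rhombi of the tiling with height array `N`. -/
def tiles (N : HeightArray n) : Set Rhombus :=
  rotations {ρ | ∃ m h d, N.HasTile m h d ∧ ρ = tile m h d}

theorem rotate_mem_tiles_iff (N : HeightArray n) {ρ : Rhombus} :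
    ρ.rotate ∈ N.tiles ↔ ρ ∈ N.tiles :=
  rotate_mem_rotations_iff _

theorem tile_mem_tiles_iff (N : HeightArray n) {m h : ℕ} {d : Fin 3} :
    tile m h d ∈ N.tiles ↔ N.HasTile m h d := by
  unfold tiles rotations
  simp [tile_inj, rotate_tile_ne, rotate_rotate_tile_ne]

end HeightArray

/-- Otherwise positivity would pass around the cycle to all three coordinates, and the sum would be
at least `3`. -/
theorem exists_rotation_of_exists_pos {c : Fin 3 → ℤ} (hc : ∑ i, c i ≤ 1) (h : ∃ i, 1 ≤ c i) :
    (1 ≤ c 0 ∧ c 2 ≤ 0) ∨ (1 ≤ c 1 ∧ c 0 ≤ 0) ∨ (1 ≤ c 2 ∧ c 1 ≤ 0) := by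
  rw [Fin.sum_univ_three] at hc
  obtain ⟨i, hi⟩ := h
  fin_cases i <;> simp at hi <;> omega

theorem exists_one_le_of_mem_holedHexagon {n : ℕ} {c : Fin 3 → ℤ} (hc : c ∈ holedHexagon n) :
    ∃ i, 1 ≤ c i := by
  by_contra h
  push Not at h
  exact hc.2 ⟨hc.1.1, h⟩

theorem sum_le_one_of_mem_holedHexagon {n : ℕ} {c : Fin 3 → ℤ} (hc : c ∈ holedHexagon n) :
    ∑ i, c i ≤ 1 := by
  rcases hc.1.1 with h | h <;> omega

namespace Rhombus

/-- A rhombus whose base is not in the hole has a rotation in the fundamental region. -/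
theorem exists_rotation_eq_tile {ρ : Rhombus} (h : ∃ i, 1 ≤ ρ.base i) :
    ∃ m h d, ρ = tile m h d ∨ ρ.rotate = tile m h d ∨ ρ.rotate.rotate = tile m h d := by
  rcases exists_rotation_of_exists_pos (by rw [ρ.sum_base]; omega) h with h | h | h
  · obtain ⟨a, b, e⟩ := exists_eq_tile h.1 h.2
    exact ⟨a, b, _, Or.inl e⟩
  · obtain ⟨a, b, e⟩ := exists_eq_tile (ρ := ρ.rotate) h.1 h.2
    exact ⟨a, b, _, Or.inr (Or.inl e)⟩
  · obtain ⟨a, b, e⟩ := exists_eq_tile (ρ := ρ.rotate.rotate) h.1 h.2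
    exact ⟨a, b, _, Or.inr (Or.inr e)⟩

theorem mem_cells_rotate (ρ : Rhombus) (c : Fin 3 → ℤ) :
    c ∘ finRotate 3 ∈ ρ.rotate.cells ↔ c ∈ ρ.cells := by
  unfold rotate
  rw [mem_cells_perm]
  have : (c ∘ finRotate 3) ∘ (finRotate 3).symm = c := by
    funext i
    simp
  rw [this]

theorem cells_rotate_subset_iff {n : ℕ} (ρ : Rhombus) :
    ρ.rotate.cells ⊆ holedHexagon n ↔ ρ.cells ⊆ holedHexagon n := by
  constructor
  · intro h c hc
    exact (holedHexagon_perm n _ c).1 (h ((mem_cells_rotate ρ c).2 hc))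
  · intro h c hc
    have h1 := (mem_cells_perm _ _ _).1 hc
    exact (holedHexagon_perm n _ c).1 (h h1)

theorem cells_tile_subset_iff {n m h : ℕ} {d : Fin 3} :
    (tile m h d).cells ⊆ holedHexagon n ↔
      (m + 1 < n ∧ h ≤ n) ∧ (d = 0 → m = 0 → 2 ≤ h) ∧ (d = 2 → h < n) := by
  have h1 : (tile m h d).cells ⊆ holedHexagon n ↔
      (tile m h d).base ∈ holedHexagon n ∧ (tile m h d).opp ∈ holedHexagon n := by
    simp [cells, Set.insert_subset_iff]
  have h2 : (tile m h d).base ∈ holedHexagon n ↔ m + 1 < n ∧ h ≤ n := up_mem_holedHexagon_iff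
  rw [h1, h2]
  refine and_congr_right fun hb => ?_
  have h3 : ∀ d : Fin 3, d = 0 ∨ d = 1 ∨ d = 2 := by decide
  have h4 : IsUnitTriangle (tile m h d).opp := Or.inr (sum_opp _)
  simp only [holedHexagon, hexagon, hole, Set.mem_sdiff, Set.mem_ofPred_eq, h4, true_and,
    Fin.forall_fin_succ, opp_apply]
  rcases h3 d with rfl | rfl | rfl <;> simp <;> omega

end Rhombus

namespace HeightArray

variable {n : ℕ}

theorem existsUnique_rotate (N : HeightArray n) (c : Fin 3 → ℤ) :
    (∃! ρ, ρ ∈ N.tiles ∧ c ∈ ρ.cells) ↔ ∃! ρ, ρ ∈ N.tiles ∧ c ∘ finRotate 3 ∈ ρ.cells := by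
  constructor
  · rintro ⟨ρ, ⟨h1, h2⟩, hu⟩
    refine ⟨ρ.rotate, ⟨N.rotate_mem_tiles_iff.2 h1, (mem_cells_rotate ρ c).2 h2⟩, ?_⟩
    rintro σ ⟨h3, h4⟩
    have h5 := hu σ.rotate.rotate ⟨N.rotate_mem_tiles_iff.2 (N.rotate_mem_tiles_iff.2 h3), by
      rw [← mem_cells_rotate, rotate_rotate_rotate]
      exact h4⟩
    rw [← h5, rotate_rotate_rotate]
  · rintro ⟨ρ, ⟨h1, h2⟩, hu⟩
    have h6 : c ∈ ρ.rotate.rotate.cells := by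
      rw [← mem_cells_rotate, rotate_rotate_rotate]
      exact h2
    refine ⟨ρ.rotate.rotate, ⟨N.rotate_mem_tiles_iff.2 (N.rotate_mem_tiles_iff.2 h1), h6⟩, ?_⟩
    rintro σ ⟨h3, h4⟩
    have h5 := hu σ.rotate ⟨N.rotate_mem_tiles_iff.2 h3, (mem_cells_rotate σ c).2 h4⟩
    rw [← h5, rotate_rotate_rotate]

/-- The three indicators are the gaps in `N (m+1) (h+1) ≤ N m (h+1) ≤ N m h ≤ N (m+1) (h+1) + 1`,
which add up to one. -/
theorem existsUnique_up (N : HeightArray n) {m h : ℕ} (hm : m + 1 < n) (hh : h ≤ n) :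
    ∃! ρ, ρ ∈ N.tiles ∧ ![(m : ℤ) + 1, h - m - 1, -h] ∈ ρ.cells := by
  classical
  simp only [up_mem_cells_iff]
  rw [existsUnique_three_iff _ (by simp [tile_inj]) (by simp [tile_inj]) (by simp [tile_inj])]
  simp only [tile_mem_tiles_iff, hasTile_zero_iff, hasTile_one_iff, hasTile_two_iff]
  have h1 := N.succ_right_le m h
  have h2 := N.succ_left_le m (h + 1)
  have h3 := N.le_succ_succ m h
  split_ifs <;> omega

/-- The same with the chain that passes through `N (m+1) h` instead of `N m (h+1)`. -/
theorem existsUnique_down (N : HeightArray n) {m h : ℕ} (hm : m + 1 < n) (hh : h ≤ n) :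
    ∃! ρ, ρ ∈ N.tiles ∧ ![(m : ℤ) + 1, h - m - 2, -h] ∈ ρ.cells := by
  classical
  simp only [down_mem_cells_iff]
  rw [existsUnique_three_iff _ (by simp [tile_inj])
    (CyclicTiling.tile_ne_upperTile _ _ _ _ _ (by decide))
    (CyclicTiling.tile_ne_upperTile _ _ _ _ _ (by decide))]
  have h1 := N.succ_right_le (m + 1) h
  have h2 := N.succ_left_le m h
  have h3 := N.le_succ_succ m h
  have h4 : upperTile m h ∈ N.tiles ↔ N m h = N (m + 1) h + 1 := by
    cases h with
    | zero =>
      rw [← N.rotate_mem_tiles_iff, ← N.rotate_mem_tiles_iff, rotate_rotate_upperTile,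
        tile_mem_tiles_iff, hasTile_zero_iff, N.glue, N.glue]
    | succ h => rw [upperTile_succ, tile_mem_tiles_iff, hasTile_two_iff]
  simp only [tile_mem_tiles_iff, hasTile_zero_iff, hasTile_one_iff, h4]
  split_ifs <;> omega

/-- The tiling with height array `N`. -/
def toTiling (N : HeightArray n) : CyclicTiling n where
  tiles := N.tiles
  cells_subset := by
    have h1 : ∀ m h d, N.HasTile m h d → (tile m h d).cells ⊆ holedHexagon n := by
      intro m h d H
      rw [cells_tile_subset_iff]
      refine ⟨H.1, ?_, ?_⟩
      · rintro rfl rfl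
        rw [hasTile_zero_iff] at H
        -- Along the side of the hole the height is constant, so no horizontal rhombus occurs at
        -- height `0` or `1`.
        have h2 := N.hole
        have h3 := N.glue 0
        by_contra hlt
        obtain rfl | rfl : h = 0 ∨ h = 1 := by omega
        · simp only [zero_add] at *
          omega
        · simp only [Nat.reduceAdd] at *
          omega
      · rintro rfl
        rw [hasTile_two_iff] at H
        by_contra hlt
        rw [N.eq_zero_of_lt (by omega)] at H
        omega
    rintro ρ (⟨m, h, d, H, e⟩ | ⟨m, h, d, H, e⟩ | ⟨m, h, d, H, e⟩)
    · rw [e]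
      exact h1 m h d H
    · rw [← cells_rotate_subset_iff, e]
      exact h1 m h d H
    · rw [← cells_rotate_subset_iff, ← cells_rotate_subset_iff, e]
      exact h1 m h d H
  existsUnique_tile := by
    have key : ∀ c ∈ holedHexagon n, 1 ≤ c 0 → c 2 ≤ 0 →
        ∃! ρ, ρ ∈ N.tiles ∧ c ∈ ρ.cells := by
      intro c hc h0 h2
      have e3 : ∀ c c' : Fin 3 → ℤ, c 0 = c' 0 → c 1 = c' 1 → c 2 = c' 2 → c = c' := by
        intro c c' h0 h1 h2
        funext i
        fin_cases i <;> assumption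
      have hsum := hc.1.1
      unfold IsUnitTriangle at hsum
      rw [Fin.sum_univ_three] at hsum
      obtain ⟨m, hm⟩ := Int.eq_ofNat_of_zero_le (show 0 ≤ c 0 - 1 by omega)
      obtain ⟨h, hh⟩ := Int.eq_ofNat_of_zero_le (show 0 ≤ -c 2 by omega)
      rcases hsum with hsum | hsum
      · obtain rfl : c = ![(m : ℤ) + 1, h - m - 1, -h] := by
          refine e3 _ _ ?_ ?_ ?_ <;> simp <;> omega
        obtain ⟨h3, h4⟩ := up_mem_holedHexagon_iff.1 hc
        exact N.existsUnique_up h3 h4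
      · obtain rfl : c = ![(m : ℤ) + 1, h - m - 2, -h] := by
          refine e3 _ _ ?_ ?_ ?_ <;> simp <;> omega
        obtain ⟨h3, h4⟩ := down_mem_holedHexagon_iff.1 hc
        exact N.existsUnique_down h3 h4
    intro c hc
    rcases exists_rotation_of_exists_pos (sum_le_one_of_mem_holedHexagon hc)
      (exists_one_le_of_mem_holedHexagon hc) with h | h | h
    · exact key c hc h.1 h.2
    · rw [existsUnique_rotate]
      exact key _ ((holedHexagon_perm n _ c).2 hc) h.1 h.2
    · rw [existsUnique_rotate, existsUnique_rotate]
      exact key _ ((holedHexagon_perm n _ _).2 ((holedHexagon_perm n _ c).2 hc)) h.1 h.2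
  rotate_mem ρ h := N.rotate_mem_tiles_iff.2 h

theorem tile_mem_toTiling_iff (N : HeightArray n) {m h : ℕ} {d : Fin 3} :
    tile m h d ∈ N.toTiling.tiles ↔ N.HasTile m h d := N.tile_mem_tiles_iff

end HeightArray

namespace CyclicTiling

variable {n : ℕ}

theorem exists_one_le_base (T : CyclicTiling n) {ρ : Rhombus} (h : ρ ∈ T.tiles) :
    ∃ i, 1 ≤ ρ.base i :=
  exists_one_le_of_mem_holedHexagon (T.base_mem h)

/-- Two sets of rhombi that are invariant under rotation agree if they agree in the fundamental
region. -/
theorem set_ext_of_tile {A B : Set Rhombus} (hA : ∀ ρ : Rhombus, ρ.rotate ∈ A ↔ ρ ∈ A)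
    (hB : ∀ ρ : Rhombus, ρ.rotate ∈ B ↔ ρ ∈ B)
    (hA' : ∀ ρ ∈ A, ∃ i, 1 ≤ ρ.base i) (hB' : ∀ ρ ∈ B, ∃ i, 1 ≤ ρ.base i)
    (h : ∀ m h d, tile m h d ∈ A ↔ tile m h d ∈ B) : A = B := by
  have key : ∀ ρ : Rhombus, (∃ i, 1 ≤ ρ.base i) → (ρ ∈ A ↔ ρ ∈ B) := by
    intro ρ hρ
    obtain ⟨a, b, d, e | e | e⟩ := exists_rotation_eq_tile hρ
    · rw [e, h]
    · rw [← hA, ← hB, e, h]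
    · rw [← hA, ← hB, ← hA, ← hB, e, h]
  ext ρ
  exact ⟨fun hρ => (key ρ (hA' ρ hρ)).1 hρ, fun hρ => (key ρ (hB' ρ hρ)).2 hρ⟩

theorem ext_tile {T U : CyclicTiling n} (h : ∀ m h d, tile m h d ∈ T.tiles ↔ tile m h d ∈ U.tiles) :
    T = U :=
  CyclicTiling.ext (set_ext_of_tile (fun _ => T.rotate_mem_iff) (fun _ => U.rotate_mem_iff)
    (fun _ => T.exists_one_le_base) (fun _ => U.exists_one_le_base) h)

theorem tile_mem_iff (T : CyclicTiling n) {m h : ℕ} {d : Fin 3} :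
    tile m h d ∈ T.tiles ↔ T.toHeightArray.HasTile m h d := by
  have h1 : T.toHeightArray m h = T.toHeightArray m (h + 1) + T.ind m h 0 :=
    T.height_eq_add_ind_zero m h
  have h2 : T.toHeightArray m (h + 1) = T.toHeightArray (m + 1) (h + 1) + T.ind m h 2 :=
    T.height_eq_add_ind_two m h
  have h3 : ∀ d : Fin 3, d = 0 ∨ d = 1 ∨ d = 2 := by decide
  rw [← ind_eq_one_iff]
  rcases h3 d with rfl | rfl | rfl
  · rw [HeightArray.hasTile_zero_iff]
    omega
  · rw [HeightArray.hasTile_one_iff]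
    by_cases hb : m + 1 < n ∧ h ≤ n
    · have := T.ind_up hb.1 hb.2
      omega
    · refine ⟨fun H => absurd (T.tile_bound (T.ind_eq_one_iff.1 H)) hb, fun H => absurd H.1 hb⟩
  · rw [HeightArray.hasTile_two_iff]
    omega

theorem toTiling_toHeightArray (T : CyclicTiling n) : T.toHeightArray.toTiling = T :=
  ext_tile fun m h d => by rw [HeightArray.tile_mem_toTiling_iff, T.tile_mem_iff]

end CyclicTiling

namespace HeightArray

variable {n : ℕ}

theorem toHeightArray_toTiling (N : HeightArray n) : N.toTiling.toHeightArray = N := by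
  apply ext_apply
  intro m h
  by_cases hh : h ≤ n + 1
  · induction hh using Nat.decreasingInduction with
    | self => rw [eq_zero_of_lt _ (by omega), eq_zero_of_lt _ (by omega)]
    | of_succ h hh ih =>
      have h1 : N.toTiling.toHeightArray m h =
          N.toTiling.toHeightArray m (h + 1) + N.toTiling.ind m h 0 :=
        N.toTiling.height_eq_add_ind_zero m h
      have h2 := N.toTiling.ind_le_one m h 0
      have h3 := N.toTiling.ind_eq_one_iff (m := m) (h := h) (d := 0)
      rw [tile_mem_toTiling_iff, hasTile_zero_iff] at h3
      have h4 := N.succ_right_le m h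
      have h5 := N.le_succ_succ m h
      have h6 := N.succ_left_le m (h + 1)
      omega
  · rw [eq_zero_of_lt _ (by omega), eq_zero_of_lt _ (by omega)]

/-- Height arrays and cyclically symmetric tilings correspond to each other. -/
noncomputable def tilingEquiv (n : ℕ) : CyclicTiling n ≃ HeightArray n where
  toFun := CyclicTiling.toHeightArray
  invFun := toTiling
  left_inv := CyclicTiling.toTiling_toHeightArray
  right_inv := toHeightArray_toTiling

end HeightArray

/-! ### Reading off the rows -/

namespace Rhombus

theorem base_two_of_pathStep {ρ ρ' : Rhombus} (h : PathStep ρ ρ') :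
    ρ'.base 2 = ρ.base 2 + if (2 : Fin 3) = ρ'.dir then 1 else 0 := by
  have h1 := congrFun h.2.2 2
  rw [opp_apply] at h1
  simp at h1
  omega

/-- A path that has crossed the bottom border does not reach it again. -/
theorem not_cutByBottomBorder_getLast (Q : List Rhombus) (ρ σ : Rhombus)
    (hc : (ρ :: Q).IsChain PathStep) (hρ : 1 ≤ ρ.base 2) (hσ : Q.getLast? = some σ) :
    ¬ σ.CutByBottomBorder := by
  induction Q generalizing ρ with
  | nil => simp at hσ
  | cons ρ' Q ih =>
    rw [List.isChain_cons_cons] at hc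
    have h1 := base_two_of_pathStep hc.1
    cases Q with
    | nil =>
      simp only [List.getLast?_singleton, Option.some.injEq] at hσ
      subst hσ
      rintro ⟨h2, h3, -⟩
      rw [if_pos h2.symm] at h1
      omega
    | cons ρ'' Q =>
      rw [List.getLast?_cons_cons] at hσ
      refine ih ρ' hc.2 ?_ hσ
      split_ifs at h1 <;> omega

theorem pathStep_tile_iff {m h : ℕ} {d : Fin 3} {ρ : Rhombus} :
    PathStep (tile m h d) ρ ↔ d ≠ 1 ∧ (ρ = tile (m + 1) h 0 ∨ ρ = upperTile m h) := by
  have h1 : (tile m h d).base - Pi.single 1 1 = ![(m : ℤ) + 1, h - m - 2, -h] := by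
    funext i
    fin_cases i <;> simp
    ring
  unfold PathStep
  rw [h1, opp_eq_iff, tile_dir]
  constructor
  · rintro ⟨h2, h3, rfl | rfl | rfl⟩
    · exact ⟨h2, Or.inl rfl⟩
    · exact absurd rfl h3
    · exact ⟨h2, Or.inr rfl⟩
  · rintro ⟨h2, rfl | rfl⟩
    · exact ⟨h2, by simp, Or.inl rfl⟩
    · exact ⟨h2, by simp [upperTile], Or.inr (Or.inr rfl)⟩

theorem height_tile (m h : ℕ) (d : Fin 3) : (tile m h d).height = h := by
  simp [height]

end Rhombus

namespace CyclicTiling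

theorem pathRow_nil : pathRow [] = [] := rfl

theorem pathRow_cons_of_ne (ρ : Rhombus) (P : List Rhombus) (h : ρ.dir ≠ 0) :
    pathRow (ρ :: P) = pathRow P := by
  simp [pathRow, h]

theorem pathRow_cons_tile (m h : ℕ) (P : List Rhombus) :
    pathRow (tile m h 0 :: P) = if 0 < h then h :: pathRow P else pathRow P := by
  simp only [pathRow, tile_dir, decide_true, List.filter_cons_of_pos, List.map_cons, height_tile]
  split_ifs with h1 <;> simp [h1]

variable {n : ℕ}

theorem drop_row_eq_nil (N : HeightArray n) {i m : ℕ} (h : N m 1 ≤ i) : (N.row i).drop m = [] := by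
  rw [List.drop_eq_nil_iff]
  have := N.lt_rowLen_iff (i := i) (m := m)
  simp only [HeightArray.row, List.length_map, List.length_range]
  omega

theorem drop_row_eq_cons (N : HeightArray n) {i m h : ℕ} (hh : 1 ≤ h) (h1 : i < N m h)
    (h2 : N m (h + 1) ≤ i) : (N.row i).drop m = h :: (N.row i).drop (m + 1) := by
  have h3 : N.part i m = h := by
    have h4 := (N.le_part_iff (i := i) (m := m) hh).2 h1
    have h5 := N.le_part_iff (i := i) (m := m) (h := h + 1) (by omega)
    omega
  have h6 : m < N.rowLen i := N.lt_rowLen_iff.2 (h1.trans_le (N.antitone le_rfl hh))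
  have h7 : m < (N.row i).length := by simpa [HeightArray.row] using h6
  rw [List.drop_eq_getElem_cons h7]
  congr 1
  simp [HeightArray.row, h3]

/-- The part of a path behind a rhombus of the fundamental region. -/
theorem pathRow_tail (T : CyclicTiling n) (Q : List Rhombus) (m h i : ℕ) (d : Fin 3) (σ : Rhombus)
    (h1 : T.toHeightArray m h = i + 1) (h2 : T.toHeightArray (m + 1) (h + 1) = i)
    (hQ : ∀ ρ ∈ Q, ρ ∈ T.tiles) (hc : (tile m h d :: Q).IsChain PathStep)
    (hσ : Q.getLast? = some σ) (hcut : σ.CutByBottomBorder) :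
    pathRow Q = (T.toHeightArray.row i).drop (m + 1) := by
  -- The two hypotheses on the heights are preserved by both kinds of step, so the index `i` stays
  -- constant along the path.
  induction Q generalizing m h d with
  | nil => simp at hσ
  | cons ρ Q ih =>
    rw [List.isChain_cons_cons, pathStep_tile_iff] at hc
    obtain ⟨⟨-, rfl | rfl⟩, hc⟩ := hc
    · have h3 := hQ _ List.mem_cons_self
      rw [tile_mem_iff, HeightArray.hasTile_zero_iff] at h3
      have h4 := T.toHeightArray.le_succ_succ (m + 1) h
      have h5 := T.toHeightArray.succ_left_le (m + 1) (h + 1)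
      cases Q with
      | nil =>
        simp only [List.getLast?_singleton, Option.some.injEq] at hσ
        subst hσ
        exact absurd hcut.1 (by simp)
      | cons ρ' Q =>
        rw [List.getLast?_cons_cons] at hσ
        rw [pathRow_cons_tile, ih (m + 1) h 0 (by omega) (by omega)
          (fun ρ hρ => hQ ρ (List.mem_cons_of_mem _ hρ)) hc hσ]
        split_ifs with hh
        · exact (drop_row_eq_cons T.toHeightArray hh (by omega) (by omega)).symm
        -- Horizontal steps at height `0` contribute nothing, and row `i` has already ended.
        · obtain rfl : h = 0 := by omega
          have h6 : T.toHeightArray (m + 1 + 1) 1 ≤ i := by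
            simp only [zero_add] at h2 h5
            omega
          rw [drop_row_eq_nil _ h6, drop_row_eq_nil _ (m := m + 1) (by simpa using h2.le)]
    · rw [pathRow_cons_of_ne _ _ (by simp [upperTile])]
      cases h with
      -- This rhombus is cut by the bottom border, so the path must end with it.
      | zero =>
        cases Q with
        | nil => rw [pathRow_nil, drop_row_eq_nil _ (by simpa using h2.le)]
        | cons ρ' Q =>
          rw [List.getLast?_cons_cons] at hσ
          exact absurd hcut (not_cutByBottomBorder_getLast _ _ _ hc (by simp [upperTile]) hσ)
      | succ h =>
        rw [upperTile_succ] at *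
        have h3 := hQ _ List.mem_cons_self
        rw [tile_mem_iff, HeightArray.hasTile_two_iff] at h3
        have h4 := T.toHeightArray.le_succ_succ m h
        have h5 := T.toHeightArray.succ_right_le m h
        cases Q with
        | nil =>
          simp only [List.getLast?_singleton, Option.some.injEq] at hσ
          subst hσ
          have := hcut.2.1
          simp at this
          omega
        | cons ρ' Q =>
          rw [List.getLast?_cons_cons] at hσ
          exact ih m h 2 (by omega) (by omega)
            (fun ρ hρ => hQ ρ (List.mem_cons_of_mem _ hρ)) hc hσ

/-- The triangle beyond the exit edge is covered, and the height difference excludes direction `1`,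
so the path goes on. Each step inside the region moves right or down, which lowers `n - m + h`,
until the bottom border is crossed. -/
theorem exists_tail (T : CyclicTiling n) (m h i : ℕ)
    (h1 : T.toHeightArray m h = i + 1) (h2 : T.toHeightArray (m + 1) (h + 1) = i) :
    ∃ Q : List Rhombus, (∀ ρ ∈ Q, ρ ∈ T.tiles) ∧
      (∀ d : Fin 3, d ≠ 1 → (tile m h d :: Q).IsChain PathStep) ∧
      ∃ σ, Q.getLast? = some σ ∧ σ.CutByBottomBorder := by
  obtain ⟨c, hc⟩ : ∃ c, c = n - m + h := ⟨_, rfl⟩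
  induction c using Nat.strong_induction_on generalizing m h with
  | _ c ih =>
    have hm : m + 1 < n := by
      by_contra hm
      have := T.toHeightArray.eq_zero_of_le (m := m) (h := h) (by omega)
      omega
    have hh : h ≤ n := by
      by_contra hh
      have := T.toHeightArray.eq_zero_of_lt (m := m) (h := h) (by omega)
      omega
    have extend : ∀ (m' h' : ℕ) (d' : Fin 3), d' ≠ 1 → n - m' + h' < c →
        T.toHeightArray m' h' = i + 1 → T.toHeightArray (m' + 1) (h' + 1) = i → tile m' h' d' ∈ T.tiles →
        (∀ d : Fin 3, d ≠ 1 → PathStep (tile m h d) (tile m' h' d')) →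
        ∃ Q : List Rhombus, (∀ ρ ∈ Q, ρ ∈ T.tiles) ∧
          (∀ d : Fin 3, d ≠ 1 → (tile m h d :: Q).IsChain PathStep) ∧
          ∃ σ, Q.getLast? = some σ ∧ σ.CutByBottomBorder := by
      intro m' h' d' hd' hlt e1 e2 hmem hstep
      obtain ⟨Q, hQ1, hQ2, σ, hσ, hcut⟩ := ih _ hlt m' h' e1 e2 rfl
      refine ⟨tile m' h' d' :: Q, ?_, ?_, σ, ?_, hcut⟩
      · intro ρ hρ
        rcases List.mem_cons.1 hρ with rfl | hρ
        · exact hmem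
        · exact hQ1 ρ hρ
      · intro d hd
        rw [List.isChain_cons_cons]
        exact ⟨hstep d hd, hQ2 d' hd'⟩
      · cases Q with
        | nil => simp at hσ
        | cons ρ Q => rwa [List.getLast?_cons_cons]
    obtain ⟨ρ, ⟨hρ, hcell⟩, -⟩ := T.existsUnique_tile _ (down_mem_holedHexagon_iff.2 ⟨hm, hh⟩)
    rw [down_mem_cells_iff] at hcell
    rcases hcell with rfl | rfl | rfl
    · have h3 := hρ
      rw [tile_mem_iff, HeightArray.hasTile_zero_iff] at h3
      have h4 := T.toHeightArray.le_succ_succ (m + 1) h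
      have h5 := T.toHeightArray.succ_left_le (m + 1) (h + 1)
      exact extend (m + 1) h 0 (by decide) (by omega) (by omega) (by omega) hρ
        fun d hd => pathStep_tile_iff.2 ⟨hd, Or.inl rfl⟩
    · rw [tile_mem_iff, HeightArray.hasTile_one_iff] at hρ
      omega
    · cases h with
      | zero =>
        refine ⟨[upperTile m 0], by simpa using hρ, fun d hd => ?_, upperTile m 0, rfl, rfl, ?_, ?_⟩
        · rw [List.isChain_pair, pathStep_tile_iff]
          exact ⟨hd, Or.inr rfl⟩
        · simp [upperTile]
        · simp [upperTile]
      | succ h =>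
        rw [upperTile_succ] at hρ
        have h3 := hρ
        rw [tile_mem_iff, HeightArray.hasTile_two_iff] at h3
        have h4 := T.toHeightArray.le_succ_succ m h
        have h5 := T.toHeightArray.succ_right_le m h
        exact extend m h 2 (by decide) (by omega) (by omega) (by omega) hρ
          fun d hd => pathStep_tile_iff.2 ⟨hd, Or.inr (upperTile_succ m h).symm⟩

/-- The path with index `i` starts at the height where column `0` drops from `i + 1` to `i`, which
is the first entry of row `i`. Conversely, a path starting at height `h` has as index the number of
starting points above it. -/
theorem readsOff_toDPP (T : CyclicTiling n) : T.ReadsOff T.toHeightArray.toDPP := by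
  intro row
  change row ∈ T.toHeightArray.rows ↔ _
  constructor
  · intro hrow
    obtain ⟨i, hi, rfl⟩ := List.mem_map.1 hrow
    rw [List.mem_range] at hi
    have hpos : 1 ≤ T.toHeightArray.part i 0 := (T.toHeightArray.le_part_iff le_rfl).2 hi
    obtain ⟨h, hh⟩ : ∃ h, h = T.toHeightArray.part i 0 := ⟨_, rfl⟩
    have h1 := (T.toHeightArray.le_part_iff (i := i) (m := 0) (h := h) (by omega)).1 hh.le
    have h2 := T.toHeightArray.le_part_iff (i := i) (m := 0) (h := h + 1) (by omega)
    have h3 := T.toHeightArray.le_succ_succ 0 h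
    have h4 := T.toHeightArray.succ_left_le 0 (h + 1)
    have h5 : tile 0 h 0 ∈ T.tiles := by
      rw [tile_mem_iff, HeightArray.hasTile_zero_iff]
      omega
    rw [zero_add] at h3 h4
    obtain ⟨Q, hQ1, hQ2, σ, hσ, hcut⟩ := T.exists_tail 0 h i (by omega) (by rw [zero_add]; omega)
    refine ⟨tile 0 h 0 :: Q, ⟨?_, hQ2 0 (by decide), ⟨_, rfl, rfl, by simp, ?_⟩, σ, ?_, hcut⟩, ?_⟩
    · intro ρ hρ
      rcases List.mem_cons.1 hρ with rfl | hρ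
      · exact h5
      · exact hQ1 ρ hρ
    · simp
      omega
    · cases Q with
      | nil => simp at hσ
      | cons ρ Q => rwa [List.getLast?_cons_cons]
    · rw [pathRow_cons_tile, if_pos (by omega),
        T.pathRow_tail Q 0 h i 0 σ (by omega) (by rw [zero_add]; omega) hQ1 (hQ2 0 (by decide)) hσ
          hcut, ← drop_row_eq_cons _ (by omega) (by omega) (by omega)]
      rfl
  · rintro ⟨P, ⟨hP, hc, ⟨ρ, hρ, hd, h0, h2⟩, σ, hσ, hcut⟩, rfl⟩
    cases P with
    | nil => simp at hρ
    | cons ρ' Q =>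
      simp only [List.head?_cons, Option.some.injEq] at hρ
      subst hρ
      obtain ⟨m, h, e⟩ := exists_eq_tile (ρ := ρ') (by omega) (by omega)
      rw [hd] at e
      subst e
      obtain rfl : m = 0 := by
        simp at h0
        omega
      have h3 := hP _ List.mem_cons_self
      have h4 := T.two_le_of_tile_zero h3
      rw [tile_mem_iff, HeightArray.hasTile_zero_iff] at h3
      have h5 := T.toHeightArray.le_succ_succ 0 h
      have h6 := T.toHeightArray.succ_left_le 0 (h + 1)
      rw [zero_add] at h5 h6
      cases Q with
      | nil =>
        simp only [List.getLast?_singleton, Option.some.injEq] at hσ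
        subst hσ
        exact absurd hcut.1 (by simp)
      | cons ρ' Q =>
        rw [List.getLast?_cons_cons] at hσ
        rw [pathRow_cons_tile, if_pos (by omega),
          T.pathRow_tail _ 0 h (T.toHeightArray 0 (h + 1)) 0 σ (by omega) (by rw [zero_add]; omega)
            (fun ρ hρ => hP ρ (List.mem_cons_of_mem _ hρ)) hc hσ hcut,
          ← drop_row_eq_cons _ (by omega) (by omega) (by omega)]
        refine List.mem_map.2 ⟨T.toHeightArray 0 (h + 1), ?_, rfl⟩
        rw [List.mem_range]
        have := T.toHeightArray.antitone (le_refl 0) (show 1 ≤ h by omega)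
        omega

end CyclicTiling

namespace DescendingPlanePartition

theorem pairwise_rows (π : DescendingPlanePartition) :
    π.rows.Pairwise fun a b => b.headD 0 < a.headD 0 := by
  rw [List.pairwise_iff_getElem]
  intro i j hi hj hij
  have key : ∀ k (hk : k < π.rows.length), π.rows[k].headD 0 = π.part k 0 := by
    intro k hk
    unfold part
    rw [List.getD_eq_getElem _ _ hk]
    cases π.rows[k] <;> rfl
  rw [key, key]
  have h1 : 0 < π.part (i + 1) 0 := by
    rw [part_pos_iff]
    exact π.rowLength_pos _ (by omega)
  have h2 := π.part_succ_lt h1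
  have h3 := π.part_succ_right_le i 0
  have h4 : π.part j 0 ≤ π.part (i + 1) 0 := π.part_antitone 0 (by omega)
  rw [zero_add] at *
  omega

/-- First entries strictly decrease, so the rows are distinct and their set determines their order.
-/
theorem ext_mem {π σ : DescendingPlanePartition} (h : ∀ row, row ∈ π.rows ↔ row ∈ σ.rows) :
    π = σ := by
  have nodup : ∀ π : DescendingPlanePartition, π.rows.Nodup := fun π =>
    π.pairwise_rows.imp fun hab => by
      rintro rfl
      exact lt_irrefl _ hab
  have hp := (List.perm_ext_iff_of_nodup (nodup π) (nodup σ)).2 h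
  exact DescendingPlanePartition.ext
    (hp.eq_of_pairwise (fun a b _ _ h1 h2 => (lt_asymm h1 h2).elim) π.pairwise_rows σ.pairwise_rows)

end DescendingPlanePartition

theorem CyclicTiling.readsOff_iff {n : ℕ} (T : CyclicTiling n) (π : BoundedDPP n) :
    T.ReadsOff π ↔ T.toHeightArray.toDPP = π := by
  constructor
  · intro h
    exact Subtype.ext (DescendingPlanePartition.ext_mem fun row =>
      (T.readsOff_toDPP row).trans (h row).symm)
  · rintro rfl
    exact T.readsOff_toDPP

/-! ### Moves -/

theorem mem_flipBefore_iff {p : Fin 3 → ℤ} (hp : ∑ i, p i = 1) {ρ : Rhombus} :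
    ρ ∈ flipBefore p ↔ (ρ.dir = 2 ∧ ρ.base 0 = p 0 - 1 ∧ ρ.base 2 = p 2) ∨
      (ρ.dir = 0 ∧ ρ.base 0 = p 0 ∧ ρ.base 2 = p 2) ∨
      (ρ.dir = 1 ∧ ρ.base 0 = p 0 ∧ ρ.base 2 = p 2 - 1) := by
  have h1 := ρ.base_one
  rw [Fin.sum_univ_three] at hp
  unfold flipBefore
  simp only [Set.mem_ofPred_eq, Fin.exists_fin_succ, funext_iff, Fin.forall_fin_succ]
  simp
  have h3 : ∀ d : Fin 3, d = 0 ∨ d = 1 ∨ d = 2 := by decide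
  rcases h3 ρ.dir with hd | hd | hd <;> rw [hd] <;> simp <;> omega

theorem mem_flipAfter_iff {p : Fin 3 → ℤ} (hp : ∑ i, p i = 1) {ρ : Rhombus} :
    ρ ∈ flipAfter p ↔ (ρ.dir = 1 ∧ ρ.base 0 = p 0 - 1 ∧ ρ.base 2 = p 2) ∨
      (ρ.dir = 2 ∧ ρ.base 0 = p 0 ∧ ρ.base 2 = p 2) ∨
      (ρ.dir = 0 ∧ ρ.base 0 = p 0 ∧ ρ.base 2 = p 2 - 1) := by
  have h1 := ρ.base_one
  rw [Fin.sum_univ_three] at hp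
  unfold flipAfter
  simp only [Set.mem_ofPred_eq, Fin.exists_fin_succ, funext_iff, Fin.forall_fin_succ]
  simp
  have h3 : ∀ d : Fin 3, d = 0 ∨ d = 1 ∨ d = 2 := by decide
  rcases h3 ρ.dir with hd | hd | hd <;> rw [hd] <;> simp <;> omega

theorem mem_specialBefore_iff {ρ : Rhombus} :
    ρ ∈ specialBefore ↔ ρ.dir = 1 ∧ ρ.base 0 = 1 ∧
      (ρ.base 2 = -2 ∨ ρ.base 2 = -1 ∨ ρ.base 2 = 0) := by
  have h1 := ρ.base_one
  unfold specialBefore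
  simp only [Set.mem_ofPred_eq, funext_iff, Fin.forall_fin_succ]
  simp
  have h3 : ∀ d : Fin 3, d = 0 ∨ d = 1 ∨ d = 2 := by decide
  rcases h3 ρ.dir with hd | hd | hd <;> rw [hd] <;> simp
  omega

theorem mem_specialAfter_iff {ρ : Rhombus} :
    ρ ∈ specialAfter ↔ ρ.base 0 = 1 ∧ ((ρ.dir = 0 ∧ ρ.base 2 = -2) ∨
      (ρ.dir = 2 ∧ (ρ.base 2 = -1 ∨ ρ.base 2 = 0))) := by
  have h1 := ρ.base_one
  unfold specialAfter
  simp only [Set.mem_ofPred_eq, funext_iff, Fin.forall_fin_succ]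
  simp
  have h3 : ∀ d : Fin 3, d = 0 ∨ d = 1 ∨ d = 2 := by decide
  rcases h3 ρ.dir with hd | hd | hd <;> rw [hd] <;> simp <;> omega

/-- The lattice point with distance `m` from the left border and height `h`. -/
def latticePoint (m h : ℕ) : Fin 3 → ℤ := ![m + 1, h - m - 1, 1 - h]

theorem sum_latticePoint (m h : ℕ) : ∑ i, latticePoint m h i = 1 := by
  simp [latticePoint, Fin.sum_univ_three]

theorem tile_mem_rotations_iff {A : Set Rhombus} {m h : ℕ} {d : Fin 3} :
    tile m h d ∈ rotations A ↔
      tile m h d ∈ A ∨ (tile m h d).rotate ∈ A ∨ (tile m h d).rotate.rotate ∈ A := Iff.rfl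

/-- If the hexagon is centred on the left border, the rhombus that sticks out to the left reappears,
rotated, at height `0` in column `h - 2`. -/
theorem tile_mem_rotations_flipBefore_iff {m h m' h' : ℕ} {d : Fin 3} (hs : 1 ≤ h) :
    tile m' h' d ∈ rotations (flipBefore (latticePoint m h)) ↔
      (d = 0 ∧ m' = m ∧ h' + 1 = h) ∨
      (d = 1 ∧ ((m' = m ∧ h' = h) ∨ (m = 0 ∧ h' = 0 ∧ m' + 2 = h))) ∨
      (d = 2 ∧ m' + 1 = m ∧ h' + 1 = h) := by
  rw [tile_mem_rotations_iff]
  simp only [mem_flipBefore_iff (sum_latticePoint m h), rotate_base_zero, rotate_base_one,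
    rotate_base_two, rotate_dir, tile_base_zero, tile_base_one, tile_base_two, tile_dir]
  have e0 : latticePoint m h 0 = m + 1 := rfl
  have e2 : latticePoint m h 2 = 1 - h := rfl
  rw [e0, e2]
  have h3 : ∀ d : Fin 3, d = 0 ∨ d = 1 ∨ d = 2 := by decide
  rcases h3 d with rfl | rfl | rfl <;> simp <;> omega

theorem tile_mem_rotations_flipAfter_iff {m h m' h' : ℕ} {d : Fin 3} (hs : 1 ≤ h) :
    tile m' h' d ∈ rotations (flipAfter (latticePoint m h)) ↔
      (d = 0 ∧ ((m' = m ∧ h' = h) ∨ (m = 0 ∧ h' = 0 ∧ m' + 2 = h))) ∨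
      (d = 1 ∧ m' + 1 = m ∧ h' + 1 = h) ∨
      (d = 2 ∧ m' = m ∧ h' + 1 = h) := by
  rw [tile_mem_rotations_iff]
  simp only [mem_flipAfter_iff (sum_latticePoint m h), rotate_base_zero, rotate_base_one,
    rotate_base_two, rotate_dir, tile_base_zero, tile_base_one, tile_base_two, tile_dir]
  have e0 : latticePoint m h 0 = m + 1 := rfl
  have e2 : latticePoint m h 2 = 1 - h := rfl
  rw [e0, e2]
  have h3 : ∀ d : Fin 3, d = 0 ∨ d = 1 ∨ d = 2 := by decide
  rcases h3 d with rfl | rfl | rfl <;> simp <;> omega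

theorem tile_mem_rotations_specialBefore_iff {m h : ℕ} {d : Fin 3} :
    tile m h d ∈ rotations specialBefore ↔ d = 1 ∧ m = 0 ∧ h ≤ 2 := by
  rw [tile_mem_rotations_iff]
  simp only [mem_specialBefore_iff, rotate_base_zero, rotate_base_one,
    rotate_base_two, rotate_dir, tile_base_zero, tile_base_one, tile_base_two, tile_dir]
  have h3 : ∀ d : Fin 3, d = 0 ∨ d = 1 ∨ d = 2 := by decide
  rcases h3 d with rfl | rfl | rfl <;> simp <;> omega

theorem tile_mem_rotations_specialAfter_iff {m h : ℕ} {d : Fin 3} :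
    tile m h d ∈ rotations specialAfter ↔ m = 0 ∧ ((d = 0 ∧ h = 2) ∨ (d = 2 ∧ h ≤ 1)) := by
  rw [tile_mem_rotations_iff]
  simp only [mem_specialAfter_iff, rotate_base_zero, rotate_base_one,
    rotate_base_two, rotate_dir, tile_base_zero, tile_base_one, tile_base_two, tile_dir]
  have h3 : ∀ d : Fin 3, d = 0 ∨ d = 1 ∨ d = 2 := by decide
  rcases h3 d with rfl | rfl | rfl <;> simp <;> omega

theorem exists_one_le_of_mem_rotations {A : Set Rhombus} (hA : ∀ ρ ∈ A, ∃ i, 1 ≤ ρ.base i)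
    {ρ : Rhombus} (hρ : ρ ∈ rotations A) : ∃ i, 1 ≤ ρ.base i := by
  have key : ∀ ρ : Rhombus, (∃ i, 1 ≤ ρ.rotate.base i) → ∃ i, 1 ≤ ρ.base i :=
    fun ρ ⟨i, hi⟩ => ⟨_, hi⟩
  rcases hρ with h | h | h
  · exact hA _ h
  · exact key _ (hA _ h)
  · exact key _ (key _ (hA _ h))

theorem exists_one_le_of_mem_flipBefore {m h : ℕ} (hs' : m = 0 → 2 ≤ h) {ρ : Rhombus}
    (hρ : ρ ∈ flipBefore (latticePoint m h)) : ∃ i, 1 ≤ ρ.base i := by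
  rw [mem_flipBefore_iff (sum_latticePoint m h)] at hρ
  have e0 : latticePoint m h 0 = m + 1 := rfl
  have e2 : latticePoint m h 2 = 1 - h := rfl
  rw [e0, e2] at hρ
  have h1 := ρ.base_one
  by_cases h2 : 1 ≤ ρ.base 0
  · exact ⟨0, h2⟩
  · exact ⟨1, by omega⟩

theorem exists_one_le_of_mem_flipAfter {m h : ℕ} (hs' : m = 0 → 2 ≤ h) {ρ : Rhombus}
    (hρ : ρ ∈ flipAfter (latticePoint m h)) : ∃ i, 1 ≤ ρ.base i := by
  rw [mem_flipAfter_iff (sum_latticePoint m h)] at hρ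
  have e0 : latticePoint m h 0 = m + 1 := rfl
  have e2 : latticePoint m h 2 = 1 - h := rfl
  rw [e0, e2] at hρ
  have h1 := ρ.base_one
  by_cases h2 : 1 ≤ ρ.base 0
  · exact ⟨0, h2⟩
  · exact ⟨1, by omega⟩

theorem rotate_mem_flipBefore_iff {p : Fin 3 → ℤ} (hp : ∑ i, p i = 1) {ρ : Rhombus} :
    ρ.rotate ∈ flipBefore (p ∘ finRotate 3) ↔ ρ ∈ flipBefore p := by
  have hp' : ∑ i, (p ∘ finRotate 3) i = 1 := by
    rw [← hp]
    exact Equiv.sum_comp (finRotate 3) p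
  rw [mem_flipBefore_iff hp, mem_flipBefore_iff hp']
  have e0 : (p ∘ finRotate 3) 0 = p 1 := rfl
  have e2 : (p ∘ finRotate 3) 2 = p 0 := rfl
  rw [e0, e2, rotate_dir, rotate_base_zero, rotate_base_two]
  have h1 := ρ.base_one
  rw [Fin.sum_univ_three] at hp
  have h3 : ∀ d : Fin 3, d = 0 ∨ d = 1 ∨ d = 2 := by decide
  rcases h3 ρ.dir with hd | hd | hd <;> rw [hd] <;> simp <;> omega

theorem rotate_mem_flipAfter_iff {p : Fin 3 → ℤ} (hp : ∑ i, p i = 1) {ρ : Rhombus} :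
    ρ.rotate ∈ flipAfter (p ∘ finRotate 3) ↔ ρ ∈ flipAfter p := by
  have hp' : ∑ i, (p ∘ finRotate 3) i = 1 := by
    rw [← hp]
    exact Equiv.sum_comp (finRotate 3) p
  rw [mem_flipAfter_iff hp, mem_flipAfter_iff hp']
  have e0 : (p ∘ finRotate 3) 0 = p 1 := rfl
  have e2 : (p ∘ finRotate 3) 2 = p 0 := rfl
  rw [e0, e2, rotate_dir, rotate_base_zero, rotate_base_two]
  have h1 := ρ.base_one
  rw [Fin.sum_univ_three] at hp
  have h3 : ∀ d : Fin 3, d = 0 ∨ d = 1 ∨ d = 2 := by decide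
  rcases h3 ρ.dir with hd | hd | hd <;> rw [hd] <;> simp <;> omega

theorem rotations_eq_of_rotate_mem_iff {A B : Set Rhombus}
    (h : ∀ ρ : Rhombus, ρ.rotate ∈ B ↔ ρ ∈ A) : rotations B = rotations A := by
  ext ρ
  have h1 : ρ ∈ B ↔ ρ.rotate.rotate ∈ A := by rw [← h, rotate_rotate_rotate]
  simp only [rotations, Set.mem_ofPred_eq, h, h1]
  constructor
  · rintro (h | h | h)
    exacts [Or.inr (Or.inr h), Or.inl h, Or.inr (Or.inl h)]
  · rintro (h | h | h)
    exacts [Or.inr (Or.inl h), Or.inr (Or.inr h), Or.inl h]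

/-- Every lattice point that is not strictly inside the hole can be rotated into the fundamental
region. -/
theorem exists_latticePoint {p : Fin 3 → ℤ} (hp : ∑ i, p i = 1) :
    ∃ m h, 1 ≤ h ∧ rotations (flipBefore p) = rotations (flipBefore (latticePoint m h)) ∧
      rotations (flipAfter p) = rotations (flipAfter (latticePoint m h)) := by
  have key : ∀ q : Fin 3 → ℤ, ∑ i, q i = 1 → 1 ≤ q 0 → q 2 ≤ 0 →
      ∃ m h, 1 ≤ h ∧ q = latticePoint m h := by
    intro q hq h0 h2
    rw [Fin.sum_univ_three] at hq
    obtain ⟨m, hm⟩ := Int.eq_ofNat_of_zero_le (show 0 ≤ q 0 - 1 by omega)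
    obtain ⟨h, hh⟩ := Int.eq_ofNat_of_zero_le (show 0 ≤ 1 - q 2 by omega)
    refine ⟨m, h, by omega, ?_⟩
    funext i
    fin_cases i <;> simp [latticePoint] <;> omega
  have hp1 : ∑ i, (p ∘ finRotate 3) i = 1 := by
    rw [← hp]
    exact Equiv.sum_comp (finRotate 3) p
  have hp2 : ∑ i, ((p ∘ finRotate 3) ∘ finRotate 3) i = 1 := by
    rw [← hp1]
    exact Equiv.sum_comp (finRotate 3) (p ∘ finRotate 3)
  have e1 := rotations_eq_of_rotate_mem_iff fun ρ => rotate_mem_flipBefore_iff (ρ := ρ) hp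
  have e2 := rotations_eq_of_rotate_mem_iff fun ρ => rotate_mem_flipAfter_iff (ρ := ρ) hp
  have e3 := rotations_eq_of_rotate_mem_iff fun ρ => rotate_mem_flipBefore_iff (ρ := ρ) hp1
  have e4 := rotations_eq_of_rotate_mem_iff fun ρ => rotate_mem_flipAfter_iff (ρ := ρ) hp1
  have hex : ∃ i, 1 ≤ p i := by
    by_contra hc
    push Not at hc
    have h0 := hc 0
    have h1 := hc 1
    have h2 := hc 2
    rw [Fin.sum_univ_three] at hp
    omega
  rcases exists_rotation_of_exists_pos hp.le hex with h | h | h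
  · obtain ⟨m, k, hk, e⟩ := key p hp h.1 h.2
    exact ⟨m, k, hk, by rw [e], by rw [e]⟩
  · obtain ⟨m, k, hk, e⟩ := key _ hp1 h.1 h.2
    exact ⟨m, k, hk, by rw [← e, e1], by rw [← e, e2]⟩
  · obtain ⟨m, k, hk, e⟩ := key _ hp2 h.1 h.2
    exact ⟨m, k, hk, by rw [← e, e3, e1], by rw [← e, e4, e2]⟩

namespace CyclicTiling

variable {n : ℕ}

/-- Replacement can be tested on the rhombi of the fundamental region. -/
theorem replace_of_tile {A B : Set Rhombus} {T U : CyclicTiling n}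
    (hA : ∀ ρ ∈ A, ∃ i, 1 ≤ ρ.base i) (hB : ∀ ρ ∈ B, ∃ i, 1 ≤ ρ.base i)
    (h1 : ∀ m h d, tile m h d ∈ rotations A → tile m h d ∈ T.tiles)
    (h2 : ∀ m h d, tile m h d ∈ U.tiles ↔
      (tile m h d ∈ T.tiles ∧ tile m h d ∉ rotations A) ∨ tile m h d ∈ rotations B) :
    Replace A B T U := by
  constructor
  · intro ρ hρ
    obtain ⟨m, h, d, e⟩ := exists_rotation_eq_tile (exists_one_le_of_mem_rotations hA hρ)
    rcases e with e | e | e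
    · rw [e] at hρ ⊢
      exact h1 _ _ _ hρ
    · rw [← rotate_mem_rotations_iff, e] at hρ
      rw [← T.rotate_mem_iff, e]
      exact h1 _ _ _ hρ
    · rw [← rotate_mem_rotations_iff, ← rotate_mem_rotations_iff, e] at hρ
      rw [← T.rotate_mem_iff, ← T.rotate_mem_iff, e]
      exact h1 _ _ _ hρ
  · refine set_ext_of_tile (fun _ => U.rotate_mem_iff) (fun ρ => ?_)
      (fun _ => U.exists_one_le_base) ?_ h2
    · simp only [Set.mem_union, Set.mem_sdiff, rotate_mem_rotations_iff, T.rotate_mem_iff]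
    · rintro ρ (h | h)
      · exact T.exists_one_le_base h.1
      · exact exists_one_le_of_mem_rotations hB h

theorem replace_unique {A B : Set Rhombus} {T U U' : CyclicTiling n} (h : Replace A B T U)
    (h' : Replace A B T U') : U = U' :=
  CyclicTiling.ext (h.2.trans h'.2.symm)

end CyclicTiling

namespace HeightArray

variable {n : ℕ}

theorem local_bounds (N : HeightArray n) (a b : ℕ) :
    N (a + 1) (b + 1) ≤ N a (b + 1) ∧ N a (b + 1) ≤ N a b ∧ N a b ≤ N (a + 1) (b + 1) + 1 :=
  ⟨N.succ_left_le a (b + 1), N.succ_right_le a b, N.le_succ_succ a b⟩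

theorem fin_three_cases (d : Fin 3) : d = 0 ∨ d = 1 ∨ d = 2 := by
  revert d
  decide

/-- Membership of `tile a b d` depends only on the heights at `(a, b)`, `(a, b + 1)` and `(a + 1, b
+ 1)`, so it is decided by which of these points are raised. The site on the hole, where more points
are glued, is excluded. -/
theorem AddAt.hasTile_iff {N N' : HeightArray n} {m h : ℕ} (H : AddAt N N' m h)
    (h3 : m = 0 → 3 ≤ h) (a b : ℕ) (d : Fin 3) :
    N'.HasTile a b d ↔
      (N.HasTile a b d ∧ tile a b d ∉ rotations (flipBefore (latticePoint m h))) ∨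
        tile a b d ∈ rotations (flipAfter (latticePoint m h)) := by
  rw [tile_mem_rotations_flipBefore_iff H.1.1, tile_mem_rotations_flipAfter_iff H.1.1]
  have hs := H.1.1
  have e1 := H.2 a b
  have e2 := H.2 a (b + 1)
  have e3 := H.2 (a + 1) (b + 1)
  have l := N.local_bounds a b
  have l' := N'.local_bounds a b
  have g1 : Glued m h a b ↔ (a = m ∧ b = h) ∨ (m = 0 ∧ b = 0 ∧ a + 2 = h) := by
    unfold Glued
    omega
  have g2 : Glued m h a (b + 1) ↔ (a = m ∧ b + 1 = h) := by
    unfold Glued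
    omega
  have g3 : Glued m h (a + 1) (b + 1) ↔ (a + 1 = m ∧ b + 1 = h) := by
    unfold Glued
    omega
  simp only [g1] at e1
  simp only [g2] at e2
  simp only [g3] at e3
  have hb : 1 ≤ N' m h := by
    have := H.apply_eq
    omega
  have hb1 := hb.trans (N'.le_left m h)
  have hb2 := hb.trans (N'.le_right m h)
  rcases fin_three_cases d with rfl | rfl | rfl
  · rw [hasTile_zero_iff, hasTile_zero_iff]
    simp
    split_ifs at e1 e2 e3 <;> omega
  · rw [hasTile_one_iff, hasTile_one_iff]
    simp
    split_ifs at e1 e2 e3 <;> omega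
  · rw [hasTile_two_iff, hasTile_two_iff]
    simp
    split_ifs at e1 e2 e3 <;> omega

theorem AddAt.hasTile_of_mem {N N' : HeightArray n} {m h : ℕ} (H : AddAt N N' m h)
    (h3 : m = 0 → 3 ≤ h) (a b : ℕ) (d : Fin 3)
    (hmem : tile a b d ∈ rotations (flipBefore (latticePoint m h))) : N.HasTile a b d := by
  rw [tile_mem_rotations_flipBefore_iff H.1.1] at hmem
  have hs := H.1.1
  have e1 := H.2 a b
  have e2 := H.2 a (b + 1)
  have e3 := H.2 (a + 1) (b + 1)
  have l := N.local_bounds a b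
  have l' := N'.local_bounds a b
  have g1 : Glued m h a b ↔ (a = m ∧ b = h) ∨ (m = 0 ∧ b = 0 ∧ a + 2 = h) := by
    unfold Glued
    omega
  have g2 : Glued m h a (b + 1) ↔ (a = m ∧ b + 1 = h) := by
    unfold Glued
    omega
  have g3 : Glued m h (a + 1) (b + 1) ↔ (a + 1 = m ∧ b + 1 = h) := by
    unfold Glued
    omega
  simp only [g1] at e1
  simp only [g2] at e2
  simp only [g3] at e3
  have hb : 1 ≤ N' m h := by
    have := H.apply_eq
    omega
  have hb1 := hb.trans (N'.le_left m h)
  have hb2 := hb.trans (N'.le_right m h)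
  rcases fin_three_cases d with rfl | rfl | rfl
  · rw [hasTile_zero_iff]
    simp at hmem
    split_ifs at e1 e2 e3 <;> omega
  · rw [hasTile_one_iff]
    simp at hmem
    split_ifs at e1 e2 e3 <;> omega
  · rw [hasTile_two_iff]
    simp at hmem
    split_ifs at e1 e2 e3 <;> omega

/-- At this site the points `(0, 0)`, `(0, 1)`, `(0, 2)` are raised together, which changes the
three rhombi along the side of the hole. -/
theorem AddAt.hasTile_iff_special {N N' : HeightArray n} (H : AddAt N N' 0 2)
    (a b : ℕ) (d : Fin 3) :
    (tile a b d ∈ rotations specialBefore → N.HasTile a b d) ∧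
    (N'.HasTile a b d ↔
      (N.HasTile a b d ∧ tile a b d ∉ rotations specialBefore) ∨
        tile a b d ∈ rotations specialAfter) := by
  rw [tile_mem_rotations_specialBefore_iff, tile_mem_rotations_specialAfter_iff]
  have e1 := H.2 a b
  have e2 := H.2 a (b + 1)
  have e3 := H.2 (a + 1) (b + 1)
  have l := N.local_bounds a b
  have l' := N'.local_bounds a b
  have g1 : Glued 0 2 a b ↔ (a = 0 ∧ b ≤ 2) := by
    unfold Glued
    omega
  have g2 : Glued 0 2 a (b + 1) ↔ (a = 0 ∧ b ≤ 1) := by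
    unfold Glued
    omega
  have g3 : ¬ Glued 0 2 (a + 1) (b + 1) := by
    unfold Glued
    omega
  simp only [g1] at e1
  simp only [g2] at e2
  simp only [g3, if_false] at e3
  have hb : 1 ≤ N' 0 2 := by
    have := H.apply_eq
    omega
  have hb1 := hb.trans (N'.le_left 0 2)
  have hb2 := hb.trans (N'.le_right 0 2)
  rcases fin_three_cases d with rfl | rfl | rfl
  · rw [hasTile_zero_iff, hasTile_zero_iff]
    simp
    split_ifs at e1 e2 <;> omega
  · rw [hasTile_one_iff, hasTile_one_iff]
    simp
    split_ifs at e1 e2 <;> omega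
  · rw [hasTile_two_iff, hasTile_two_iff]
    simp
    split_ifs at e1 e2 <;> omega

end HeightArray

namespace CyclicTiling

variable {n : ℕ}

open HeightArray

theorem replace_of_addAt {T U : CyclicTiling n} {m h : ℕ}
    (H : AddAt T.toHeightArray U.toHeightArray m h) (h3 : m = 0 → 3 ≤ h) :
    Replace (flipBefore (latticePoint m h)) (flipAfter (latticePoint m h)) T U := by
  refine replace_of_tile (fun ρ => exists_one_le_of_mem_flipBefore fun hm => by have := h3 hm; omega)
    (fun ρ => exists_one_le_of_mem_flipAfter fun hm => by have := h3 hm; omega) ?_ ?_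
  · intro a b d hmem
    rw [tile_mem_iff]
    exact H.hasTile_of_mem h3 a b d hmem
  · intro a b d
    rw [tile_mem_iff, tile_mem_iff]
    exact H.hasTile_iff h3 a b d

theorem replace_special_of_addAt {T U : CyclicTiling n}
    (H : AddAt T.toHeightArray U.toHeightArray 0 2) : Replace specialBefore specialAfter T U := by
  refine replace_of_tile (fun ρ hρ => ⟨0, ?_⟩) (fun ρ hρ => ⟨0, ?_⟩) ?_ ?_
  · rw [mem_specialBefore_iff] at hρ
    omega
  · rw [mem_specialAfter_iff] at hρ
    omega
  · intro a b d hmem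
    rw [tile_mem_iff]
    exact (H.hasTile_iff_special a b d).1 hmem
  · intro a b d
    rw [tile_mem_iff, tile_mem_iff]
    exact (H.hasTile_iff_special a b d).2

/-- The presence of the three rhombi yields the inequalities of `Addable`. Raising the site gives a
tiling that results from the same replacement, hence is `U`. -/
theorem exists_addAt_of_replace_flip {T U : CyclicTiling n} {p : Fin 3 → ℤ} (hp : ∑ i, p i = 1)
    (H : Replace (flipBefore p) (flipAfter p) T U) :
    ∃ m h, AddAt T.toHeightArray U.toHeightArray m h := by
  obtain ⟨m, h, hh, e1, e2⟩ := exists_latticePoint hp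
  have H' : Replace (flipBefore (latticePoint m h)) (flipAfter (latticePoint m h)) T U := by
    unfold Replace at *
    rwa [← e1, ← e2]
  have hmem : ∀ a b d, tile a b d ∈ rotations (flipBefore (latticePoint m h)) →
      tile a b d ∈ T.tiles := fun a b d hd => H'.1 hd
  simp only [tile_mem_rotations_flipBefore_iff hh] at hmem
  have t0 := hmem m (h - 1) 0 (Or.inl ⟨rfl, rfl, by omega⟩)
  have t1 := hmem m h 1 (Or.inr (Or.inl ⟨rfl, Or.inl ⟨rfl, rfl⟩⟩))
  -- The centre is not on the side of the hole, as the bottom rhombus of the hexagon would overlap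
  -- the hole.
  have h3 : m = 0 → 3 ≤ h := by
    rintro rfl
    have := T.two_le_of_tile_zero t0
    omega
  have hb := T.tile_bound t1
  rw [tile_mem_iff, hasTile_zero_iff, show h - 1 + 1 = h by omega] at t0
  rw [tile_mem_iff, hasTile_one_iff] at t1
  have hadd : T.toHeightArray.Addable m h := by
    refine ⟨⟨hh, fun hm => by have := h3 hm; omega⟩, fun _ => by omega, fun hm => ?_, by omega,
      fun hm => ?_, fun _ => hb.2⟩
    · have t2 := hmem (m - 1) (h - 1) 2 (Or.inr (Or.inr ⟨rfl, by omega, by omega⟩))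
      rw [tile_mem_iff, hasTile_two_iff, show h - 1 + 1 = h by omega,
        show m - 1 + 1 = m by omega] at t2
      omega
    · subst hm
      have := h3 rfl
      have t2 := hmem (h - 2) 0 1 (Or.inr (Or.inl ⟨rfl, Or.inr ⟨rfl, rfl, by omega⟩⟩))
      rw [tile_mem_iff, hasTile_one_iff, HeightArray.glue, show h - 2 + 2 = h by omega,
        show h - 2 + 1 = h - 1 by omega, zero_add] at t2
      omega
  obtain ⟨N', hN'⟩ := hadd.exists_addAt
  have hN'' : AddAt T.toHeightArray N'.toTiling.toHeightArray m h := by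
    rwa [toHeightArray_toTiling]
  rw [replace_unique H' (replace_of_addAt hN'' h3)]
  exact ⟨m, h, hN''⟩

theorem addAt_of_replace_special {T U : CyclicTiling n}
    (H : Replace specialBefore specialAfter T U) :
    AddAt T.toHeightArray U.toHeightArray 0 2 := by
  have hmem : ∀ a b d, tile a b d ∈ rotations specialBefore → tile a b d ∈ T.tiles :=
    fun a b d hd => H.1 hd
  simp only [tile_mem_rotations_specialBefore_iff] at hmem
  have t0 := hmem 0 0 1 ⟨rfl, rfl, by omega⟩
  have t2 := hmem 0 2 1 ⟨rfl, rfl, by omega⟩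
  have hb := T.tile_bound t2
  rw [tile_mem_iff, hasTile_one_iff, HeightArray.glue] at t0
  rw [tile_mem_iff, hasTile_one_iff] at t2
  have hadd : T.toHeightArray.Addable 0 2 :=
    ⟨⟨by omega, by omega⟩, fun h => absurd ⟨rfl, rfl⟩ h, by omega, t2.2.le,
      fun _ => t0.2.le, fun _ => hb.2⟩
  obtain ⟨N', hN'⟩ := hadd.exists_addAt
  have hN'' : AddAt T.toHeightArray N'.toTiling.toHeightArray 0 2 := by
    rwa [toHeightArray_toTiling]
  rwa [replace_unique H (replace_special_of_addAt hN'')]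

/-- Local moves correspond to covering relations. -/
theorem move_iff {T U : CyclicTiling n} : T.Move U ↔ T.toHeightArray ⋖ U.toHeightArray := by
  rw [covBy_iff]
  constructor
  · rintro (⟨p, hp, H⟩ | H)
    · exact exists_addAt_of_replace_flip hp H
    · exact ⟨0, 2, addAt_of_replace_special H⟩
  · rintro ⟨m, h, H⟩
    by_cases h2 : m = 0 ∧ h = 2
    · obtain ⟨rfl, rfl⟩ := h2
      exact Or.inr (replace_special_of_addAt H)
    · have := H.1.2
      exact Or.inl ⟨latticePoint m h, sum_latticePoint m h, replace_of_addAt H fun hm => by omega⟩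

/-! ### Reflections of tilings -/

theorem mem_reflect_iff (T : CyclicTiling n) (k : Fin 3) {ρ : Rhombus} :
    ρ ∈ (T.reflect k).tiles ↔ ρ.reflect k ∈ T.tiles := by
  change ρ ∈ Rhombus.reflect k '' T.tiles ↔ _
  constructor
  · rintro ⟨σ, hσ, rfl⟩
    rwa [Rhombus.reflect_reflect]
  · intro h
    exact ⟨_, h, Rhombus.reflect_reflect k ρ⟩

theorem reflect_dir (k : Fin 3) (ρ : Rhombus) :
    (ρ.reflect k).dir = Equiv.swap (k + 1) (k + 2) ρ.dir := by
  change (Equiv.swap (k + 1) (k + 2)).symm ρ.dir = _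
  rw [Equiv.symm_swap]

/-- The reflections differ by rotations. -/
theorem rotate_reflect_eq (k : Fin 3) (ρ : Rhombus) :
    ∃ σ : Rhombus, σ = ρ.reflect (k + 1) ∧
      ((ρ.reflect k).rotate = σ ∨ (ρ.reflect k).rotate.rotate = σ) := by
  refine ⟨_, rfl, ?_⟩
  unfold Rhombus.reflect Rhombus.rotate
  rw [Rhombus.perm_perm, Rhombus.perm_perm]
  have : ∀ k : Fin 3, Equiv.swap (k + 1) (k + 2) * finRotate 3 =
      Equiv.swap (k + 1 + 1) (k + 1 + 2) ∨
      Equiv.swap (k + 1) (k + 2) * finRotate 3 * finRotate 3 =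
      Equiv.swap (k + 1 + 1) (k + 1 + 2) := by decide
  rcases this k with h | h <;> rw [h] <;> simp

theorem reflect_eq_reflect_succ (T : CyclicTiling n) (k : Fin 3) :
    T.reflect (k + 1) = T.reflect k := by
  apply CyclicTiling.ext
  ext ρ
  rw [mem_reflect_iff, mem_reflect_iff]
  obtain ⟨σ, rfl, h | h⟩ := rotate_reflect_eq k ρ
  · rw [← h, T.rotate_mem_iff]
  · rw [← h, T.rotate_mem_iff, T.rotate_mem_iff]

theorem reflect_eq_reflect_one (T : CyclicTiling n) (k : Fin 3) : T.reflect k = T.reflect 1 := by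
  rcases fin_three_cases k with rfl | rfl | rfl
  · exact (T.reflect_eq_reflect_succ 0).symm
  · rfl
  · exact T.reflect_eq_reflect_succ 1

/-- By rotational symmetry one axis suffices. A reflected rhombus is rotated back into the
fundamental region; this exchanges two directions and fixes the third, matching the formulas of
`HeightArray.reflect`. -/
theorem reflect_toHeightArray (T : CyclicTiling n) (k : Fin 3) :
    (T.reflect k).toHeightArray = T.toHeightArray.reflect := by
  rw [reflect_eq_reflect_one]
  suffices h : T.reflect 1 = T.toHeightArray.reflect.toTiling by
    rw [h, toHeightArray_toTiling]
  apply ext_tile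
  intro m h d
  rw [mem_reflect_iff, tile_mem_toTiling_iff]
  obtain ⟨N, hN⟩ : ∃ N, N = T.toHeightArray := ⟨_, rfl⟩
  have hd := reflect_dir 1 (tile m h d)
  rw [tile_dir] at hd
  -- The reflected base is `(-h, h - m - 1, m + 1)`; the sign of its middle coordinate decides
  -- whether two rotations or one are needed.
  by_cases hh : h ≤ m + 1
  · have e : ((tile m h d).reflect 1).rotate.rotate =
        tile m (m + 1 - h) (Equiv.swap (1 + 1) (1 + 2) d + 2 + 2) := by
      rw [eq_tile_iff, rotate_dir, rotate_dir, hd]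
      refine ⟨?_, ?_, rfl⟩
      · change (m : ℤ) + 1 = m + 1
        rfl
      · change (h : ℤ) - m - 1 = _
        push_cast [hh]
        ring
    rw [← T.rotate_mem_iff, ← T.rotate_mem_iff, e, tile_mem_iff, ← hN]
    have r1 := N.reflect_apply_of_le (m := m) (h := h) (by omega)
    have r2 := N.reflect_apply_of_le (m := m) (h := h + 1) (by omega)
    have r3 := N.reflect_apply_of_le (m := m + 1) (h := h + 1) (by omega)
    rw [show m + 2 - h = m + 1 - h + 1 by omega] at r1
    rw [show m + 2 - (h + 1) = m + 1 - h by omega] at r2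
    rw [show m + 1 + 2 - (h + 1) = m + 1 - h + 1 by omega] at r3
    have l := N.local_bounds m (m + 1 - h)
    have b1 := N.le_left m (m + 1 - h)
    have b2 := N.le_left m (m + 1 - h + 1)
    have b3 := N.le_left (m + 1) (m + 1 - h + 1)
    rcases fin_three_cases d with rfl | rfl | rfl
    · rw [show Equiv.swap (1 + 1) (1 + 2) (0 : Fin 3) + 2 + 2 = 0 by decide, hasTile_zero_iff,
        hasTile_zero_iff]
      omega
    · rw [show Equiv.swap (1 + 1) (1 + 2) (1 : Fin 3) + 2 + 2 = 2 by decide, hasTile_one_iff,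
        hasTile_two_iff]
      omega
    · rw [show Equiv.swap (1 + 1) (1 + 2) (2 : Fin 3) + 2 + 2 = 1 by decide, hasTile_one_iff,
        hasTile_two_iff]
      omega
  · have e : ((tile m h d).reflect 1).rotate =
        tile (h - m - 2) h (Equiv.swap (1 + 1) (1 + 2) d + 2) := by
      rw [eq_tile_iff, rotate_dir, hd]
      refine ⟨?_, ?_, rfl⟩
      · change (h : ℤ) - m - 1 = _
        rw [Nat.sub_sub]
        push_cast [show m + 2 ≤ h by omega]
        ring
      · rfl
    rw [← T.rotate_mem_iff, e, tile_mem_iff, ← hN]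
    have r1 := N.reflect_apply_of_ge (m := m) (h := h) (by omega)
    have r2 := N.reflect_apply_of_ge (m := m) (h := h + 1) (by omega)
    have r3 := N.reflect_apply_of_ge (m := m + 1) (h := h + 1) (by omega)
    rw [show h + 1 - m - 2 = h - m - 2 + 1 by omega] at r2
    rw [show h + 1 - (m + 1) - 2 = h - m - 2 by omega] at r3
    have l := N.local_bounds (h - m - 2) h
    have b1 := N.le_right (h - m - 2) h
    have b2 := N.le_right (h - m - 2) (h + 1)
    have b3 := N.le_right (h - m - 2 + 1) (h + 1)
    rcases fin_three_cases d with rfl | rfl | rfl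
    · rw [show Equiv.swap (1 + 1) (1 + 2) (0 : Fin 3) + 2 = 1 by decide, hasTile_zero_iff,
        hasTile_one_iff]
      omega
    · rw [show Equiv.swap (1 + 1) (1 + 2) (1 : Fin 3) + 2 = 0 by decide, hasTile_one_iff,
        hasTile_zero_iff]
      omega
    · rw [show Equiv.swap (1 + 1) (1 + 2) (2 : Fin 3) + 2 = 2 by decide, hasTile_two_iff,
        hasTile_two_iff]
      omega

end CyclicTiling

end

/-! ### From covers to the whole order, and transport to descending plane partitions. -/

theorem HeightArray.le_iff_reflTransGen_covBy {n : ℕ} {M N : HeightArray n} :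
    M ≤ N ↔ Relation.ReflTransGen (· ⋖ ·) M N := by
  classical
  have := Fintype.ofFinite (HeightArray n)
  have : DecidableLE (HeightArray n) := Classical.decRel _
  have := Fintype.toLocallyFiniteOrder (α := HeightArray n)
  exact _root_.le_iff_reflTransGen_covBy

theorem CyclicTiling.moveLE_iff {n : ℕ} {T U : CyclicTiling n} :
    T.MoveLE U ↔ T.toHeightArray ≤ U.toHeightArray := by
  rw [HeightArray.le_iff_reflTransGen_covBy]
  have hsymm : ∀ V : CyclicTiling n, (HeightArray.tilingEquiv n).symm V.toHeightArray = V :=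
    (HeightArray.tilingEquiv n).symm_apply_apply
  have happly : ∀ K : HeightArray n, ((HeightArray.tilingEquiv n).symm K).toHeightArray = K :=
    (HeightArray.tilingEquiv n).apply_symm_apply
  refine ⟨fun h => ?_, fun h => ?_⟩
  · exact Relation.ReflTransGen.lift toHeightArray (fun _ _ => move_iff.1) _ _ h
  · have h' := Relation.ReflTransGen.lift (p := Move) (HeightArray.tilingEquiv n).symm
      (fun M N hMN => by rwa [Function.onFun, move_iff, happly, happly]) _ _ h
    simp only [Function.onFun, hsymm] at h'
    exact h'

namespace BoundedDPP

variable {n : ℕ}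

theorem exists_isLUB (π σ : BoundedDPP n) : ∃ ρ, IsLUB {π, σ} ρ := by
  obtain ⟨M, rfl⟩ := (HeightArray.dppIso n).surjective π
  obtain ⟨N, rfl⟩ := (HeightArray.dppIso n).surjective σ
  rw [← Set.image_pair]
  exact ⟨_, (HeightArray.dppIso n).isLUB_image'.2 isLUB_pair⟩

theorem exists_isGLB (π σ : BoundedDPP n) : ∃ ρ, IsGLB {π, σ} ρ := by
  obtain ⟨M, rfl⟩ := (HeightArray.dppIso n).surjective π
  obtain ⟨N, rfl⟩ := (HeightArray.dppIso n).surjective σ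
  rw [← Set.image_pair]
  exact ⟨_, (HeightArray.dppIso n).isGLB_image'.2 isGLB_pair⟩

/-- The antiautomorphism of descending plane partitions given by the reflection of height arrays. -/
def reflectIso (n : ℕ) : BoundedDPP n ≃o (BoundedDPP n)ᵒᵈ :=
  (HeightArray.dppIso n).symm.trans
    (HeightArray.reflectIso.trans (HeightArray.dppIso n).dual)

theorem reflectIso_toDPP (N : HeightArray n) :
    reflectIso n N.toDPP = OrderDual.toDual N.reflect.toDPP := by
  have h : (HeightArray.dppIso n).symm N.toDPP = N := (HeightArray.dppIso n).symm_apply_apply N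
  rw [reflectIso, OrderIso.trans_apply, h]
  rfl

/-- Following `τ` by the inverse of the reflection gives an automorphism, which is trivial by
rigidity. -/
theorem eq_reflectIso (τ : BoundedDPP n ≃o (BoundedDPP n)ᵒᵈ) : τ = reflectIso n := by
  refine OrderIso.ext (funext fun π => ?_)
  have h := HeightArray.apply_eq ((HeightArray.dppIso n).trans
    (τ.trans ((reflectIso n).symm.trans (HeightArray.dppIso n).symm)))
    ((HeightArray.dppIso n).symm π)
  simp only [OrderIso.trans_apply, OrderIso.apply_symm_apply] at h
  exact ((reflectIso n).symm_apply_eq).1 ((HeightArray.dppIso n).symm.injective h)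

end BoundedDPP

theorem mainTheorem2 (n : ℕ) (hn : 1 ≤ n) :
    -- the order on descending plane partitions with entries `≤ n` is a lattice
    (∀ π σ : BoundedDPP n, (∃ ρ, IsLUB {π, σ} ρ) ∧ (∃ ρ, IsGLB {π, σ} ρ)) ∧
    -- reading off the paths is a bijection that turns the order by moves into this order
    ∃ Φ : CyclicTiling n ≃ BoundedDPP n,
      (∀ T π, T.ReadsOff π ↔ Φ T = π) ∧
      (∀ T U, T.MoveLE U ↔ Φ T ≤ Φ U) ∧
      (∀ T U, T.Move U ↔ Φ T ⋖ Φ U) ∧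
      -- there is exactly one antiautomorphism, and it corresponds to each of the reflections
      ∃ τ : BoundedDPP n ≃o (BoundedDPP n)ᵒᵈ,
        (∀ τ' : BoundedDPP n ≃o (BoundedDPP n)ᵒᵈ, τ' = τ) ∧
        (∀ (k : Fin 3) (T : CyclicTiling n), OrderDual.ofDual (τ (Φ T)) = Φ (T.reflect k)) ∧
        ∀ π : BoundedDPP n,
          π.1.r n + (OrderDual.ofDual (τ π)).1.r n = n - 1 ∧
          (OrderDual.ofDual (τ π)).1.s = π.1.s ∧
          π.1.i + (OrderDual.ofDual (τ π)).1.i = n.choose 2 + π.1.s := by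
  refine ⟨fun π σ => ⟨π.exists_isLUB σ, π.exists_isGLB σ⟩,
    (HeightArray.tilingEquiv n).trans (HeightArray.dppIso n).toEquiv,
    fun T π => T.readsOff_iff π, fun T U => ?_, fun T U => ?_,
    BoundedDPP.reflectIso n, BoundedDPP.eq_reflectIso, fun k T => ?_, fun π => ?_⟩
  · exact CyclicTiling.moveLE_iff.trans (HeightArray.dppIso n).le_iff_le.symm
  · exact CyclicTiling.move_iff.trans (apply_covBy_apply_iff (HeightArray.dppIso n)).symm
  · have h := BoundedDPP.reflectIso_toDPP T.toHeightArray
    rw [← T.reflect_toHeightArray k] at h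
    exact congrArg OrderDual.ofDual h
  · obtain ⟨N, rfl⟩ : ∃ N : HeightArray n, N.toDPP = π := (HeightArray.dppIso n).surjective π
    rw [BoundedDPP.reflectIso_toDPP]
    exact ⟨N.r_reflect hn, N.s_reflect, N.i_reflect⟩
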